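/- **Setting.** Let $d\ge 2$, let $k\ge 1$ be odd, let $\Omega\subset\mathbb R^d$ be a bounded, open, connected set with $\Omega=\operatorname{int}\overline\Omega$ (for example a bounded Lipschitz polytope domain), and let $\mathcal T$ be a finite conforming simplicial mesh with $\bigcup_{K\in\mathcal T}K=\overline\Omega$ that contains more than one simplex. Let $\mathcal S$ be the set of all faces of simplices of $\mathcal T$, $\mathcal F$ the set of $(d-1)$-dimensional facets, $\mathcal F(K)$ the set of facets of $K$, and let a subscript $\partial\Omega$ (resp. $\Omega$) select the entities that are (resp. are not) contained in $\partial\Omega$. $\lambda_{K,z}$ is the barycentric coordinate of $K\in\mathcal T$ for its vertex $z$, $\lambda_{K,F}$ the one for the vertex opposite to $F\in\mathcal F(K)$, and $P_n^{(a,b)}$ is the Jacobi polynomial. *Spaces.* Set $$B_k^{CR,K}:=\tfrac1d\Bigl(-1+\sum_{z\in\mathcal V(K)}P_k^{(0,d-2)}(1-2\lambda_{K,z})\Bigr)\ \text{ on }K,$$ $B_k^{CR,F}:=P_k^{(0,d-2)}(1-2\lambda_{K,F})-B_k^{CR,K}$ on each $K\in\mathcal T$ with $F\subset K$, and $B_k^{CR,F}:=0$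 on the other simplices. Let $S_k(\mathcal T)$ be the space of continuous functions on $\overline\Omega$ that are polynomials of degree at most $k$ on each simplex, $S_{k,0}(\mathcal T)=S_k(\mathcal T)\cap H_0^1(\Omega)$, and (recall that $k$ is odd) $$CR_k(\mathcal T)=S_k(\mathcal T)+\operatorname{span}\{B_k^{CR,F}:F\in\mathcal F\},\qquad CR_{k,0}(\mathcal T)=S_{k,0}(\mathcal T)+\operatorname{span}\{B_k^{CR,F}:F\in\mathcal F_\Omega\},$$ as subspaces of $L^2(\Omega)$. *Conforming basis functions.* Let $\mathcal I_k$ be the set of all $(\tau,\alpha)$ with $\tau\in\mathcal S$ of dimension $\ell$, $1\le\ell\le\min\{k-1,d\}$, and $\alpha\in\mathbb N_0^\ell$ with $|\alpha|\le k-\ell-1$; $\mathcal I_{k,\Omega}$ and $\mathcal I_{k,\partial\Omega}$ select $\tau\in\mathcal S_\Omega$ and $\tau\in\mathcal S_{\partial\Omega}$, and $\mathcal I_k(\sigma)$ selects $\tau\subset\sigma$. Fix an arbitrary numbering $A_0(\tau),\dots,A_\ell(\tau)$ of the vertices of each face $\tau$, let $\varphi_z$ be the piecewise affine hat function of the vertex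 $z$, and put $B_{\tau,\alpha}:=\bigl(\prod_{z\in\mathcal V(\tau)}\varphi_z\bigr)\,P_\alpha^{\rm bary}(\varphi_{A_0(\tau)},\dots,\varphi_{A_\ell(\tau)})$ on the simplices that contain $\tau$ and $B_{\tau,\alpha}:=0$ on the others, where $$P_\alpha^{\rm bary}(y_0,\dots,y_\ell)=\prod_{j=1}^{\ell}\Bigl(y_0+\sum_{m=j}^{\ell}y_m\Bigr)^{\alpha_j}P_{\alpha_j}^{(s_j,1)}\Bigl(\tfrac{2y_j}{y_0+\sum_{m=j}^\ell y_m}-1\Bigr),\qquad s_j=2\sum_{m=j+1}^{\ell}\alpha_m+2(\ell-j)+1 .$$ *Degrees of freedom.* An admissible system of weights consists of the following. (a) For each $K\in\mathcal T$: functions $g^K_{\tau,\alpha}$ ($(\tau,\alpha)\in\mathcal I_k(K)$) and $g_F^{CR,K}$ ($F\in\mathcal F(K)$) in $L^2(K)$ whose functionals $J^K_{\tau,\alpha}u=(g^K_{\tau,\alpha},u)_{L^2(K)}$, $J_F^{CR,K}u=(g_F^{CR,K},u)_{L^2(K)}$ are bidual to the functions $B_{t,\beta}|_K$ ($(t,\beta)\in\mathcal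 I_k(K)$), $B_k^{CR,F}|_K$ ($F\in\mathcal F(K)$). (b) For each $F\in\mathcal F_{\partial\Omega}$ with adjacent simplex $K$: functions $g^F_{\tau,\alpha}$ ($(\tau,\alpha)\in\mathcal I_k(F)$) and $g_{F'}^{CR,F}$ ($F'\in\mathcal F(K)\cap\mathcal F_{\partial\Omega}$) in $L^2(F)$ whose functionals $J^F_{\tau,\alpha}u=(g^F_{\tau,\alpha},u)_{L^2(F)}$, $J_{F'}^{CR,F}u=(g_{F'}^{CR,F},u)_{L^2(F)}$ are bidual to the functions $B_{t,\beta}|_K|_F$ ($(t,\beta)\in\mathcal I_k(F)$), $B_k^{CR,F'}|_K|_F$ ($F'\in\mathcal F(K)\cap\mathcal F_{\partial\Omega}$), and such that in addition $J^F_{\tau,\alpha}$ ($(\tau,\alpha)\in\mathcal I_k(F)$) and $J_F^{CR,F}$ vanish on $B_k^{CR,F''}|_K|_F$ for all $F''\in\mathcal F(K)\cap\mathcal F_\Omega$. On $H^1(\Omega)+CR_k(\mathcal T)$ the functionals in (b) act on the $L^2(F)$-trace of $u|_K$. Let $\operatorname{mark}$ assign to each $\tau\in\mathcal S_\Omega$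 a simplex of $\mathcal T$ that contains $\tau$ and to each $\tau\in\mathcal S_{\partial\Omega}$ a facet in $\mathcal F_{\partial\Omega}$ that contains $\tau$. The quasi-interpolation operator is $$I_{\mathcal T,k}u=\sum_{(\tau,\alpha)\in\mathcal I_{k,\Omega}}(J^{K}_{\tau,\alpha}u)B_{\tau,\alpha}+\sum_{F\in\mathcal F_\Omega}(J_F^{CR,K}u)B_k^{CR,F}+\sum_{(\tau,\alpha)\in\mathcal I_{k,\partial\Omega}}(J^{F}_{\tau,\alpha}u)B_{\tau,\alpha}+\sum_{F\in\mathcal F_{\partial\Omega}}(J_F^{CR,F}u)B_k^{CR,F},$$ where $K=\operatorname{mark}(\tau)$, $K=\operatorname{mark}(F)$ and $F=\operatorname{mark}(\tau)$ in the first three sums, respectively. **Lemma.** For every choice of the numbering, admissible systems of weights exist, and every $u\in H^1(\Omega)+CR_k(\mathcal T)$ has a unique $L^2(F)$-trace on each $F\in\mathcal F_{\partial\Omega}$. For every admissible system of weights and every assignment function $\operatorname{mark}$: 1. $I_{\mathcal T,k}$ is a linear projection of $H^1(\Omega)+CR_k(\mathcal T)$ onto $CR_k(\mathcal T)$: it is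 linear, has values in $CR_k(\mathcal T)$, and $I_{\mathcal T,k}u=u$ for all $u\in CR_k(\mathcal T)$. 2. $I_{\mathcal T,k}$ maps $H_0^1(\Omega)+CR_{k,0}(\mathcal T)$ into $CR_{k,0}(\mathcal T)$. 3. For all $u\in H_0^1(\Omega)+CR_{k,0}(\mathcal T)$, $$I_{\mathcal T,k}u=\sum_{(\tau,\alpha)\in\mathcal I_{k,\Omega}}(J^{K}_{\tau,\alpha}u)B_{\tau,\alpha}+\sum_{F\in\mathcal F_\Omega}(J_F^{CR,K}u)B_k^{CR,F}.$$ -/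

import Mathlib

open MeasureTheory
open scoped ContDiff ENNReal

noncomputable section

namespace CrouzeixRaviart

open scoped Classical

/-- The Euclidean space `ℝ^d`. -/
abbrev Space (d : ℕ) : Type := EuclideanSpace ℝ (Fin d)

/-- The real Hilbert space `L²(Ω)`. -/
abbrev L2 {d : ℕ} (Ω : Set (Space d)) : Type := Lp ℝ 2 (volume.restrict Ω)

/-! ### Sobolev spaces -/

/-- The classical partial derivative `∂_i φ`. -/
def pd {d : ℕ} (i : Fin d) (φ : Space d → ℝ) (x : Space d) : ℝ :=
  fderiv ℝ φ x (EuclideanSpace.single i 1)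

/-- `φ ∈ C_c^∞(Ω)`. -/
structure IsTest {d : ℕ} (Ω : Set (Space d)) (φ : Space d → ℝ) : Prop where
  smooth : ContDiff ℝ ∞ φ
  compact : HasCompactSupport φ
  supp : tsupport φ ⊆ Ω

theorem continuous_pd {d : ℕ} (i : Fin d) {φ : Space d → ℝ} (h : ContDiff ℝ ∞ φ) :
    Continuous (pd i φ) :=
  (h.continuous_fderiv (by simp)).clm_apply continuous_const

theorem IsTest.compact_pd {d : ℕ} {Ω : Set (Space d)} {φ : Space d → ℝ} (h : IsTest Ω φ)
    (i : Fin d) : HasCompactSupport (pd i φ) :=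
  (h.compact.fderiv (𝕜 := ℝ)).comp_left
    (g := fun L : Space d →L[ℝ] ℝ => L (EuclideanSpace.single i 1)) (by simp)

theorem integrable_mul_of_compact {d : ℕ} {Ω : Set (Space d)} (u : L2 Ω) {ψ : Space d → ℝ}
    (hc : Continuous ψ) (hs : HasCompactSupport ψ) :
    Integrable (fun x => u x * ψ x) (volume.restrict Ω) :=
  (Lp.memLp u).integrable_mul (q := 2) (hc.memLp_of_hasCompactSupport hs)

/-- The graph of the weak gradient on `L²(Ω)`: all pairs `(u, (g_i)_i)` in `L²` such that `g_i` is
the weak partial derivative of `u` in direction `i`. -/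
def weakGradGraph {d : ℕ} (Ω : Set (Space d)) : Submodule ℝ (L2 Ω × (Fin d → L2 Ω)) where
  carrier := {q | ∀ φ, IsTest Ω φ → ∀ i,
    ∫ x in Ω, q.1 x * pd i φ x = - ∫ x in Ω, q.2 i x * φ x}
  zero_mem' := by
    intro φ _ i
    have h1 : ∫ x in Ω, (0 : L2 Ω) x * pd i φ x = 0 := by
      refine integral_eq_zero_of_ae ?_
      filter_upwards [Lp.coeFn_zero ℝ 2 (volume.restrict Ω)] with x hx
      simp only [hx, Pi.zero_apply, zero_mul]
    have h2 : ∫ x in Ω, (0 : L2 Ω) x * φ x = 0 := by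
      refine integral_eq_zero_of_ae ?_
      filter_upwards [Lp.coeFn_zero ℝ 2 (volume.restrict Ω)] with x hx
      simp only [hx, Pi.zero_apply, zero_mul]
    simp only [Prod.fst_zero, Prod.snd_zero, Pi.zero_apply, h1, h2, neg_zero]
  add_mem' := by
    intro a b ha hb φ hφ i
    have key : ∀ (u v : L2 Ω) {ψ : Space d → ℝ}, Continuous ψ → HasCompactSupport ψ →
        ∫ x in Ω, (u + v) x * ψ x = (∫ x in Ω, u x * ψ x) + ∫ x in Ω, v x * ψ x := by
      intro u v ψ hc hs
      rw [← integral_add (integrable_mul_of_compact u hc hs) (integrable_mul_of_compact v hc hs)]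
      refine integral_congr_ae ?_
      filter_upwards [Lp.coeFn_add u v] with x hx
      rw [hx, Pi.add_apply, add_mul]
    simp only [Prod.fst_add, Prod.snd_add, Pi.add_apply]
    rw [key _ _ (continuous_pd i hφ.smooth) (hφ.compact_pd i),
      key _ _ hφ.smooth.continuous hφ.compact, ha φ hφ i, hb φ hφ i]
    ring
  smul_mem' := by
    intro c a ha φ hφ i
    have key : ∀ (u : L2 Ω) (ψ : Space d → ℝ),
        ∫ x in Ω, (c • u) x * ψ x = c * ∫ x in Ω, u x * ψ x := by
      intro u ψ
      rw [← integral_const_mul]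
      refine integral_congr_ae ?_
      filter_upwards [Lp.coeFn_smul c u] with x hx
      rw [hx, Pi.smul_apply, smul_eq_mul, mul_assoc]
    simp only [Prod.smul_fst, Prod.smul_snd, Pi.smul_apply]
    rw [key, key, ha φ hφ i]
    ring

/-- The Sobolev space `H¹(Ω)`. -/
def H1 {d : ℕ} (Ω : Set (Space d)) : Submodule ℝ (L2 Ω) :=
  (weakGradGraph Ω).map (LinearMap.fst ℝ (L2 Ω) (Fin d → L2 Ω))

/-- All pairs `(φ, ∇φ)` with `φ ∈ C_c^∞(Ω)`. -/
def testGraph {d : ℕ} (Ω : Set (Space d)) : Submodule ℝ (L2 Ω × (Fin d → L2 Ω)) where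
  carrier := {q | ∃ φ, IsTest Ω φ ∧ q.1 =ᵐ[volume.restrict Ω] φ ∧
    ∀ i, q.2 i =ᵐ[volume.restrict Ω] pd i φ}
  zero_mem' := by
    refine ⟨fun _ => 0, ⟨contDiff_const, HasCompactSupport.zero, by simp [tsupport]⟩,
      Lp.coeFn_zero _ _ _, fun i => ?_⟩
    filter_upwards [Lp.coeFn_zero ℝ 2 (volume.restrict Ω)] with x hx
    simp only [Prod.snd_zero, Pi.zero_apply, pd, fderiv_fun_const]
    exact hx
  add_mem' := by
    rintro a b ⟨φ, hφ, h1, h2⟩ ⟨ψ, hψ, h3, h4⟩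
    refine ⟨φ + ψ, ⟨hφ.smooth.add hψ.smooth, hφ.compact.add hψ.compact,
      (tsupport_add φ ψ).trans (Set.union_subset hφ.supp hψ.supp)⟩, ?_, fun i => ?_⟩
    · exact (Lp.coeFn_add _ _).trans (h1.add h3)
    · refine (Lp.coeFn_add _ _).trans (((h2 i).add (h4 i)).trans (Filter.Eventually.of_forall ?_))
      intro x
      have e1 : DifferentiableAt ℝ φ x := (hφ.smooth.differentiable (by simp)) x
      have e2 : DifferentiableAt ℝ ψ x := (hψ.smooth.differentiable (by simp)) x
      simp [pd, fderiv_add e1 e2]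
  smul_mem' := by
    rintro c a ⟨φ, hφ, h1, h2⟩
    refine ⟨c • φ, ⟨hφ.smooth.const_smul c, hφ.compact.smul_left (f := fun _ => c), ?_⟩,
      ?_, fun i => ?_⟩
    · exact (closure_mono (Function.support_const_smul_subset c φ)).trans hφ.supp
    · exact (Lp.coeFn_smul _ _).trans (h1.const_smul c)
    · refine (Lp.coeFn_smul _ _).trans (((h2 i).const_smul c).trans
        (Filter.Eventually.of_forall ?_))
      intro x
      have e1 : DifferentiableAt ℝ φ x := (hφ.smooth.differentiable (by simp)) x
      simp [pd, fderiv_const_smul e1]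

/-- The space `H¹₀(Ω)`: the closure of `C_c^∞(Ω)` with respect to the `H¹`-norm, i.e. the space of
all `u` such that some `(u, g)` is a limit of pairs `(φ, ∇φ)` with `φ ∈ C_c^∞(Ω)`. -/
def H10 {d : ℕ} (Ω : Set (Space d)) : Submodule ℝ (L2 Ω) :=
  (testGraph Ω).topologicalClosure.map (LinearMap.fst ℝ (L2 Ω) (Fin d → L2 Ω))

/-! ### Meshes -/

/-- A conforming simplicial mesh of `Ω`: a finite geometric simplicial complex (whose faces are
given through their vertex sets), each face of which lies in a `d`-simplex, and which covers the
closure of `Ω`. -/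
structure Mesh {d : ℕ} (Ω : Set (Space d)) where
  complex : Geometry.SimplicialComplex ℝ (Space d)
  finite : complex.faces.Finite
  pure : ∀ τ ∈ complex.faces, ∃ K ∈ complex.faces, τ ⊆ K ∧ K.card = d + 1
  space_eq : complex.space = closure Ω

/-- The closed simplex with the given vertex set. -/
abbrev hull {d : ℕ} (τ : Finset (Space d)) : Set (Space d) := convexHull ℝ (τ : Set (Space d))

namespace Mesh

variable {d : ℕ} {Ω : Set (Space d)} (T : Mesh Ω)

/-- All faces of the mesh, of dimensions `0, …, d`; a face with `ℓ + 1` vertices has dimension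
`ℓ`. -/
def faces : Finset (Finset (Space d)) := T.finite.toFinset

/-- The `d`-simplices of the mesh. -/
def cells : Finset (Finset (Space d)) := T.faces.filter fun K => K.card = d + 1

/-- The `(d-1)`-dimensional facets of the mesh. -/
def facets : Finset (Finset (Space d)) := T.faces.filter fun F => F.card = d

/-- The faces contained in `∂Ω`. -/
def bdryFaces : Finset (Finset (Space d)) := T.faces.filter fun τ => hull τ ⊆ frontier Ω

/-- The inner faces. -/
def innerFaces : Finset (Finset (Space d)) := T.faces \ T.bdryFaces

/-- The facets contained in `∂Ω`. -/
def bdryFacets : Finset (Finset (Space d)) := T.facets.filter fun F => hull F ⊆ frontier Ω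

/-- The inner facets. -/
def innerFacets : Finset (Finset (Space d)) := T.facets \ T.bdryFacets

end Mesh

/-! ### Jacobi polynomials and barycentric coordinates -/

/-- The Jacobi polynomial `P_n^{(a,b)}`. -/
def jacobi (a b n : ℕ) (t : ℝ) : ℝ :=
  ∑ s ∈ Finset.range (n + 1), ((n + a).choose (n - s) : ℝ) * ((n + b).choose s : ℝ) *
    ((t - 1) / 2) ^ s * ((t + 1) / 2) ^ (n - s)

/-- The polynomial `S^n P_n^{(a,b)}(2 y / S - 1)` in `(S, y)`. -/
def jacobiHom (a b n : ℕ) (S y : ℝ) : ℝ :=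
  ∑ s ∈ Finset.range (n + 1), ((n + a).choose (n - s) : ℝ) * ((n + b).choose s : ℝ) *
    (y - S) ^ s * y ^ (n - s)

theorem jacobiHom_eq (a b n : ℕ) {S : ℝ} (hS : S ≠ 0) (y : ℝ) :
    jacobiHom a b n S y = S ^ n * jacobi a b n (2 * y / S - 1) := by
  unfold jacobiHom jacobi
  rw [Finset.mul_sum]
  refine Finset.sum_congr rfl fun s hs => ?_
  have hsn : s ≤ n := Nat.lt_succ_iff.mp (Finset.mem_range.mp hs)
  have h1 : (2 * y / S - 1 - 1) / 2 = (y - S) / S := by field_simp; ring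
  have h2 : (2 * y / S - 1 + 1) / 2 = y / S := by field_simp; ring
  have h3 : S ^ n = S ^ s * S ^ (n - s) := by rw [← pow_add]; congr 1; omega
  rw [h1, h2, div_pow, div_pow, h3]
  field_simp

/-- The polynomial `P_α^{bary}(y_0, …, y_ℓ)`, that is
`∏_{j=1}^{ℓ} S_j^{α_j} P_{α_j}^{(s_j, 1)}(2 y_j / S_j - 1)` with `S_j = y_0 + ∑_{m=j}^{ℓ} y_m` and
`s_j = 2 ∑_{m=j+1}^{ℓ} α_m + 2 (ℓ - j) + 1`. In the code `j` runs from `0` to `ℓ - 1`. -/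
def baryPoly {ℓ : ℕ} (α : Fin ℓ → ℕ) (y : Fin (ℓ + 1) → ℝ) : ℝ :=
  ∏ j : Fin ℓ, jacobiHom (2 * (∑ m ∈ Finset.Ioi j, α m) + 2 * (ℓ - 1 - (j : ℕ)) + 1) 1 (α j)
    (y 0 + ∑ m ∈ Finset.Ici j, y m.succ) (y j.succ)

/-- The barycentric coordinate `λ_{K,z}` of a `d`-simplex `K`: the affine function with value `1` in
`z` and value `0` in the other vertices of `K`. (It vanishes identically if `z` is not a vertex.) -/
def bary {d : ℕ} (K : Finset (Space d)) (z : Space d) : Space d →ᵃ[ℝ] ℝ :=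
  if h : ∃ f : Space d →ᵃ[ℝ] ℝ, ∀ y ∈ K, f y = if y = z then 1 else 0 then h.choose else 0

theorem bary_apply {d : ℕ} {K : Finset (Space d)}
    (hK : AffineIndependent ℝ ((↑) : K → Space d)) (hc : K.card = d + 1) (z : Space d) :
    ∀ y ∈ K, bary K z y = if y = z then 1 else 0 := by
  have h : ∃ f : Space d →ᵃ[ℝ] ℝ, ∀ y ∈ K, f y = if y = z then 1 else 0 := by
    by_cases hz : z ∈ K
    · have htot : affineSpan ℝ (Set.range ((↑) : K → Space d)) = ⊤ := by
        rw [hK.affineSpan_eq_top_iff_card_eq_finrank_add_one]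
        simp [hc]
      let b : AffineBasis K ℝ (Space d) := ⟨(↑), hK, htot⟩
      refine ⟨b.coord ⟨z, hz⟩, fun y hy => ?_⟩
      have hb : b ⟨y, hy⟩ = y := rfl
      have := b.coord_apply ⟨z, hz⟩ ⟨y, hy⟩
      rw [hb] at this
      rw [this]
      by_cases hyz : y = z
      · simp [hyz]
      · simp [hyz, Ne.symm hyz]
    · refine ⟨0, fun y hy => ?_⟩
      have : y ≠ z := fun e => hz (e ▸ hy)
      simp [this]
  unfold bary
  rw [dif_pos h]
  exact h.choose_spec

theorem continuous_bary {d : ℕ} (K : Finset (Space d)) (z : Space d) :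
    Continuous fun x => bary K z x :=
  (bary K z).continuous_of_finiteDimensional

/-! ### Shape functions

A piecewise polynomial function is given by a family `p`, where `p K` is a polynomial on the whole
space which is used on the simplex `K` only. -/

/-- The shape function `B_k^{CR,K}` on `K`. -/
def simplexShape {d : ℕ} (k : ℕ) (K : Finset (Space d)) (x : Space d) : ℝ :=
  (1 / (d : ℝ)) * (-1 + ∑ z ∈ K, jacobi 0 (d - 2) k (1 - 2 * bary K z x))

/-- The restriction to `K'` of the non-conforming simplex function `B_k^{CR,K}`. -/
def simplexPiece {d : ℕ} (k : ℕ) (K K' : Finset (Space d)) (x : Space d) : ℝ :=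
  if K' = K then simplexShape k K x else 0

/-- `λ_{K,F}`: the barycentric coordinate of `K` for the vertex opposite to the facet `F` of `K`
(the only element of `K \ F`). -/
def facetBary {d : ℕ} (K F : Finset (Space d)) (x : Space d) : ℝ := ∑ z ∈ K \ F, bary K z x

/-- The restriction to `K` of the non-conforming facet function `B_k^{CR,F}`. -/
def facetPiece {d : ℕ} (k : ℕ) (F K : Finset (Space d)) (x : Space d) : ℝ :=
  if F ⊆ K then jacobi 0 (d - 2) k (1 - 2 * facetBary K F x) - simplexShape k K x else 0

/-- Pairs `(τ, α)` of a face `τ` and a multi-index `α ∈ ℕ₀^ℓ`, where `ℓ = dim τ`. -/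
abbrev Idx (d : ℕ) : Type := Σ τ : Finset (Space d), (Fin (τ.card - 1) → ℕ)

/-- A choice of vertices `A_0(τ), …, A_ℓ(τ)` for each finite set `τ`, where `ℓ = #τ - 1`. -/
abbrev Numbering (d : ℕ) : Type := ∀ τ : Finset (Space d), Fin (τ.card - 1 + 1) → Space d

/-- The restriction to `K` of the conforming basis function
`B_{τ,α} = W_τ P_α^{bary}(φ_{A_0(τ)}, …, φ_{A_ℓ(τ)})`, where the hat function `φ_z` coincides with
`λ_{K,z}` on `K` and `W_τ` is the face bubble. -/
def facePiece {d : ℕ} (A : Numbering d) (I : Idx d) (K : Finset (Space d)) (x : Space d) : ℝ :=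
  if I.1 ⊆ K then (∏ z ∈ I.1, bary K z x) * baryPoly I.2 (fun j => bary K (A I.1 j) x) else 0

theorem continuous_jacobi (a b n : ℕ) : Continuous (jacobi a b n) := by
  unfold jacobi; fun_prop

theorem continuous_simplexShape {d : ℕ} (k : ℕ) (K : Finset (Space d)) :
    Continuous (simplexShape k K) := by
  refine continuous_const.mul (continuous_const.add (continuous_finsetSum _ fun z _ => ?_))
  exact (continuous_jacobi 0 (d - 2) k).comp
    (continuous_const.sub (continuous_const.mul (continuous_bary K z)))

theorem continuous_simplexPiece {d : ℕ} (k : ℕ) (K K' : Finset (Space d)) :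
    Continuous (simplexPiece k K K') := by
  by_cases h : K' = K
  · have : simplexPiece k K K' = simplexShape k K := by funext x; simp [simplexPiece, h]
    rw [this]; exact continuous_simplexShape k K
  · have : simplexPiece k K K' = fun _ => 0 := by funext x; simp [simplexPiece, h]
    rw [this]; exact continuous_const

theorem continuous_facetPiece {d : ℕ} (k : ℕ) (F K : Finset (Space d)) :
    Continuous (facetPiece k F K) := by
  by_cases h : F ⊆ K
  · have : facetPiece k F K = fun x =>
        jacobi 0 (d - 2) k (1 - 2 * facetBary K F x) - simplexShape k K x := by
      funext x; simp [facetPiece, h]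
    rw [this]
    refine ((continuous_jacobi 0 (d - 2) k).comp
      (continuous_const.sub (continuous_const.mul ?_))).sub (continuous_simplexShape k K)
    exact continuous_finsetSum _ fun z _ => continuous_bary K z
  · have : facetPiece k F K = fun _ => 0 := by funext x; simp [facetPiece, h]
    rw [this]; exact continuous_const

theorem continuous_facePiece {d : ℕ} (A : Numbering d) (I : Idx d) (K : Finset (Space d)) :
    Continuous (facePiece A I K) := by
  by_cases h : I.1 ⊆ K
  · have : facePiece A I K = fun x =>
        (∏ z ∈ I.1, bary K z x) * baryPoly I.2 (fun j => bary K (A I.1 j) x) := by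
      funext x; simp [facePiece, h]
    rw [this]
    have hb : ∀ z, Continuous fun x => bary K z x := continuous_bary K
    unfold baryPoly jacobiHom
    fun_prop
  · have : facePiece A I K = fun _ => 0 := by funext x; simp [facePiece, h]
    rw [this]; exact continuous_const

namespace Mesh

variable {d : ℕ} {Ω : Set (Space d)} (T : Mesh Ω)

/-- The function which equals `p K` in the interior of each simplex `K` of the mesh. -/
def glueFun (p : Finset (Space d) → Space d → ℝ) (x : Space d) : ℝ :=
  ∑ K ∈ T.cells, (interior (hull K)).indicator (p K) x

theorem memLp_glueFun {p : Finset (Space d) → Space d → ℝ} (hp : ∀ K, Continuous (p K)) :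
    MemLp (T.glueFun p) 2 (volume.restrict Ω) := by
  have h : T.glueFun p = fun x => ∑ K ∈ T.cells, (interior (hull K)).indicator (p K) x := rfl
  rw [h]
  refine memLp_finsetSum _ fun K _ => ?_
  have hc : IsCompact (hull K) := (Finset.finite_toSet K).isCompact_convexHull (𝕜 := ℝ)
  have h1 : MemLp (p K) 2 (volume.restrict (hull K)) := by
    obtain ⟨C, hC⟩ := hc.exists_bound_of_continuousOn (hp K).continuousOn
    have : IsFiniteMeasure (volume.restrict (hull K)) :=
      isFiniteMeasure_restrict.2 hc.measure_lt_top.ne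
    exact MemLp.of_bound (hp K).aestronglyMeasurable C
      (ae_restrict_of_forall_mem hc.measurableSet hC)
  have h2 : MemLp ((interior (hull K)).indicator (p K)) 2 volume :=
    (memLp_indicator_iff_restrict isOpen_interior.measurableSet).2
      (h1.mono_measure (Measure.restrict_mono interior_subset le_rfl))
  exact h2.mono_measure Measure.restrict_le_self

/-- The element of `L²(Ω)` which equals `p K` on each simplex `K` of the mesh. -/
def glue (p : Finset (Space d) → Space d → ℝ) (hp : ∀ K, Continuous (p K)) : L2 Ω :=
  (T.memLp_glueFun hp).toLp (T.glueFun p)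

/-- The non-conforming simplex function `B_k^{CR,K}`. -/
def simplexFun (k : ℕ) (K : Finset (Space d)) : L2 Ω :=
  T.glue (simplexPiece k K) (continuous_simplexPiece k K)

/-- The non-conforming facet function `B_k^{CR,F}`. -/
def facetFun (k : ℕ) (F : Finset (Space d)) : L2 Ω :=
  T.glue (facetPiece k F) (continuous_facetPiece k F)

/-- The conforming basis function `B_{τ,α}`. -/
def faceFun (A : Numbering d) (I : Idx d) : L2 Ω :=
  T.glue (facePiece A I) (continuous_facePiece A I)

/-- `A` numbers the vertices of each face of the mesh. -/
def IsNumbering (A : Numbering d) : Prop :=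
  ∀ τ ∈ T.faces, Set.BijOn (A τ) Set.univ (τ : Set (Space d))

/-! ### Finite element spaces -/

/-- `S_k(𝒯)`: continuous functions on the closure of `Ω` whose restriction to each simplex is a
polynomial of degree at most `k`. -/
def conformingSpace (k : ℕ) : Submodule ℝ (L2 Ω) where
  carrier := {u | ∃ v : Space d → ℝ, ContinuousOn v (closure Ω) ∧
    (∀ K ∈ T.cells, ∃ q : MvPolynomial (Fin d) ℝ, q.totalDegree ≤ k ∧
      ∀ x ∈ hull K, v x = MvPolynomial.eval (fun i => x i) q) ∧
    u =ᵐ[volume.restrict Ω] v}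
  zero_mem' := ⟨fun _ => 0, continuousOn_const, fun K _ => ⟨0, by simp, by simp⟩,
    Lp.coeFn_zero _ _ _⟩
  add_mem' := by
    rintro a b ⟨v, hv, hvp, hva⟩ ⟨w, hw, hwp, hwa⟩
    refine ⟨v + w, hv.add hw, fun K hK => ?_, (Lp.coeFn_add _ _).trans (hva.add hwa)⟩
    obtain ⟨q, hq, hq'⟩ := hvp K hK
    obtain ⟨r, hr, hr'⟩ := hwp K hK
    exact ⟨q + r, (MvPolynomial.totalDegree_add q r).trans (max_le hq hr),
      fun x hx => by simp [hq' x hx, hr' x hx]⟩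
  smul_mem' := by
    rintro c a ⟨v, hv, hvp, hva⟩
    refine ⟨c • v, hv.const_smul c, fun K hK => ?_,
      (Lp.coeFn_smul _ _).trans (hva.const_smul c)⟩
    obtain ⟨q, hq, hq'⟩ := hvp K hK
    exact ⟨c • q, (MvPolynomial.totalDegree_smul_le c q).trans hq,
      fun x hx => by simp [hq' x hx]⟩

/-- `S_{k,0}(𝒯) = S_k(𝒯) ∩ H¹₀(Ω)`. -/
def conformingSpace0 (k : ℕ) : Submodule ℝ (L2 Ω) := T.conformingSpace k ⊓ H10 Ω

/-- The canonical Crouzeix-Raviart space `CR_k(𝒯)`. -/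
def CR (k : ℕ) : Submodule ℝ (L2 Ω) :=
  if Even k then T.conformingSpace k ⊔ Submodule.span ℝ (T.simplexFun k '' T.cells)
  else T.conformingSpace k ⊔ Submodule.span ℝ (T.facetFun k '' T.facets)

/-- The canonical Crouzeix-Raviart space `CR_{k,0}(𝒯)` with zero boundary conditions. -/
def CR0 (k : ℕ) : Submodule ℝ (L2 Ω) :=
  if Even k then T.conformingSpace0 k ⊔ Submodule.span ℝ (T.simplexFun k '' T.cells)
  else T.conformingSpace0 k ⊔ Submodule.span ℝ (T.facetFun k '' T.innerFacets)

/-! ### Index sets (for odd `k`) -/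

end Mesh

/-- The multi-indices `α ∈ ℕ₀^ℓ` with `|α| ≤ m`. -/
def multiIdx (ℓ m : ℕ) : Finset (Fin ℓ → ℕ) :=
  (Fintype.piFinset fun _ => Finset.range (m + 1)).filter fun α => ∑ j, α j ≤ m

namespace Mesh

variable {d : ℕ} {Ω : Set (Space d)} (T : Mesh Ω)

/-- The index set `𝓘_k` for odd `k`: all `(τ, α)` with a face `τ` of dimension
`ℓ ∈ {1, …, min (k - 1) d}` and `|α| ≤ k - (ℓ + 1)`; note that `#τ = ℓ + 1`. -/
def idx (k : ℕ) : Finset (Idx d) :=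
  (T.faces.filter fun τ => 2 ≤ τ.card ∧ τ.card ≤ k).sigma
    fun τ => multiIdx (τ.card - 1) (k - τ.card)

/-- `𝓘_{k,Ω}`. -/
def innerIdx (k : ℕ) : Finset (Idx d) := (T.idx k).filter fun I => I.1 ∈ T.innerFaces

/-- `𝓘_{k,∂Ω}`. -/
def bdryIdx (k : ℕ) : Finset (Idx d) := T.idx k \ T.innerIdx k

/-- `𝓘_k(K)` and `𝓘_k(F)`: the indices whose face is contained in `σ`. -/
def idxIn (k : ℕ) (σ : Finset (Space d)) : Finset (Idx d) := (T.idx k).filter fun I => I.1 ⊆ σ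

end Mesh

/-! ### Traces and degrees of freedom -/

/-- The surface measure on the facet `F`. -/
def facetMeasure {d : ℕ} (F : Finset (Space d)) : Measure (Space d) :=
  (Measure.euclideanHausdorffMeasure (d - 1)).restrict (hull F)

/-- `w ∈ L²(F)` is the trace on `F` of the restriction of `u` to the simplex `K`: the pair consisting
of `u` and `w` is a limit of pairs `(φ, φ|_F)` in `H¹(K) × L²(F)`, with `φ` smooth up to the
boundary of `K`. -/
def IsTraceFrom {d : ℕ} (K F : Finset (Space d)) (u w : Space d → ℝ) : Prop :=
  MemLp w 2 (facetMeasure F) ∧ ∃ g : Fin d → Space d → ℝ,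
    (∀ i, MemLp (g i) 2 (volume.restrict (hull K))) ∧
    ∀ ε : ℝ≥0∞, 0 < ε → ∃ φ : Space d → ℝ, ContDiff ℝ ∞ φ ∧
      eLpNorm (u - φ) 2 (volume.restrict (hull K)) < ε ∧
      (∀ i, eLpNorm (g i - pd i φ) 2 (volume.restrict (hull K)) < ε) ∧
      eLpNorm (w - φ) 2 (facetMeasure F) < ε

/-- The weight functions of the degrees of freedom. -/
structure Weights (d : ℕ) where
  /-- `g_{τ,α}^K` -/
  cellFace : Finset (Space d) → Idx d → Space d → ℝ
  /-- `g_F^{CR,K}` -/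
  cellFacet : Finset (Space d) → Finset (Space d) → Space d → ℝ
  /-- `g_{τ,α}^F` -/
  facetFace : Finset (Space d) → Idx d → Space d → ℝ
  /-- `g_{F'}^{CR,F}` (arguments `F`, `F'`) -/
  facetFacet : Finset (Space d) → Finset (Space d) → Space d → ℝ

namespace Mesh

variable {d : ℕ} {Ω : Set (Space d)} (T : Mesh Ω)

/-- `w` is the trace of `u` on the facet `F`, taken from an adjacent simplex of the mesh (which is
unique for boundary facets). -/
def IsTrace (F : Finset (Space d)) (u : L2 Ω) (w : Space d → ℝ) : Prop :=
  ∃ K ∈ T.cells, F ⊆ K ∧ IsTraceFrom K F u w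

/-- The trace of `u` on the facet `F`. -/
def trace (F : Finset (Space d)) (u : L2 Ω) : Space d → ℝ :=
  if h : ∃ w, T.IsTrace F u w then h.choose else 0

/-- The functional `u ↦ (g, u)_{L²(K)}`. -/
def cellDof (g : Space d → ℝ) (K : Finset (Space d)) (u : L2 Ω) : ℝ :=
  ∫ x in hull K, g x * u x

/-- The functional `u ↦ (g, u)_{L²(F)}`. -/
def facetDof (g : Space d → ℝ) (F : Finset (Space d)) (u : L2 Ω) : ℝ :=
  ∫ x, g x * T.trace F u x ∂(facetMeasure F)

/-- The weights `g_{τ,α}^K`, `g_F^{CR,K}` on the simplex `K` are in `L²(K)` and induce functionals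
that are bidual to `B_{t,β}|_K`, `(t,β) ∈ 𝓘_k(K)`, and `B_k^{CR,F}|_K`, `F` a facet of `K`. -/
structure IsBidualOnCell (k : ℕ) (A : Numbering d) (W : Weights d) (K : Finset (Space d)) :
    Prop where
  memLp_face : ∀ I ∈ T.idxIn k K, MemLp (W.cellFace K I) 2 (volume.restrict (hull K))
  memLp_facet : ∀ F ∈ T.facets, F ⊆ K → MemLp (W.cellFacet K F) 2 (volume.restrict (hull K))
  face_face : ∀ I ∈ T.idxIn k K, ∀ J ∈ T.idxIn k K,
    ∫ x in hull K, W.cellFace K I x * facePiece A J K x = if I = J then 1 else 0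
  face_facet : ∀ I ∈ T.idxIn k K, ∀ F ∈ T.facets, F ⊆ K →
    ∫ x in hull K, W.cellFace K I x * facetPiece k F K x = 0
  facet_face : ∀ F ∈ T.facets, F ⊆ K → ∀ J ∈ T.idxIn k K,
    ∫ x in hull K, W.cellFacet K F x * facePiece A J K x = 0
  facet_facet : ∀ F ∈ T.facets, F ⊆ K → ∀ F' ∈ T.facets, F' ⊆ K →
    ∫ x in hull K, W.cellFacet K F x * facetPiece k F' K x = if F = F' then 1 else 0

/-- The weights `g_{τ,α}^F`, `g_{F'}^{CR,F}` on the boundary facet `F` of the simplex `K` are in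
`L²(F)` and induce functionals `J_{τ,α}^F`, `(τ,α) ∈ 𝓘_k(F)`, and `J_{F'}^{CR,F}`, `F'` a boundary
facet of `K`, that are bidual to the restrictions to `F` of `B_{t,β}|_K`, `(t,β) ∈ 𝓘_k(F)`, and
`B_k^{CR,F'}|_K`, `F'` a boundary facet of `K`. Moreover, `J_{τ,α}^F` and `J_F^{CR,F}` vanish for
the facet functions of the inner facets of `K`. -/
structure IsBidualOnFacet (k : ℕ) (A : Numbering d) (W : Weights d) (K F : Finset (Space d)) :
    Prop where
  memLp_face : ∀ I ∈ T.idxIn k F, MemLp (W.facetFace F I) 2 (facetMeasure F)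
  memLp_facet : ∀ F' ∈ T.bdryFacets, F' ⊆ K → MemLp (W.facetFacet F F') 2 (facetMeasure F)
  face_face : ∀ I ∈ T.idxIn k F, ∀ J ∈ T.idxIn k F,
    ∫ x, W.facetFace F I x * facePiece A J K x ∂(facetMeasure F) = if I = J then 1 else 0
  face_facet : ∀ I ∈ T.idxIn k F, ∀ F' ∈ T.bdryFacets, F' ⊆ K →
    ∫ x, W.facetFace F I x * facetPiece k F' K x ∂(facetMeasure F) = 0
  facet_face : ∀ F' ∈ T.bdryFacets, F' ⊆ K → ∀ J ∈ T.idxIn k F,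
    ∫ x, W.facetFacet F F' x * facePiece A J K x ∂(facetMeasure F) = 0
  facet_facet : ∀ F' ∈ T.bdryFacets, F' ⊆ K → ∀ F'' ∈ T.bdryFacets, F'' ⊆ K →
    ∫ x, W.facetFacet F F' x * facetPiece k F'' K x ∂(facetMeasure F) = if F' = F'' then 1 else 0
  face_inner : ∀ I ∈ T.idxIn k F, ∀ F' ∈ T.innerFacets, F' ⊆ K →
    ∫ x, W.facetFace F I x * facetPiece k F' K x ∂(facetMeasure F) = 0
  facet_inner : ∀ F' ∈ T.innerFacets, F' ⊆ K →
    ∫ x, W.facetFacet F F x * facetPiece k F' K x ∂(facetMeasure F) = 0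

/-- `W` is an admissible system of weights: bidual on each simplex and on each boundary facet. -/
def IsBidual (k : ℕ) (A : Numbering d) (W : Weights d) : Prop :=
  (∀ K ∈ T.cells, T.IsBidualOnCell k A W K) ∧
  ∀ F ∈ T.bdryFacets, ∀ K ∈ T.cells, F ⊆ K → T.IsBidualOnFacet k A W K F

/-- `mark` is an assignment function: inner faces are assigned to a simplex, boundary faces to a
boundary facet that contains them. -/
def IsMark (mark : Finset (Space d) → Finset (Space d)) : Prop :=
  (∀ τ ∈ T.innerFaces, mark τ ∈ T.cells ∧ τ ⊆ mark τ) ∧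
  ∀ τ ∈ T.bdryFaces, mark τ ∈ T.bdryFacets ∧ τ ⊆ mark τ

/-- The part of the quasi-interpolant that belongs to the inner faces and inner facets. -/
def innerInterp (k : ℕ) (A : Numbering d) (W : Weights d)
    (mark : Finset (Space d) → Finset (Space d)) (u : L2 Ω) : L2 Ω :=
  (∑ I ∈ T.innerIdx k, cellDof (W.cellFace (mark I.1) I) (mark I.1) u • T.faceFun A I) +
  ∑ F ∈ T.innerFacets, cellDof (W.cellFacet (mark F) F) (mark F) u • T.facetFun k F

/-- The quasi-interpolant `I_{𝒯,k} u`. -/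
def interp (k : ℕ) (A : Numbering d) (W : Weights d)
    (mark : Finset (Space d) → Finset (Space d)) (u : L2 Ω) : L2 Ω :=
  T.innerInterp k A W mark u +
  (∑ I ∈ T.bdryIdx k, T.facetDof (W.facetFace (mark I.1) I) (mark I.1) u • T.faceFun A I) +
  ∑ F ∈ T.bdryFacets, T.facetDof (W.facetFacet F F) F u • T.facetFun k F

end Mesh

end CrouzeixRaviart

end

noncomputable section

namespace CrouzeixRaviart

open scoped Classical

section

/-! ### Linear independence of the barycentric Jacobi polynomials -/

section BaryPoly

open MvPolynomial

/-! Every functional in the operator reads off one coefficient. A weight on a simplex or on a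
boundary facet only sees basis functions that do not vanish there. Biduality, together with the
extra annihilation conditions on boundary facets, prescribes all of these values, so the operator
fixes each basis function (`Mesh.interp_faceFun`, `Mesh.interp_facetFun`). Since the basis functions
span `CR_k`, linearity gives the projection property (`Mesh.interp_eq_self`).

Spanning is a local matter. On one simplex the face functions vanish at all vertices, while the
vertex values of the `d + 1` facet functions form a multiple of the all-ones matrix minus `d` times
the identity, which is invertible. The face functions are independent by induction over the number
of vertices of the face; on one face this reduces to the independence of the polynomials
`P_α^{bary}`, whose leading monomials are distinct (`baryPoly_linearIndependent`). A Vandermonde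
count then shows that these functions form a basis of the polynomials of degree at most `k`
(`IsCell.exists_shape_sum`). The coefficient of a facet function depends only on the vertex values
on that facet, so the local expansions of a continuous function match across simplices and glue
(`Mesh.exists_conforming_sum`).

Weights with prescribed moments exist as soon as the moments respect all linear relations between
the tested functions (`exists_weight`). On a simplex there are none. On a facet `F` of `K` the
relations are generated by one: the facet functions of the other facets of `K` sum to zero on `F`.
Hence the moments for those facets must sum to zero. For the weight of a second boundary facet `F'`
this is arranged by the value `-1` at an inner facet of `K`, where nothing is required of this
weight. Connectedness of `Ω` and the presence of a second simplex provide such a facet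
(`Mesh.exists_inner_facet`).

Traces on boundary facets are unique by the trace inequality and the closability of the gradient
(`IsCell.trace_unique`). They exist for `H¹` functions because dilation and mollification give
smooth approximations on a simplex (`IsCell.exists_smooth_approx`), and for `CR_k` because its
elements are polynomials on each simplex.

For the boundary condition, traces of `H¹₀` functions vanish, `S_{k,0}` lies in `H¹₀`, and the
boundary functionals that occur in the operator annihilate the inner facet functions; so both
boundary sums drop out (`Mesh.facetDof_eq_zero`). What remains lies in `CR_{k,0}` because face
functions of inner faces are Lipschitz and vanish on `∂Ω`. Membership in `H¹₀` then needs no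
regularity of `∂Ω`: uniformly convergent test functions with bounded gradients suffice
(`mem_H10_of_bounded`). -/

/-- The polynomial `S^n P_n^{(a,b)}(2 y / S - 1)` with polynomial arguments. -/
def jacobiHomPoly {σ : Type*} (a b n : ℕ) (S y : MvPolynomial σ ℝ) : MvPolynomial σ ℝ :=
  ∑ s ∈ Finset.range (n + 1), C (((n + a).choose (n - s) : ℝ) * ((n + b).choose s : ℝ)) *
    ((y - S) ^ s * y ^ (n - s))

theorem eval_jacobiHomPoly {σ : Type*} (a b n : ℕ) (S y : MvPolynomial σ ℝ) (t : σ → ℝ) :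
    eval t (jacobiHomPoly a b n S y) = jacobiHom a b n (eval t S) (eval t y) := by
  simp [jacobiHomPoly, jacobiHom, mul_assoc]

/-- This sum is the leading coefficient of the homogenized Jacobi polynomial in `y`; all summands
are nonnegative, so nothing cancels. -/
theorem sum_choose_mul_choose_pos (a b n : ℕ) :
    0 < ∑ s ∈ Finset.range (n + 1),
      (((n + a).choose (n - s) : ℝ) * ((n + b).choose s : ℝ)) := by
  refine Finset.sum_pos' (fun s _ => by positivity) ⟨0, by simp, ?_⟩
  have : 0 < (n + a).choose (n - 0) := Nat.choose_pos (by omega)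
  have h2 : 0 < (n + b).choose 0 := Nat.choose_pos (by omega)
  positivity

/-- If `S` is of lower order than `X i`, every product `(X i - S)^s (X i)^(n-s)` is monic with
leading monomial `(X i)^n`, so the leading coefficients simply add up to a positive number. -/
theorem degree_jacobiHomPoly {σ : Type*} (m : MonomialOrder σ) (a b n : ℕ)
    {S : MvPolynomial σ ℝ} {i : σ} (hS : m.toSyn (m.degree S) < m.toSyn (Finsupp.single i 1)) :
    m.degree (jacobiHomPoly a b n S (X i)) = n • Finsupp.single i 1 ∧
      jacobiHomPoly a b n S (X i) ≠ 0 := by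
  have hX : m.degree (X i : MvPolynomial σ ℝ) = Finsupp.single i 1 := m.degree_X
  have hlt : m.toSyn (m.degree S) < m.toSyn (m.degree (X i : MvPolynomial σ ℝ)) := by rwa [hX]
  have hd : m.degree (X i - S : MvPolynomial σ ℝ) = Finsupp.single i 1 := by
    rw [m.degree_sub_of_lt hlt, hX]
  have hm : m.Monic (X i - S : MvPolynomial σ ℝ) := by
    unfold MonomialOrder.Monic
    rw [m.leadingCoeff_sub_of_lt hlt, m.leadingCoeff_X]
  have hmon : ∀ s ∈ Finset.range (n + 1),
      m.Monic ((X i - S) ^ s * X i ^ (n - s) : MvPolynomial σ ℝ) := fun s _ =>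
    hm.pow.mul (m.monic_X.pow)
  have hdeg : ∀ s ∈ Finset.range (n + 1),
      m.degree ((X i - S) ^ s * X i ^ (n - s) : MvPolynomial σ ℝ) = n • Finsupp.single i 1 := by
    intro s hs
    have hs' : s ≤ n := Nat.lt_succ_iff.mp (Finset.mem_range.mp hs)
    rw [m.degree_mul (pow_ne_zero _ hm.ne_zero) (pow_ne_zero _ (X_ne_zero i)), m.degree_pow,
      m.degree_pow, hd, hX, ← add_smul]
    congr 1
    omega
  have hc : coeff (n • Finsupp.single i 1) (jacobiHomPoly a b n S (X i)) =
      ∑ s ∈ Finset.range (n + 1), (((n + a).choose (n - s) : ℝ) * ((n + b).choose s : ℝ)) := by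
    unfold jacobiHomPoly
    rw [coeff_sum]
    refine Finset.sum_congr rfl fun s hs => ?_
    rw [coeff_C_mul]
    have := (hmon s hs).coeff_degree
    rw [hdeg s hs] at this
    rw [this, mul_one]
  have hle : m.toSyn (m.degree (jacobiHomPoly a b n S (X i))) ≤
      m.toSyn (n • Finsupp.single i 1) := by
    unfold jacobiHomPoly
    refine m.degree_sum_le.trans (Finset.sup_le fun s hs => ?_)
    rw [← smul_eq_C_mul]
    exact m.degree_smul_le.trans (by rw [hdeg s hs])
  have hne : coeff (n • Finsupp.single i 1) (jacobiHomPoly a b n S (X i)) ≠ 0 := by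
    rw [hc]; exact (sum_choose_mul_choose_pos a b n).ne'
  refine ⟨m.toSyn.injective (le_antisymm hle ?_), fun h => hne (by simp [h])⟩
  exact m.le_degree (mem_support_iff.2 hne)

/-- Polynomials with pairwise distinct leading monomials are linearly independent. -/
theorem eq_zero_of_sum_eq_zero_of_degree_injOn {σ ι : Type*} (m : MonomialOrder σ) (s : Finset ι)
    (p : ι → MvPolynomial σ ℝ) (hp : ∀ i ∈ s, p i ≠ 0)
    (hinj : ∀ i ∈ s, ∀ j ∈ s, m.degree (p i) = m.degree (p j) → i = j) (c : ι → ℝ)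
    (h : ∑ i ∈ s, C (c i) * p i = 0) : ∀ i ∈ s, c i = 0 := by
  by_contra! hne
  obtain ⟨i, hi, hci⟩ := hne
  -- Among the indices with nonzero coefficient, one with the largest leading monomial cannot be
  -- cancelled by any other term.
  obtain ⟨i₀, hi₀, hmax⟩ := Finset.exists_max_image (s.filter fun i => c i ≠ 0)
    (fun i => m.toSyn (m.degree (p i))) ⟨i, Finset.mem_filter.2 ⟨hi, hci⟩⟩
  rw [Finset.mem_filter] at hi₀
  have h1 := congrArg (coeff (m.degree (p i₀))) h
  rw [coeff_sum, Finset.sum_eq_single i₀] at h1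
  · rw [coeff_C_mul, coeff_zero] at h1
    exact mul_ne_zero hi₀.2 (m.coeff_degree_ne_zero_iff.2 (hp i₀ hi₀.1)) h1
  · intro j hj hji
    rw [coeff_C_mul]
    by_cases hcj : c j = 0
    · simp [hcj]
    · have hle := hmax j (Finset.mem_filter.2 ⟨hj, hcj⟩)
      have hlt : m.toSyn (m.degree (p j)) < m.toSyn (m.degree (p i₀)) :=
        lt_of_le_of_ne hle fun e => hji (hinj j hj i₀ hi₀.1 (m.toSyn.injective e))
      rw [m.coeff_eq_zero_of_lt hlt, mul_zero]
  · intro hn; exact absurd hi₀.1 hn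

/-- The coordinate `S_j = 1 - ∑_{m < j} t_m` as a polynomial. -/
def partialCoord {ℓ : ℕ} (j : Fin ℓ) : MvPolynomial (Fin ℓ)ᵒᵈ ℝ :=
  1 - ∑ m ∈ Finset.Iio j, X (OrderDual.toDual m)

/-- `S_j` only involves the variables before `j`. The order dual on the index type makes later
variables dominate earlier ones in the lexicographic order, which is the comparison that
`degree_jacobiHomPoly` asks for. -/
theorem degree_partialCoord_lt {ℓ : ℕ} (j : Fin ℓ) :
    (MonomialOrder.lex (σ := (Fin ℓ)ᵒᵈ)).toSyn (MonomialOrder.lex.degree (partialCoord j)) <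
      MonomialOrder.lex.toSyn (Finsupp.single (OrderDual.toDual j) 1) := by
  set m := MonomialOrder.lex (σ := (Fin ℓ)ᵒᵈ)
  have hpos : (0 : m.syn) < m.toSyn (Finsupp.single (OrderDual.toDual j) 1) := by
    rw [← map_zero m.toSyn]
    exact m.toSyn_strictMono (pos_iff_ne_zero.2 (by simp))
  unfold partialCoord
  refine (m.degree_sub_le).trans_lt (max_lt ?_ ?_)
  · rw [m.degree_one, map_zero]; exact hpos
  · refine m.degree_sum_le.trans_lt ((Finset.sup_lt_iff hpos).2 fun i hi => ?_)
    rw [m.degree_X]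
    have : i < j := Finset.mem_Iio.1 hi
    exact MonomialOrder.lex_lt_iff.2 (Finsupp.Lex.single_strictAnti (show
      OrderDual.toDual j < OrderDual.toDual i from this))

/-- `P_α^{bary}` in the coordinates `y_1, …, y_ℓ`, as a polynomial. -/
def baryMvPoly {ℓ : ℕ} (α : Fin ℓ → ℕ) : MvPolynomial (Fin ℓ)ᵒᵈ ℝ :=
  ∏ j : Fin ℓ, jacobiHomPoly (2 * (∑ m ∈ Finset.Ioi j, α m) + 2 * (ℓ - 1 - (j : ℕ)) + 1) 1 (α j)
    (partialCoord j) (X (OrderDual.toDual j))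

/-- The factor with index `j` contributes the leading monomial `X_j^{α_j}`, so `α` can be recovered
from the leading exponent of the product. -/
theorem degree_baryMvPoly {ℓ : ℕ} (α : Fin ℓ → ℕ) :
    MonomialOrder.lex.degree (baryMvPoly α) =
      ∑ j : Fin ℓ, α j • Finsupp.single (OrderDual.toDual j) 1 ∧ baryMvPoly α ≠ 0 := by
  have h := fun j : Fin ℓ => degree_jacobiHomPoly MonomialOrder.lex
    (2 * (∑ m ∈ Finset.Ioi j, α m) + 2 * (ℓ - 1 - (j : ℕ)) + 1) 1 (α j) (degree_partialCoord_lt j)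
  refine ⟨?_, Finset.prod_ne_zero_iff.2 fun j _ => (h j).2⟩
  unfold baryMvPoly
  rw [MonomialOrder.degree_prod fun j _ => (h j).2]
  exact Finset.sum_congr rfl fun j _ => (h j).1

/-- On the hyperplane where the coordinates sum to one, `y_0 + ∑_{m ≥ j} y_m` equals `1 - ∑_{m < j}
y_m`; this eliminates `y_0` and makes the triangular structure visible. -/
theorem eval_baryMvPoly {ℓ : ℕ} (α : Fin ℓ → ℕ) (t : (Fin ℓ)ᵒᵈ → ℝ) :
    eval t (baryMvPoly α) = baryPoly α
      (Fin.cons (1 - ∑ j : Fin ℓ, t (OrderDual.toDual j)) fun j => t (OrderDual.toDual j)) := by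
  unfold baryMvPoly baryPoly
  rw [map_prod]
  refine Finset.prod_congr rfl fun j _ => ?_
  rw [eval_jacobiHomPoly]
  simp only [partialCoord, map_sub, map_one, map_sum, eval_X, Fin.cons_zero, Fin.cons_succ]
  congr 1
  have : ∑ j : Fin ℓ, t (OrderDual.toDual j) = ∑ m ∈ Finset.Iio j, t (OrderDual.toDual m) +
      ∑ m ∈ Finset.Ici j, t (OrderDual.toDual m) := by
    rw [← Finset.sum_union]
    · refine Finset.sum_congr ?_ fun _ _ => rfl
      ext m; simp [lt_or_ge]
    · rw [Finset.disjoint_left]; intro m hm hm'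
      simp at hm hm'; omega
  linarith

/-- A relation on the open simplex is a polynomial identity on an open cube in the coordinates `y_1,
…, y_ℓ`, hence an identity of polynomials, and distinct leading exponents force the coefficients to
vanish. -/
theorem baryPoly_linearIndependent {ℓ : ℕ} (s : Finset (Fin ℓ → ℕ)) (c : (Fin ℓ → ℕ) → ℝ)
    (h : ∀ y : Fin (ℓ + 1) → ℝ, (∀ j, 0 < y j) → ∑ j, y j = 1 →
      ∑ α ∈ s, c α * baryPoly α y = 0) : ∀ α ∈ s, c α = 0 := by
  refine eq_zero_of_sum_eq_zero_of_degree_injOn MonomialOrder.lex s baryMvPoly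
    (fun α _ => (degree_baryMvPoly α).2) (fun α _ β _ hαβ => ?_) c ?_
  · rw [(degree_baryMvPoly α).1, (degree_baryMvPoly β).1] at hαβ
    funext i
    have := DFunLike.congr_fun hαβ (OrderDual.toDual i)
    simpa [Finsupp.finsetSum_apply, Finsupp.single_apply] using this
  -- With all `ℓ` coordinates below `1 / (ℓ + 1)`, the remaining coordinate `y_0` stays positive.
  · refine funext_set (fun _ => Set.Ioo (0 : ℝ) (1 / (ℓ + 1)))
      (fun _ => Set.Ioo_infinite (by positivity)) fun t ht => ?_
    have ht' : ∀ j, 0 < t j ∧ t j < 1 / ((ℓ : ℝ) + 1) := fun j => ht j (Set.mem_univ j)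
    have hs : ∑ j : Fin ℓ, t (OrderDual.toDual j) < 1 := by
      calc ∑ j : Fin ℓ, t (OrderDual.toDual j) ≤ ∑ j : Fin ℓ, 1 / ((ℓ : ℝ) + 1) :=
            Finset.sum_le_sum fun j _ => (ht' _).2.le
        _ = ℓ / ((ℓ : ℝ) + 1) := by simp [div_eq_mul_inv]
        _ < 1 := by rw [div_lt_one (by positivity)]; linarith
    rw [map_sum, map_zero]
    simp only [map_mul, eval_C, eval_baryMvPoly]
    refine h _ (fun j => ?_) ?_
    · refine Fin.cases ?_ (fun i => ?_) j
      · simpa using hs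
      · simpa using (ht' (OrderDual.toDual i)).1
    · rw [Fin.sum_univ_succ]; simp

end BaryPoly

end

section

/-! ### Geometry of a simplex -/

/-- `K` is the vertex set of a nondegenerate `d`-simplex. -/
structure IsCell {d : ℕ} (K : Finset (Space d)) : Prop where
  indep : AffineIndependent ℝ ((↑) : K → Space d)
  card_eq : K.card = d + 1

namespace IsCell

variable {d : ℕ} {K K' : Finset (Space d)}

/-- The vertices of a simplex as an affine basis. -/
def basis (hK : IsCell K) : AffineBasis K ℝ (Space d) :=
  ⟨(↑), hK.indep, by
    rw [hK.indep.affineSpan_eq_top_iff_card_eq_finrank_add_one]; simp [hK.card_eq]⟩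

theorem range_basis (hK : IsCell K) : Set.range hK.basis = (K : Set (Space d)) := by
  change Set.range ((↑) : K → Space d) = _
  simp

theorem bary_vertex (hK : IsCell K) (z : Space d) {y : Space d} (hy : y ∈ K) :
    bary K z y = if y = z then 1 else 0 := bary_apply hK.indep hK.card_eq z y hy

theorem affineMap_ext (hK : IsCell K) {f g : Space d →ᵃ[ℝ] ℝ} (h : ∀ y ∈ K, f y = g y) :
    f = g := by
  refine AffineMap.ext_on (s := (K : Set (Space d))) ?_ fun y hy => h y hy
  rw [← hK.range_basis]; exact hK.basis.tot

theorem bary_eq_coord (hK : IsCell K) {z : Space d} (hz : z ∈ K) :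
    bary K z = hK.basis.coord ⟨z, hz⟩ := by
  refine hK.affineMap_ext fun y hy => ?_
  rw [hK.bary_vertex z hy]
  have h := hK.basis.coord_apply ⟨z, hz⟩ ⟨y, hy⟩
  change hK.basis.coord ⟨z, hz⟩ y = _ at h
  rw [h]
  by_cases e : y = z
  · simp [e]
  · simp [e, Ne.symm e]

theorem sum_bary (hK : IsCell K) (x : Space d) : ∑ z ∈ K, bary K z x = 1 := by
  rw [← hK.basis.sum_coord_apply_eq_one x, ← Finset.sum_coe_sort]
  exact Finset.sum_congr rfl fun z _ => by rw [hK.bary_eq_coord z.2]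

theorem sum_bary_smul (hK : IsCell K) (x : Space d) : ∑ z ∈ K, bary K z x • z = x := by
  conv_rhs => rw [← hK.basis.linear_combination_coord_eq_self x]
  rw [← Finset.sum_coe_sort]
  exact Finset.sum_congr rfl fun z _ => by rw [hK.bary_eq_coord z.2]; rfl

/-- Every family of barycentric coordinates with sum `1` is attained. -/
theorem bary_sum_smul (hK : IsCell K) {w : Space d → ℝ} (hw : ∑ y ∈ K, w y = 1)
    {z : Space d} (hz : z ∈ K) : bary K z (∑ y ∈ K, w y • y) = w z := by
  rw [hK.bary_eq_coord hz]
  have h1 : ∑ y : K, w y = 1 := (Finset.sum_coe_sort K w).trans hw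
  have := hK.basis.coord_apply_combination_of_mem (i := ⟨z, hz⟩) (Finset.mem_univ _)
    (w := fun y : K => w y) h1
  rw [Finset.univ.affineCombination_eq_linear_combination _ _ h1] at this
  rw [← this, ← Finset.sum_coe_sort]
  rfl

theorem mem_hull_iff (hK : IsCell K) {x : Space d} :
    x ∈ hull K ↔ ∀ z ∈ K, 0 ≤ bary K z x := by
  unfold hull
  rw [← hK.range_basis, hK.basis.convexHull_eq_nonneg_coord]
  constructor
  · intro h z hz; rw [hK.bary_eq_coord hz]; exact h ⟨z, hz⟩
  · intro h z; rw [← hK.bary_eq_coord z.2]; exact h z z.2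

theorem mem_interior_hull_iff (hK : IsCell K) {x : Space d} :
    x ∈ interior (hull K) ↔ ∀ z ∈ K, 0 < bary K z x := by
  unfold hull
  rw [← hK.range_basis, hK.basis.interior_convexHull]
  constructor
  · intro h z hz; rw [hK.bary_eq_coord hz]; exact h ⟨z, hz⟩
  · intro h z; rw [← hK.bary_eq_coord z.2]; exact h z z.2

end IsCell

variable {d : ℕ} {K K' τ : Finset (Space d)}

/-- Affine functions that agree in the vertices of a simplex agree on the simplex. -/
theorem affineMap_eqOn_hull {f g : Space d →ᵃ[ℝ] ℝ} (h : ∀ y ∈ τ, f y = g y) {x : Space d}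
    (hx : x ∈ hull τ) : f x = g x :=
  AffineMap.eqOn_affineSpan (s := (τ : Set (Space d))) (fun y hy => h y hy)
    (convexHull_subset_affineSpan _ hx)

namespace IsCell

/-- A coordinate of a vertex outside `τ` vanishes at the vertices of `τ`, hence on its hull;
conversely, the coordinates that survive are the weights of a convex combination of the vertices of
`τ`. -/
theorem mem_hull_face_iff (hK : IsCell K) (hτ : τ ⊆ K) {x : Space d} :
    x ∈ hull τ ↔ (∀ z ∈ τ, 0 ≤ bary K z x) ∧ ∀ z ∈ K, z ∉ τ → bary K z x = 0 := by
  constructor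
  · intro hx
    refine ⟨fun z hz => hK.mem_hull_iff.1 (convexHull_mono (by exact_mod_cast hτ) hx) z (hτ hz),
      fun z hz hzτ => ?_⟩
    have := affineMap_eqOn_hull (f := bary K z) (g := AffineMap.const ℝ (Space d) 0) (τ := τ)
      (fun y hy => by
        have e : y ≠ z := fun e => hzτ (e ▸ hy)
        rw [hK.bary_vertex z (hτ hy), if_neg e]; rfl) hx
    simpa using this
  · rintro ⟨h1, h2⟩
    have hsum : ∑ z ∈ τ, bary K z x = 1 := by
      rw [← hK.sum_bary x]
      exact Finset.sum_subset hτ fun z hz hzτ => h2 z hz hzτ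
    have hx : ∑ z ∈ τ, bary K z x • z = x := by
      conv_rhs => rw [← hK.sum_bary_smul x]
      exact Finset.sum_subset hτ fun z hz hzτ => by rw [h2 z hz hzτ, zero_smul]
    rw [← hx]
    exact (convex_convexHull ℝ _).sum_mem h1 hsum fun z hz => subset_convexHull ℝ _ hz

/-- Both sides are affine with the same values at the vertices of the common face. This is why hat
functions, and everything built from them, are continuous across simplices. -/
theorem bary_eq_of_mem_hull (hK : IsCell K) (hK' : IsCell K') (hτ : τ ⊆ K) (hτ' : τ ⊆ K')
    {x : Space d} (hx : x ∈ hull τ) (z : Space d) : bary K z x = bary K' z x :=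
  affineMap_eqOn_hull (fun y hy => by
    rw [hK.bary_vertex z (hτ hy), hK'.bary_vertex z (hτ' hy)]) hx

/-- A point of a simplex lies in the relative interior of exactly one face; this is the vertex set
of that face. -/
theorem mem_hull_filter (hK : IsCell K) {x : Space d} (hx : x ∈ hull K) :
    x ∈ hull (K.filter fun z => bary K z x ≠ 0) := by
  rw [hK.mem_hull_face_iff (Finset.filter_subset _ _)]
  refine ⟨fun z hz => hK.mem_hull_iff.1 hx z (Finset.filter_subset _ _ hz), fun z hz hz' => ?_⟩
  by_contra h
  exact hz' (Finset.mem_filter.2 ⟨hz, h⟩)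

/-- Every family of positive barycentric coordinates on a face is attained in the face. -/
theorem exists_mem_hull_face (hK : IsCell K) (hτ : τ ⊆ K) {w : Space d → ℝ}
    (hw : ∑ y ∈ τ, w y = 1) (hw0 : ∀ y ∈ τ, 0 ≤ w y) :
    ∃ x ∈ hull τ, ∀ z ∈ τ, bary K z x = w z := by
  have hs : ∑ y ∈ K, (if y ∈ τ then w y else 0) = 1 := by
    rw [← hw, ← Finset.sum_filter, Finset.filter_mem_eq_inter, Finset.inter_eq_right.2 hτ]
  refine ⟨∑ y ∈ K, (if y ∈ τ then w y else 0) • y, ?_, fun z hz => ?_⟩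
  · rw [hK.mem_hull_face_iff hτ]
    refine ⟨fun z hz => ?_, fun z hz hzτ => ?_⟩
    · rw [hK.bary_sum_smul hs (hτ hz), if_pos hz]; exact hw0 z hz
    · rw [hK.bary_sum_smul hs hz, if_neg hzτ]
  · rw [hK.bary_sum_smul hs (hτ hz), if_pos hz]

theorem sum_bary_face (hK : IsCell K) (hτ : τ ⊆ K) {x : Space d} (hx : x ∈ hull τ) :
    ∑ z ∈ τ, bary K z x = 1 := by
  rw [← hK.sum_bary x]
  exact Finset.sum_subset hτ fun z hz hzτ => ((hK.mem_hull_face_iff hτ).1 hx).2 z hz hzτ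

theorem interior_nonempty (hK : IsCell K) : (interior (hull K)).Nonempty := by
  have := hK.basis.centroid_mem_interior_convexHull
  rw [hK.range_basis] at this
  exact ⟨_, this⟩

theorem closure_interior (hK : IsCell K) : closure (interior (hull K)) = hull K := by
  rw [(convex_convexHull ℝ _).closure_interior_eq_closure_of_nonempty_interior
    hK.interior_nonempty]
  exact ((Finset.finite_toSet K).isClosed_convexHull (𝕜 := ℝ)).closure_eq

end IsCell

theorem isCompact_hull (τ : Finset (Space d)) : IsCompact (hull τ) :=
  (Finset.finite_toSet τ).isCompact_convexHull (𝕜 := ℝ)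

theorem hull_mono (h : τ ⊆ K) : hull τ ⊆ hull K := convexHull_mono (by exact_mod_cast h)

theorem interior_hull_ae_eq (K : Finset (Space d)) :
    interior (hull K) =ᵐ[volume] (hull K : Set (Space d)) := by
  have h : volume (frontier (hull K)) = 0 := (convex_convexHull ℝ _).addHaar_frontier volume
  exact interior_ae_eq_of_null_frontier h

/-! ### Independence and completeness of the local shape functions -/

/-- Splitting off the first entry reduces the count to the hockey-stick identity for binomial
coefficients. -/
theorem card_multiIdx (ℓ m : ℕ) : (multiIdx ℓ m).card = (m + ℓ).choose ℓ := by
  induction ℓ generalizing m with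
  | zero =>
    have : multiIdx 0 m = {fun _ => 0} := by
      ext α
      simp only [multiIdx, Finset.mem_filter, Fintype.mem_piFinset, Finset.mem_singleton]
      constructor
      · intro _; exact Subsingleton.elim _ _
      · rintro rfl; simp
    rw [this]; simp
  | succ ℓ ih =>
    have h : multiIdx (ℓ + 1) m = ((Finset.range (m + 1)).sigma fun i => multiIdx ℓ (m - i)).image
        (fun p : (_ : ℕ) × (Fin ℓ → ℕ) => (Fin.cons p.1 p.2 : Fin (ℓ + 1) → ℕ)) := by
      ext α
      simp only [multiIdx, Finset.mem_filter, Fintype.mem_piFinset, Finset.mem_image,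
        Finset.mem_sigma, Finset.mem_range]
      constructor
      · rintro ⟨_, h2⟩
        rw [Fin.sum_univ_succ] at h2
        have h4 : ∀ j : Fin ℓ, α j.succ ≤ ∑ i : Fin ℓ, α i.succ := fun j =>
          Finset.single_le_sum (f := fun i : Fin ℓ => α i.succ) (fun _ _ => Nat.zero_le _)
            (Finset.mem_univ j)
        refine ⟨⟨α 0, Fin.tail α⟩, ⟨by dsimp only; omega, fun j => ?_, ?_⟩, Fin.cons_self_tail α⟩
        · have := h4 j
          simp only [Fin.tail]; omega
        · simp only [Fin.tail]; omega
      · rintro ⟨⟨i, β⟩, ⟨h1, h2, h3⟩, rfl⟩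
        simp only [Fin.sum_univ_succ, Fin.cons_zero, Fin.cons_succ] at *
        refine ⟨fun j => ?_, by omega⟩
        refine Fin.cases ?_ (fun j => ?_) j
        · simpa using h1
        · have := h2 j; simp only [Fin.cons_succ]; omega
    rw [h, Finset.card_image_of_injective, Finset.card_sigma]
    · rw [Finset.sum_congr rfl fun i _ => ih (m - i)]
      have h2 := Finset.sum_range_reflect (fun i => (i + ℓ).choose ℓ) (m + 1)
      rw [Nat.sum_range_add_choose] at h2
      rw [← add_assoc, ← h2]
      exact Finset.sum_congr rfl fun i _ => by simp
    · rintro ⟨i, β⟩ ⟨j, γ⟩ e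
      obtain ⟨e1, e2⟩ := Fin.cons_inj.1 e
      dsimp only at e1 e2
      subst e1; subst e2; rfl

end

section

/-! ### Polynomial functions -/

/-- The polynomial functions of degree at most `n` on `ℝ^d`. -/
def polySpace (d n : ℕ) : Submodule ℝ (Space d → ℝ) :=
  (MvPolynomial.restrictTotalDegree (Fin d) ℝ n).map
    (LinearMap.pi fun x : Space d => (MvPolynomial.aeval fun i => x i).toLinearMap)

theorem mem_polySpace {d n : ℕ} {f : Space d → ℝ} : f ∈ polySpace d n ↔
    ∃ q : MvPolynomial (Fin d) ℝ, q.totalDegree ≤ n ∧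
      ∀ x, f x = MvPolynomial.eval (fun i => x i) q := by
  simp only [polySpace, Submodule.mem_map, MvPolynomial.mem_restrictTotalDegree]
  constructor
  · rintro ⟨q, hq, rfl⟩
    exact ⟨q, hq, fun x => by simp [MvPolynomial.aeval_eq_eval]⟩
  · rintro ⟨q, hq, h⟩
    exact ⟨q, hq, funext fun x => by simp [h, MvPolynomial.aeval_eq_eval]⟩

theorem polySpace_mono {d m n : ℕ} (h : m ≤ n) {f : Space d → ℝ} (hf : f ∈ polySpace d m) :
    f ∈ polySpace d n := by
  obtain ⟨q, hq, h'⟩ := mem_polySpace.1 hf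
  exact mem_polySpace.2 ⟨q, hq.trans h, h'⟩

theorem mul_mem_polySpace {d m n : ℕ} {f g : Space d → ℝ} (hf : f ∈ polySpace d m)
    (hg : g ∈ polySpace d n) : (fun x => f x * g x) ∈ polySpace d (m + n) := by
  obtain ⟨p, hp, hp'⟩ := mem_polySpace.1 hf
  obtain ⟨q, hq, hq'⟩ := mem_polySpace.1 hg
  exact mem_polySpace.2 ⟨p * q, (MvPolynomial.totalDegree_mul p q).trans (add_le_add hp hq),
    fun x => by simp [hp', hq']⟩

theorem const_mem_polySpace {d : ℕ} (n : ℕ) (c : ℝ) :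
    (fun _ : Space d => c) ∈ polySpace d n :=
  mem_polySpace.2 ⟨MvPolynomial.C c, by simp, fun x => by simp⟩

theorem pow_mem_polySpace {d m : ℕ} {f : Space d → ℝ} (hf : f ∈ polySpace d m) (n : ℕ) :
    (fun x => f x ^ n) ∈ polySpace d (n * m) := by
  obtain ⟨p, hp, hp'⟩ := mem_polySpace.1 hf
  exact mem_polySpace.2 ⟨p ^ n, (MvPolynomial.totalDegree_pow p n).trans (by gcongr),
    fun x => by simp [hp']⟩

theorem prod_mem_polySpace {d : ℕ} {ι : Type*} (s : Finset ι) {n : ι → ℕ} {f : ι → Space d → ℝ}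
    (hf : ∀ i ∈ s, f i ∈ polySpace d (n i)) :
    (fun x => ∏ i ∈ s, f i x) ∈ polySpace d (∑ i ∈ s, n i) := by
  induction s using Finset.induction_on with
  | empty => simpa using const_mem_polySpace 0 1
  | insert i s hi ih =>
    simp only [Finset.prod_insert hi, Finset.sum_insert hi]
    exact mul_mem_polySpace (hf i (Finset.mem_insert_self i s))
      (ih fun j hj => hf j (Finset.mem_insert_of_mem hj))

theorem sum_mem_polySpace {d n : ℕ} {ι : Type*} (s : Finset ι) {f : ι → Space d → ℝ}
    (hf : ∀ i ∈ s, f i ∈ polySpace d n) : (fun x => ∑ i ∈ s, f i x) ∈ polySpace d n := by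
  have := Submodule.sum_mem (polySpace d n) hf
  convert this using 1
  funext x; simp

theorem affineMap_mem_polySpace {d : ℕ} (f : Space d →ᵃ[ℝ] ℝ) :
    (fun x => f x) ∈ polySpace d 1 := by
  refine mem_polySpace.2 ⟨MvPolynomial.C (f 0) + ∑ i, MvPolynomial.C
    (f.linear (EuclideanSpace.single i 1)) * MvPolynomial.X i, ?_, fun x => ?_⟩
  · refine (MvPolynomial.totalDegree_add _ _).trans (max_le (by simp) ?_)
    refine (MvPolynomial.totalDegree_finsetSum_le fun i _ => ?_)
    refine (MvPolynomial.totalDegree_mul _ _).trans ?_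
    simp
  · have h1 : f x = f.linear x + f 0 := by
      have := congrFun f.decomp x
      simpa using this
    have h2 : x = ∑ i, x i • EuclideanSpace.single i (1 : ℝ) := by
      ext j; simp [Finset.sum_apply, Pi.single_apply]
    rw [h1]
    conv_lhs => rw [h2, map_sum]
    simp [mul_comm, add_comm]

theorem jacobi_mem_polySpace {d : ℕ} (a b n : ℕ) {f : Space d → ℝ} (hf : f ∈ polySpace d 1) :
    (fun x => jacobi a b n (f x)) ∈ polySpace d n := by
  unfold jacobi
  refine sum_mem_polySpace _ fun s hs => ?_
  have hs' : s ≤ n := Nat.lt_succ_iff.mp (Finset.mem_range.mp hs)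
  have h1 : (fun x => (f x - 1) / 2) ∈ polySpace d 1 := by
    convert Submodule.smul_mem _ (1 / 2 : ℝ) (Submodule.sub_mem _ hf (const_mem_polySpace 1 1))
      using 1
    funext x; simp; ring
  have h2 : (fun x => (f x + 1) / 2) ∈ polySpace d 1 := by
    convert Submodule.smul_mem _ (1 / 2 : ℝ) (Submodule.add_mem _ hf (const_mem_polySpace 1 1))
      using 1
    funext x; simp; ring
  refine polySpace_mono (m := 0 + s * 1 + (n - s) * 1) (by omega) ?_
  exact mul_mem_polySpace (mul_mem_polySpace (const_mem_polySpace _ _) (pow_mem_polySpace h1 s))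
    (pow_mem_polySpace h2 (n - s))

theorem jacobiHom_mem_polySpace {d : ℕ} (a b n : ℕ) {S y : Space d → ℝ} (hS : S ∈ polySpace d 1)
    (hy : y ∈ polySpace d 1) : (fun x => jacobiHom a b n (S x) (y x)) ∈ polySpace d n := by
  unfold jacobiHom
  refine sum_mem_polySpace _ fun s hs => ?_
  have hs' : s ≤ n := Nat.lt_succ_iff.mp (Finset.mem_range.mp hs)
  refine polySpace_mono (m := 0 + s * 1 + (n - s) * 1) (by omega) ?_
  exact mul_mem_polySpace (mul_mem_polySpace (const_mem_polySpace _ _)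
    (pow_mem_polySpace (Submodule.sub_mem _ hy hS) s)) (pow_mem_polySpace hy (n - s))

theorem contDiff_of_mem_polySpace {d n : ℕ} {f : Space d → ℝ} (hf : f ∈ polySpace d n) :
    ContDiff ℝ ∞ f := by
  obtain ⟨q, -, h⟩ := mem_polySpace.1 hf
  rw [show f = fun x => MvPolynomial.eval (fun i => x i) q from funext h]
  clear h hf
  induction q using MvPolynomial.induction_on with
  | C a => simpa using contDiff_const
  | add p q hp hq => simpa using hp.add hq
  | mul_X p i hp =>
    simp only [map_mul, MvPolynomial.eval_X]
    exact hp.mul (by fun_prop)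

instance {d n : ℕ} : Module.Finite ℝ (polySpace d n) := by
  unfold polySpace; infer_instance

/-- The monomials span. Only the upper bound is needed, since the independence of the shape
functions supplies the matching lower bound in `IsCell.exists_shape_sum`. -/
theorem finrank_polySpace_le (d n : ℕ) :
    Module.finrank ℝ (polySpace d n) ≤ (n + d).choose d := by
  let m : (Fin d → ℕ) → (Space d → ℝ) := fun α x => ∏ i, x i ^ α i
  have hle : polySpace d n ≤ Submodule.span ℝ ((multiIdx d n).image m : Finset _) := by
    intro f hf
    obtain ⟨q, hq, h⟩ := mem_polySpace.1 hf
    have hf' : f = ∑ s ∈ q.support, q.coeff s • m s := by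
      funext x
      rw [h, MvPolynomial.eval_eq']
      simp [m]
    rw [hf']
    refine Submodule.sum_mem _ fun s hs => Submodule.smul_mem _ _ (Submodule.subset_span ?_)
    have hdeg : ∑ i, s i ≤ n := by
      have := (MvPolynomial.le_totalDegree hs).trans hq
      rwa [Finsupp.sum_fintype _ _ (fun _ => rfl)] at this
    simp only [Finset.coe_image, Set.mem_image, Finset.mem_coe]
    refine ⟨s, ?_, rfl⟩
    simp only [multiIdx, Finset.mem_filter, Fintype.mem_piFinset, Finset.mem_range]
    exact ⟨fun j => Nat.lt_succ_of_le ((Finset.single_le_sum (f := fun i => s i)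
      (fun _ _ => Nat.zero_le _) (Finset.mem_univ j)).trans hdeg), hdeg⟩
  calc Module.finrank ℝ (polySpace d n) ≤ _ := Submodule.finrank_mono hle
    _ ≤ ((multiIdx d n).image m).card := finrank_span_finset_le_card _
    _ ≤ (multiIdx d n).card := Finset.card_image_le
    _ = _ := card_multiIdx d n

theorem baryPoly_mem_polySpace {d ℓ : ℕ} (α : Fin ℓ → ℕ) {y : Fin (ℓ + 1) → Space d → ℝ}
    (hy : ∀ j, y j ∈ polySpace d 1) :
    (fun x => baryPoly α fun j => y j x) ∈ polySpace d (∑ j, α j) := by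
  unfold baryPoly
  exact prod_mem_polySpace _ fun j _ => jacobiHom_mem_polySpace _ _ _
    (Submodule.add_mem _ (hy 0) (sum_mem_polySpace _ fun m _ => hy m.succ)) (hy j.succ)

/-! ### The local shape functions -/

variable {d : ℕ} {K K' τ : Finset (Space d)}

/-- The indices `(t, β)` for the faces `t` of a simplex with vertex set `τ`. -/
def localIdx (k : ℕ) (τ : Finset (Space d)) : Finset (Idx d) :=
  (τ.powerset.filter fun t => 2 ≤ t.card ∧ t.card ≤ k).sigma
    fun t => multiIdx (t.card - 1) (k - t.card)

theorem mem_localIdx {k : ℕ} {I : Idx d} : I ∈ localIdx k τ ↔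
    I.1 ⊆ τ ∧ (2 ≤ I.1.card ∧ I.1.card ≤ k) ∧ I.2 ∈ multiIdx (I.1.card - 1) (k - I.1.card) := by
  simp [localIdx, Finset.mem_sigma, Finset.mem_filter, and_assoc]

theorem facePiece_mem_polySpace {k : ℕ} (A : Numbering d) {I : Idx d} (hI : I ∈ localIdx k τ)
    (K : Finset (Space d)) : facePiece A I K ∈ polySpace d k := by
  obtain ⟨-, hcard, hα⟩ := mem_localIdx.1 hI
  by_cases h : I.1 ⊆ K
  · have e : facePiece A I K = fun x =>
        (∏ z ∈ I.1, bary K z x) * baryPoly I.2 (fun j => bary K (A I.1 j) x) := by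
      funext x; simp [facePiece, h]
    rw [e]
    have hα' : ∑ j, I.2 j ≤ k - I.1.card := (Finset.mem_filter.1 hα).2
    refine polySpace_mono (m := (∑ z ∈ I.1, 1) + ∑ j, I.2 j) ?_ ?_
    · simp only [Finset.sum_const, smul_eq_mul, mul_one]; omega
    · exact mul_mem_polySpace (prod_mem_polySpace _ fun z _ => affineMap_mem_polySpace _)
        (baryPoly_mem_polySpace _ fun j => affineMap_mem_polySpace _)
  · have e : facePiece A I K = 0 := by funext x; simp [facePiece, h]
    rw [e]; exact Submodule.zero_mem _

theorem jacobi_bary_mem_polySpace (k : ℕ) (f : Space d →ᵃ[ℝ] ℝ) :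
    (fun x => jacobi 0 (d - 2) k (1 - 2 * f x)) ∈ polySpace d k :=
  jacobi_mem_polySpace _ _ _ (Submodule.sub_mem _ (const_mem_polySpace 1 1)
    (Submodule.smul_mem _ (2 : ℝ) (affineMap_mem_polySpace f)))

theorem simplexShape_mem_polySpace (k : ℕ) (K : Finset (Space d)) :
    simplexShape k K ∈ polySpace d k :=
  Submodule.smul_mem _ (1 / (d : ℝ)) (Submodule.add_mem _ (const_mem_polySpace k (-1))
    (sum_mem_polySpace K fun z _ => jacobi_bary_mem_polySpace k (bary K z)))

/-- The facets of `K` are indexed by their opposite vertices through `z ↦ K.erase z`; the local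
computations use this indexing. -/
theorem facetPiece_erase {z : Space d} (hz : z ∈ K) (k : ℕ) (x : Space d) :
    facetPiece k (K.erase z) K x =
      jacobi 0 (d - 2) k (1 - 2 * bary K z x) - simplexShape k K x := by
  have : K \ K.erase z = {z} := by
    ext y; simp only [Finset.mem_sdiff, Finset.mem_erase, Finset.mem_singleton]
    constructor
    · rintro ⟨h1, h2⟩; by_contra h; exact h2 ⟨h, h1⟩
    · rintro rfl; exact ⟨hz, fun h => h.1 rfl⟩
  simp [facetPiece, Finset.erase_subset, facetBary, this]

theorem facetPiece_erase_mem_polySpace {z : Space d} (hz : z ∈ K) (k : ℕ) :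
    facetPiece k (K.erase z) K ∈ polySpace d k := by
  rw [funext (facetPiece_erase hz k)]
  exact Submodule.sub_mem _ (jacobi_bary_mem_polySpace k (bary K z))
    (simplexShape_mem_polySpace k K)

theorem jacobi_one (b k : ℕ) : jacobi 0 b k 1 = 1 := by
  unfold jacobi
  rw [Finset.sum_eq_single 0]
  · simp
  · intro s _ hs; simp [hs]
  · simp

/-- At `-1` only the summand `s = k` survives. Its sign is where odd `k` enters the local theory: it
keeps `1 - P_k^{(0,b)}(-1)` away from zero. -/
theorem jacobi_neg_one {k : ℕ} (hk : Odd k) (b : ℕ) :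
    jacobi 0 b k (-1) = -((k + b).choose k : ℝ) := by
  unfold jacobi
  rw [Finset.sum_eq_single k]
  · have h1 : ((-1 : ℝ) - 1) / 2 = -1 := by norm_num
    rw [h1, hk.neg_one_pow]; simp
  · intro s hs hsk
    have : k - s ≠ 0 := by have := Finset.mem_range.1 hs; omega
    simp [this]
  · simp

/-- The factor `1 - P_k^{(0,d-2)}(-1) > 1` (for odd `k`). -/
def vertexScale (d k : ℕ) : ℝ := 1 + ((k + (d - 2)).choose k : ℝ)

theorem vertexScale_pos (d k : ℕ) : 0 < vertexScale d k := by unfold vertexScale; positivity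

theorem IsCell.jacobi_bary_vertex (hK : IsCell K) {k : ℕ} (hk : Odd k) {z y : Space d}
    (hy : y ∈ K) :
    jacobi 0 (d - 2) k (1 - 2 * bary K z y) = 1 - if y = z then vertexScale d k else 0 := by
  rw [hK.bary_vertex z hy]
  by_cases h : y = z
  · have : (1 : ℝ) - 2 * 1 = -1 := by norm_num
    simp only [h, if_true, this, jacobi_neg_one hk, vertexScale]; ring
  · simp [h, jacobi_one]

/-- Up to a nonzero factor, the matrix of vertex values is the all-ones matrix of size `d + 1` minus
`d` times the identity. It is invertible, with eigenvalues `1` and `-d`. -/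
theorem IsCell.facetPiece_vertex (hd : 2 ≤ d) (hK : IsCell K) {k : ℕ} (hk : Odd k)
    {z y : Space d} (hz : z ∈ K) (hy : y ∈ K) :
    facetPiece k (K.erase z) K y =
      vertexScale d k / d * (1 - if y = z then (d : ℝ) else 0) := by
  have hd0 : (d : ℝ) ≠ 0 := by positivity
  rw [facetPiece_erase hz, hK.jacobi_bary_vertex hk hy]
  unfold simplexShape
  rw [Finset.sum_congr rfl fun w _ => hK.jacobi_bary_vertex hk hy, Finset.sum_sub_distrib,
    Finset.sum_ite_eq, if_pos hy, Finset.sum_const, hK.card_eq]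
  by_cases h : y = z
  · simp [h]; field_simp; ring
  · simp [h]; field_simp; ring

theorem facePiece_eq_zero (A : Numbering d) {I : Idx d} {x z : Space d} (hz : z ∈ I.1)
    (hx : bary K z x = 0) : facePiece A I K x = 0 := by
  unfold facePiece
  split_ifs
  · rw [Finset.prod_eq_zero hz hx, zero_mul]
  · rfl

/-- A face with at least two vertices has one different from `y`, and the bubble contains its
coordinate as a factor. Vertex values therefore see the facet functions only. -/
theorem IsCell.facePiece_vertex (hK : IsCell K) (A : Numbering d) {I : Idx d}
    (hI : 2 ≤ I.1.card) {y : Space d} (hy : y ∈ K) : facePiece A I K y = 0 := by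
  obtain ⟨z, hz, hzy⟩ := Finset.exists_mem_ne (by omega : 1 < I.1.card) y
  exact facePiece_eq_zero A hz (by rw [hK.bary_vertex z hy, if_neg (Ne.symm hzy)])

/-- The conforming shape functions of the faces of `τ` are linearly independent on `τ`. -/
theorem IsCell.facePiece_linearIndependent (hK : IsCell K) (hτ : τ ⊆ K) {A : Numbering d}
    (hA : ∀ t ⊆ K, t.Nonempty → Set.BijOn (A t) Set.univ (t : Set (Space d))) (k : ℕ)
    (c : Idx d → ℝ) (h : ∀ x ∈ hull τ, ∑ I ∈ localIdx k τ, c I * facePiece A I K x = 0) :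
    ∀ I ∈ localIdx k τ, c I = 0 := by
  -- Induction on the number of vertices. At a point of the relative interior of `t`, faces not
  -- contained in `t` do not contribute, and proper subfaces of `t` have zero coefficients by
  -- induction, so only the functions of `t` itself remain.
  suffices H : ∀ n, ∀ I ∈ localIdx k τ, I.1.card = n → c I = 0 from fun I hI => H _ I hI rfl
  intro n
  induction n using Nat.strong_induction_on with
  | _ n ih =>
    rintro ⟨t, α⟩ hI hn
    obtain ⟨htτ, hcard, hα⟩ := mem_localIdx.1 hI
    dsimp only at htτ hcard hα hn
    have htK := htτ.trans hτ
    have hbij := hA t htK (Finset.card_pos.1 (by omega))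
    refine baryPoly_linearIndependent (multiIdx (t.card - 1) (k - t.card)) (fun β => c ⟨t, β⟩)
      (fun y hy hsum => ?_) α hα
    -- The numbering of the vertices of `t` turns the tuple `y` into barycentric coordinates of a
    -- point of `t`.
    let w : Space d → ℝ := fun z => if hz : z ∈ t then y (hbij.surjOn hz).choose else 0
    have hw : ∀ j, w (A t j) = y j := by
      intro j
      have hj : A t j ∈ t := hbij.mapsTo (Set.mem_univ j)
      simp only [w, dif_pos hj]
      congr 1
      exact hbij.injOn (Set.mem_univ _) (Set.mem_univ _) (hbij.surjOn hj).choose_spec.2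
    have himg : t = Finset.univ.image (A t) := by
      ext z; simp only [Finset.mem_image, Finset.mem_univ, true_and]
      exact ⟨fun hz => by obtain ⟨j, -, hj⟩ := hbij.surjOn hz; exact ⟨j, hj⟩,
        by rintro ⟨j, rfl⟩; exact hbij.mapsTo (Set.mem_univ j)⟩
    have hws : ∑ z ∈ t, w z = 1 := by
      conv_lhs => rw [himg]
      rw [Finset.sum_image fun i _ j _ e => hbij.injOn (Set.mem_univ _) (Set.mem_univ _) e]
      rw [← hsum]
      exact Finset.sum_congr rfl fun j _ => hw j
    have hwpos : ∀ z ∈ t, 0 < w z := by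
      intro z hz
      obtain ⟨j, -, rfl⟩ := hbij.surjOn hz
      rw [hw]; exact hy j
    obtain ⟨x, hx, hxw⟩ := hK.exists_mem_hull_face htK hws fun z hz => (hwpos z hz).le
    have hx0 := ((hK.mem_hull_face_iff htK).1 hx).2
    have key := h x (hull_mono htτ hx)
    have hprod : (∏ z ∈ t, bary K z x) ≠ 0 :=
      Finset.prod_ne_zero_iff.2 fun z hz => by rw [hxw z hz]; exact (hwpos z hz).ne'
    have hkey : ∑ I ∈ localIdx k τ, c I * facePiece A I K x =
        ∑ β ∈ multiIdx (t.card - 1) (k - t.card), c ⟨t, β⟩ * facePiece A ⟨t, β⟩ K x := by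
      unfold localIdx
      rw [Finset.sum_sigma]
      refine Finset.sum_eq_single_of_mem t (by simp [htτ, hcard]) fun s hs hst => ?_
      refine Finset.sum_eq_zero fun β hβ => ?_
      obtain ⟨hs1, hs2⟩ := Finset.mem_filter.1 hs
      by_cases hsub : s ⊆ t
      · rw [ih s.card (hn ▸ Finset.card_lt_card (hsub.ssubset_of_ne hst)) ⟨s, β⟩
          (mem_localIdx.2 ⟨Finset.mem_powerset.1 hs1, hs2, hβ⟩) rfl, zero_mul]
      · obtain ⟨z, hz, hzt⟩ := Finset.not_subset.1 hsub
        rw [facePiece_eq_zero A (I := ⟨s, β⟩) hz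
          (hx0 z (hτ (Finset.mem_powerset.1 hs1 hz)) hzt), mul_zero]
    rw [hkey] at key
    have hfac : ∀ β, facePiece A ⟨t, β⟩ K x = (∏ z ∈ t, bary K z x) * baryPoly β y := by
      intro β
      have e : (fun j => bary K (A t j) x) = y := funext fun j => by
        rw [hxw _ (hbij.mapsTo (Set.mem_univ j)), hw]
      simp [facePiece, htK, e]
    simp only [hfac] at key
    have : (∏ z ∈ t, bary K z x) * ∑ β ∈ multiIdx (t.card - 1) (k - t.card),
        c ⟨t, β⟩ * baryPoly β y = 0 := by
      rw [← key, Finset.mul_sum]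
      exact Finset.sum_congr rfl fun β _ => by ring
    exact (mul_eq_zero.1 this).resolve_left hprod

/-- The local facet functions are determined by their vertex values. -/
theorem IsCell.facetPiece_linearIndependent (hd : 2 ≤ d) (hK : IsCell K) {k : ℕ} (hk : Odd k)
    (e : Space d → ℝ) (h : ∀ y ∈ K, ∑ z ∈ K, e z * facetPiece k (K.erase z) K y = 0) :
    ∀ z ∈ K, e z = 0 := by
  have hd0 : (d : ℝ) ≠ 0 := by positivity
  have h1 : ∀ y ∈ K, ∑ z ∈ K, e z = d * e y := by
    intro y hy
    have := h y hy
    rw [Finset.sum_congr rfl fun z hz => by rw [hK.facetPiece_vertex hd hk hz hy]] at this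
    have h2 : ∑ z ∈ K, e z * (vertexScale d k / d * (1 - if y = z then (d : ℝ) else 0)) =
        vertexScale d k / d * (∑ z ∈ K, e z - d * e y) := by
      have h3 : (d : ℝ) * e y = ∑ z ∈ K, if y = z then (d : ℝ) * e z else 0 := by
        rw [Finset.sum_ite_eq, if_pos hy]
      rw [h3, ← Finset.sum_sub_distrib, Finset.mul_sum]
      refine Finset.sum_congr rfl fun z _ => ?_
      split_ifs <;> ring
    rw [h2] at this
    have := (mul_eq_zero.1 this).resolve_left (div_ne_zero (vertexScale_pos d k).ne' hd0)
    linarith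
  -- With `S = ∑ e`, adding the `d + 1` identities `S = d * e y` gives `(d + 1) * S = d * S`.
  have hC : ∑ z ∈ K, e z = 0 := by
    have := Finset.sum_congr rfl h1
    rw [Finset.sum_const, hK.card_eq, ← Finset.mul_sum, nsmul_eq_mul] at this
    push_cast at this
    linarith
  intro z hz
  have := h1 z hz
  rw [hC] at this
  exact (mul_eq_zero.1 this.symm).resolve_left hd0

/-- Evaluation at the vertices removes the face functions and forces the facet coefficients to
vanish; the independence of the face functions finishes. -/
theorem IsCell.shape_linearIndependent (hd : 2 ≤ d) (hK : IsCell K) {A : Numbering d}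
    (hA : ∀ t ⊆ K, t.Nonempty → Set.BijOn (A t) Set.univ (t : Set (Space d))) {k : ℕ}
    (hk : Odd k) (c : Idx d → ℝ) (e : Space d → ℝ)
    (h : ∀ x ∈ hull K, ∑ I ∈ localIdx k K, c I * facePiece A I K x +
      ∑ z ∈ K, e z * facetPiece k (K.erase z) K x = 0) :
    (∀ I ∈ localIdx k K, c I = 0) ∧ ∀ z ∈ K, e z = 0 := by
  have he : ∀ z ∈ K, e z = 0 := by
    refine hK.facetPiece_linearIndependent hd hk e fun y hy => ?_
    have := h y (subset_convexHull ℝ _ hy)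
    rwa [Finset.sum_eq_zero fun I hI => by
      rw [hK.facePiece_vertex A (mem_localIdx.1 hI).2.1.1 hy, mul_zero], zero_add] at this
  refine ⟨hK.facePiece_linearIndependent subset_rfl hA k c fun x hx => ?_, he⟩
  have := h x hx
  rwa [Finset.sum_eq_zero (s := K) fun z hz => by rw [he z hz, zero_mul], add_zero] at this

/-- There are `(d+1).choose j` faces with `j` vertices, and each carries `(k-1).choose (j-1)`
multi-indices. The added `d + 1` is the missing term `j = 1`, and Vandermonde's identity sums the
series. -/
theorem card_localIdx (hK : K.card = d + 1) {k : ℕ} (hk : 1 ≤ k) :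
    (localIdx k K).card + K.card = (k + d).choose d := by
  -- `g` extends the count `f` by the term `j = 1`, and drops the bound `j ≤ k` because the binomial
  -- coefficient vanishes beyond it.
  let g : ℕ → ℕ := fun j => if j = 0 then 0 else (k - 1).choose (j - 1)
  let f : ℕ → ℕ := fun j => if 2 ≤ j ∧ j ≤ k then (k - 1).choose (j - 1) else 0
  have h1 : (localIdx k K).card = ∑ t ∈ K.powerset, f t.card := by
    unfold localIdx
    rw [Finset.card_sigma, Finset.sum_filter]
    refine Finset.sum_congr rfl fun t _ => ?_
    simp only [f]
    split_ifs with h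
    · rw [card_multiIdx]; congr 1; omega
    · rfl
  have h2 : ∀ j, g j = f j + if j = 1 then 1 else 0 := by
    intro j
    simp only [f, g]
    rcases j with _ | _ | j
    · simp
    · simp
    · by_cases hj : j + 2 ≤ k
      · simp [hj]
      · simp [hj, Nat.choose_eq_zero_of_lt (by omega : k - 1 < j + 1)]
  have h3 : (localIdx k K).card + K.card = ∑ m ∈ Finset.range (d + 2), (d + 1).choose m * g m := by
    rw [h1, Finset.sum_powerset_apply_card, hK]
    simp only [h2, mul_add, Finset.sum_add_distrib, smul_eq_mul]
    simp
  have h4 : (k + d).choose k = ∑ m ∈ Finset.range (k + 1), (d + 1).choose m * g m := by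
    rw [show k + d = (d + 1) + (k - 1) by omega, Nat.add_choose_eq,
      Finset.Nat.sum_antidiagonal_eq_sum_range_succ_mk]
    refine Finset.sum_congr rfl fun m hm => ?_
    have hm' : m ≤ k := Nat.lt_succ_iff.1 (Finset.mem_range.1 hm)
    simp only [g]
    split_ifs with h0
    · subst h0; simp [Nat.choose_eq_zero_of_lt (by omega : k - 1 < k)]
    · rw [← Nat.choose_symm (by omega : m - 1 ≤ k - 1)]
      congr 2; omega
  -- The two sums end at `d + 1` and at `k`. Both are extended by zeros to a common range, which
  -- avoids comparing `d` with `k`.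
  have h5 : ∀ N, (∀ m, N ≤ m → (d + 1).choose m * g m = 0) → ∀ M, N ≤ M →
      ∑ m ∈ Finset.range N, (d + 1).choose m * g m =
        ∑ m ∈ Finset.range M, (d + 1).choose m * g m := fun N hN M hM =>
    Finset.sum_subset (Finset.range_mono hM) fun m _ hm => hN m (by simpa using hm)
  rw [h3, Nat.choose_symm_add.symm, h4,
    h5 (d + 2) (fun m hm => by rw [Nat.choose_eq_zero_of_lt (by omega), zero_mul]) (d + 2 + k)
      (by omega),
    h5 (k + 1) (fun m hm => by
      simp [g, Nat.choose_eq_zero_of_lt (by omega : k - 1 < m - 1)]) (d + 2 + k) (by omega)]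

/-- Every polynomial of degree at most `k` is a linear combination of the local shape functions. -/
theorem IsCell.exists_shape_sum (hd : 2 ≤ d) (hK : IsCell K) {A : Numbering d}
    (hA : ∀ t ⊆ K, t.Nonempty → Set.BijOn (A t) Set.univ (t : Set (Space d))) {k : ℕ}
    (hk : Odd k) {f : Space d → ℝ} (hf : f ∈ polySpace d k) :
    ∃ (c : Idx d → ℝ) (e : Space d → ℝ), ∀ x, f x = ∑ I ∈ localIdx k K, c I * facePiece A I K x +
      ∑ z ∈ K, e z * facetPiece k (K.erase z) K x := by
  let v : localIdx k K ⊕ K → polySpace d k := Sum.elim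
    (fun I => ⟨facePiece A I K, facePiece_mem_polySpace A I.2 K⟩)
    (fun z => ⟨facetPiece k (K.erase z) K, facetPiece_erase_mem_polySpace z.2 k⟩)
  have hval : ∀ (a : localIdx k K ⊕ K → ℝ) (x : Space d),
      ((∑ i, a i • v i : polySpace d k) : Space d → ℝ) x =
      ∑ I ∈ localIdx k K, (if h : I ∈ localIdx k K then a (Sum.inl ⟨I, h⟩) else 0) *
        facePiece A I K x + ∑ z ∈ K, (if h : z ∈ K then a (Sum.inr ⟨z, h⟩) else 0) *
        facetPiece k (K.erase z) K x := by
    intro a x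
    rw [Fintype.sum_sum_type, ← Finset.sum_coe_sort (localIdx k K), ← Finset.sum_coe_sort K]
    simp [v, Finset.sum_apply]
  have hli : LinearIndependent ℝ v := by
    rw [Fintype.linearIndependent_iff]
    intro a ha
    obtain ⟨h1, h2⟩ := hK.shape_linearIndependent hd hA hk _ _ fun x _ => by
      rw [← hval a x, ha]; rfl
    rintro (I | z)
    · simpa using h1 I I.2
    · simpa using h2 z z.2
  -- An independent family has at most as many members as the dimension, and the count shows that
  -- this one has at least as many; so it is a basis.
  have hcard : Fintype.card (localIdx k K ⊕ K) = Module.finrank ℝ (polySpace d k) := by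
    refine le_antisymm hli.fintype_card_le_finrank ((finrank_polySpace_le d k).trans ?_)
    rw [Fintype.card_sum, Fintype.card_coe, Fintype.card_coe, card_localIdx hK.card_eq hk.pos]
  have hspan := hli.span_eq_top_of_card_eq_finrank' hcard
  have hmem : (⟨f, hf⟩ : polySpace d k) ∈ Submodule.span ℝ (Set.range v) := by
    rw [hspan]; trivial
  obtain ⟨a, ha⟩ := (Submodule.mem_span_range_iff_exists_fun ℝ).1 hmem
  refine ⟨fun I => if h : I ∈ localIdx k K then a (Sum.inl ⟨I, h⟩) else 0,
    fun z => if h : z ∈ K then a (Sum.inr ⟨z, h⟩) else 0, fun x => ?_⟩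
  rw [← hval a x, ha]

end

section

/-! ### Geometry of a mesh -/

namespace Mesh

open Filter Topology

variable {d : ℕ} {Ω : Set (Space d)} (T : Mesh Ω) {K K' F τ σ : Finset (Space d)}

theorem mem_faces : τ ∈ T.faces ↔ τ ∈ T.complex.faces := by simp [faces]

theorem mem_cells : K ∈ T.cells ↔ K ∈ T.faces ∧ K.card = d + 1 := by simp [cells]

theorem mem_facets : F ∈ T.facets ↔ F ∈ T.faces ∧ F.card = d := by simp [facets]

theorem mem_bdryFaces : τ ∈ T.bdryFaces ↔ τ ∈ T.faces ∧ hull τ ⊆ frontier Ω := by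
  simp [bdryFaces]

theorem mem_bdryFacets : F ∈ T.bdryFacets ↔ F ∈ T.facets ∧ hull F ⊆ frontier Ω := by
  simp [bdryFacets]

theorem isCell (hK : K ∈ T.cells) : IsCell K :=
  ⟨T.complex.indep (T.mem_faces.1 (T.mem_cells.1 hK).1), (T.mem_cells.1 hK).2⟩

theorem exists_cell (hτ : τ ∈ T.faces) : ∃ K ∈ T.cells, τ ⊆ K := by
  obtain ⟨K, hK, h1, h2⟩ := T.pure τ (T.mem_faces.1 hτ)
  exact ⟨K, T.mem_cells.2 ⟨T.mem_faces.2 hK, h2⟩, h1⟩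

theorem mem_faces_of_subset (hK : K ∈ T.faces) (h : τ ⊆ K) (hτ : τ.Nonempty) : τ ∈ T.faces :=
  T.mem_faces.2 (T.complex.down_closed (T.mem_faces.1 hK) h hτ)

theorem cell_mem_faces (hK : K ∈ T.cells) : K ∈ T.faces := (T.mem_cells.1 hK).1

theorem mem_closure_iff {x : Space d} : x ∈ closure Ω ↔ ∃ K ∈ T.cells, x ∈ hull K := by
  rw [← T.space_eq, Geometry.SimplicialComplex.mem_space_iff]
  constructor
  · rintro ⟨τ, hτ, hx⟩
    obtain ⟨K, hK, h⟩ := T.exists_cell (T.mem_faces.2 hτ)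
    exact ⟨K, hK, hull_mono h hx⟩
  · rintro ⟨K, hK, hx⟩
    exact ⟨K, T.mem_faces.1 (T.cell_mem_faces hK), hx⟩

theorem hull_subset_closure (hK : K ∈ T.cells) : hull K ⊆ closure Ω :=
  fun _ hx => T.mem_closure_iff.2 ⟨K, hK, hx⟩

theorem mem_hull_inter (hK : K ∈ T.cells) (hK' : K' ∈ T.cells) {x : Space d} (hx : x ∈ hull K)
    (hx' : x ∈ hull K') : x ∈ hull (K ∩ K') := by
  have := T.complex.inter_subset_convexHull (T.mem_faces.1 (T.cell_mem_faces hK))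
    (T.mem_faces.1 (T.cell_mem_faces hK')) ⟨hx, hx'⟩
  rwa [← Finset.coe_inter] at this

theorem interior_hull_subset (hreg : interior (closure Ω) = Ω) (hK : K ∈ T.cells) :
    interior (hull K) ⊆ Ω := by
  conv_rhs => rw [← hreg]
  exact interior_mono (T.hull_subset_closure hK)

theorem bary_eq (hK : K ∈ T.cells) (hK' : K' ∈ T.cells) {x : Space d} (hx : x ∈ hull K)
    (hx' : x ∈ hull K') (z : Space d) : bary K z x = bary K' z x :=
  (T.isCell hK).bary_eq_of_mem_hull (T.isCell hK') Finset.inter_subset_left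
    Finset.inter_subset_right (T.mem_hull_inter hK hK' hx hx') z

/-- Conformity places a common point in the hull of the common vertices, where the coordinates of
all other vertices vanish. -/
theorem mem_of_bary_ne_zero (hK : K ∈ T.cells) (hK' : K' ∈ T.cells) {x z : Space d}
    (hx : x ∈ hull K) (hx' : x ∈ hull K') (hz : z ∈ K) (h : bary K z x ≠ 0) : z ∈ K' := by
  by_contra hz'
  exact h (((T.isCell hK).mem_hull_face_iff Finset.inter_subset_left).1
    (T.mem_hull_inter hK hK' hx hx') |>.2 z hz fun h => hz' (Finset.mem_inter.1 h).2)

theorem eq_of_mem_interior (hK : K ∈ T.cells) (hK' : K' ∈ T.cells) {x : Space d}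
    (hx : x ∈ interior (hull K)) (hx' : x ∈ hull K') : K = K' := by
  refine Finset.eq_of_subset_of_card_le (fun z hz => ?_) ?_
  · exact T.mem_of_bary_ne_zero hK hK' (interior_subset hx) hx' hz
      ((T.isCell hK).mem_interior_hull_iff.1 hx z hz).ne'
  · rw [(T.isCell hK).card_eq, (T.isCell hK').card_eq]

theorem idxIn_eq (k : ℕ) (hσ : σ ∈ T.faces) : T.idxIn k σ = localIdx k σ := by
  ext I
  simp only [idxIn, idx, Finset.mem_filter, Finset.mem_sigma, mem_localIdx]
  constructor
  · rintro ⟨⟨⟨_, h1⟩, h2⟩, h3⟩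
    exact ⟨h3, h1, h2⟩
  · rintro ⟨h1, h2, h3⟩
    exact ⟨⟨⟨T.mem_faces_of_subset hσ h1 (Finset.card_pos.1 (by omega)), h2⟩, h3⟩, h1⟩

theorem facet_eq_erase (hK : K ∈ T.cells) (hF : F ∈ T.facets) (h : F ⊆ K) :
    ∃ z ∈ K, F = K.erase z := by
  have h1 := (T.isCell hK).card_eq
  have h2 := (T.mem_facets.1 hF).2
  have h3 : (K \ F).card = 1 := by rw [Finset.card_sdiff_of_subset h]; omega
  obtain ⟨z, hz⟩ := Finset.card_eq_one.1 h3
  have hz' : z ∈ K \ F := by rw [hz]; exact Finset.mem_singleton_self z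
  rw [Finset.mem_sdiff] at hz'
  refine ⟨z, hz'.1, Finset.eq_of_subset_of_card_le (fun y hy => ?_) ?_⟩
  · exact Finset.mem_erase.2 ⟨fun e => hz'.2 (e ▸ hy), h hy⟩
  · rw [Finset.card_erase_of_mem hz'.1]; omega

theorem erase_mem_facets (hd : 2 ≤ d) (hK : K ∈ T.cells) {z : Space d} (hz : z ∈ K) :
    K.erase z ∈ T.facets := by
  have h : (K.erase z).card = d := by
    rw [Finset.card_erase_of_mem hz, (T.isCell hK).card_eq]; omega
  exact T.mem_facets.2 ⟨T.mem_faces_of_subset (T.cell_mem_faces hK) (Finset.erase_subset _ _)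
    (Finset.card_pos.1 (by omega)), h⟩

theorem notMem_frontier (hΩ : IsOpen Ω) {x : Space d} (hx : x ∈ Ω) : x ∉ frontier Ω := by
  rw [hΩ.frontier_eq]; exact fun h => h.2 hx

theorem mem_frontier (hΩ : IsOpen Ω) (hK : K ∈ T.cells) {x : Space d} (hx : x ∈ hull K)
    (h : x ∉ Ω) : x ∈ frontier Ω := by
  rw [hΩ.frontier_eq]; exact ⟨T.hull_subset_closure hK hx, h⟩

/-- If one point of the relative interior of a face lies in `Ω`, then all of them do. -/
theorem mem_of_relInterior (hreg : interior (closure Ω) = Ω) (hK : K ∈ T.cells) (hσ : σ ⊆ K)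
    {x x' : Space d} (hx : x ∈ hull σ) (hx' : x' ∈ hull σ) (hpos : ∀ z ∈ σ, 0 < bary K z x)
    (hpos' : ∀ z ∈ σ, 0 < bary K z x') (hmem : x ∈ Ω) : x' ∈ Ω := by
  rw [← hreg, mem_interior_iff_mem_nhds]
  have hxK := hull_mono hσ hx
  -- The finitely many simplices that miss `x` stay away from a neighbourhood of `x`, so near `x`
  -- only simplices through `x` are needed to cover `closure Ω`.
  have hnear : ∀ᶠ y in 𝓝 x, ∃ L ∈ T.cells, x ∈ hull L ∧ y ∈ hull L := by
    have h1 : closure Ω ∈ 𝓝 x := mem_interior_iff_mem_nhds.1 (hreg.symm ▸ hmem)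
    have h2 : ∀ᶠ y in 𝓝 x, ∀ L ∈ T.cells, x ∉ hull L → y ∉ hull L := by
      rw [Filter.eventually_all_finset]
      intro L _
      by_cases hL : x ∈ hull L
      · exact Eventually.of_forall fun _ h => absurd hL h
      · filter_upwards [(isCompact_hull L).isClosed.isOpen_compl.mem_nhds hL] with y hy _ using hy
    filter_upwards [h1, h2] with y hy1 hy2
    obtain ⟨L, hL, hyL⟩ := T.mem_closure_iff.1 hy1
    exact ⟨L, hL, by by_contra h; exact hy2 L hL h hyL, hyL⟩
  have hpos2 : ∀ᶠ y in 𝓝 x', ∀ L ∈ T.cells, σ ⊆ L → ∀ z ∈ σ, 0 ≤ bary L z y := by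
    rw [Filter.eventually_all_finset]
    intro L hL
    by_cases hσL : σ ⊆ L
    · have : ∀ᶠ y in 𝓝 x', ∀ z ∈ σ, 0 ≤ bary L z y := by
        rw [Filter.eventually_all_finset]
        intro z hz
        have h0 : 0 < bary L z x' := by
          rw [(T.isCell hL).bary_eq_of_mem_hull (T.isCell hK) hσL hσ hx' z]; exact hpos' z hz
        filter_upwards [(continuous_bary L z).continuousAt.eventually (lt_mem_nhds h0)] with y hy
          using hy.le
      filter_upwards [this] with y hy _ using hy
    · exact Eventually.of_forall fun _ h => absurd h hσL
  -- Translation by `x - x'` carries a neighbourhood of `x'` to one of `x`; the simplex `L` found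
  -- there contains the whole face `σ`, and it is shown to contain `y` as well.
  have htend : Tendsto (fun y => (y - x') + x) (𝓝 x') (𝓝 x) := by
    have : Continuous fun y : Space d => (y - x') + x := by fun_prop
    simpa using this.tendsto x'
  filter_upwards [htend.eventually hnear, hpos2] with y ⟨L, hL, hxL, hyL⟩ hy2
  have hσL : σ ⊆ L := fun z hz =>
    T.mem_of_bary_ne_zero hK hL hxK hxL (hσ hz) (hpos z hz).ne'
  refine T.hull_subset_closure hL ((T.isCell hL).mem_hull_iff.2 fun z hz => ?_)
  by_cases hzσ : z ∈ σ
  · exact hy2 L hL hσL z hzσ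
  -- For a vertex outside `σ` the coordinate vanishes at both `x` and `x'`, so `y` and its translate
  -- have the same coordinate.
  · have h1 := (T.isCell hL).mem_hull_iff.1 hyL z hz
    have h2 := ((T.isCell hL).mem_hull_face_iff hσL).1 hx |>.2 z hz hzσ
    have h3 := ((T.isCell hL).mem_hull_face_iff hσL).1 hx' |>.2 z hz hzσ
    have h4 := (bary L z).map_vadd x (y - x')
    have h5 := (bary L z).map_vadd x' (y - x')
    simp only [vadd_eq_add, sub_add_cancel] at h4 h5
    linarith

/-- The face that carries a boundary point is a boundary face. -/
theorem hull_filter_subset_frontier (hΩ : IsOpen Ω) (hreg : interior (closure Ω) = Ω)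
    (hK : K ∈ T.cells) {x : Space d} (hx : x ∈ hull K) (hxΩ : x ∈ frontier Ω) :
    hull (K.filter fun z => bary K z x ≠ 0) ⊆ frontier Ω := by
  set σ := K.filter fun z => bary K z x ≠ 0 with hσdef
  have hσ : σ ⊆ K := Finset.filter_subset _ _
  have hC := T.isCell hK
  have hxσ : x ∈ hull σ := hC.mem_hull_filter hx
  have hpos : ∀ z ∈ σ, 0 < bary K z x := fun z hz =>
    lt_of_le_of_ne (hC.mem_hull_iff.1 hx z (hσ hz)) (Finset.mem_filter.1 hz).2.symm
  have hrel : ∀ x' ∈ hull σ, (∀ z ∈ σ, 0 < bary K z x') → x' ∈ frontier Ω := fun x' hx' hp =>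
    T.mem_frontier hΩ hK (hull_mono hσ hx') fun h =>
      notMem_frontier hΩ (T.mem_of_relInterior hreg hK hσ hx' hxσ hp hpos h) hxΩ
  intro x' hx'
  -- An arbitrary point of the face is the limit, along the segment towards `x`, of points in the
  -- relative interior.
  refine isClosed_frontier.mem_of_tendsto (f := fun t : ℝ => x' + t • (x - x'))
    (b := 𝓝[>] (0 : ℝ)) ?_ ?_
  · have : Continuous fun t : ℝ => x' + t • (x - x') := by fun_prop
    simpa using this.continuousWithinAt.tendsto (x := 0) (s := Set.Ioi 0)
  · filter_upwards [Ioo_mem_nhdsGT (zero_lt_one (α := ℝ))] with t ht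
    have hmem : x' + t • (x - x') ∈ hull σ :=
      (convex_convexHull ℝ _).add_smul_sub_mem hx' hxσ ⟨ht.1.le, ht.2.le⟩
    refine hrel _ hmem fun z hz => ?_
    have h1 : bary K z (x' + t • (x - x')) = (1 - t) * bary K z x' + t * bary K z x := by
      have := (bary K z).apply_lineMap x' x t
      rw [AffineMap.lineMap_apply, AffineMap.lineMap_apply] at this
      simp only [vsub_eq_sub, vadd_eq_add, smul_eq_mul] at this
      rw [add_comm, this]; ring
    have h2 := ((hC.mem_hull_face_iff hσ).1 hx').1 z hz
    have h3 := hpos z hz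
    rw [h1]
    have := ht.1
    have h4 : 0 < 1 - t := by linarith [ht.2]
    positivity

/-- The conforming functions of inner faces vanish on the boundary. -/
theorem facePiece_eq_zero_of_mem_frontier (hΩ : IsOpen Ω) (hreg : interior (closure Ω) = Ω)
    (A : Numbering d) {I : Idx d} (hI : I.1 ∈ T.innerFaces) (hK : K ∈ T.cells) {x : Space d}
    (hx : x ∈ hull K) (hxΩ : x ∈ frontier Ω) : facePiece A I K x = 0 := by
  by_contra hne
  obtain ⟨h1, h2⟩ := Finset.mem_sdiff.1 hI
  have hIK : I.1 ⊆ K := by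
    by_contra h; exact hne (by simp [facePiece, h])
  -- If the bubble is nonzero at `x`, the face lies in the carrier face of `x`, which is contained
  -- in `∂Ω`; the face would then not be inner.
  refine h2 (T.mem_bdryFaces.2 ⟨h1, (hull_mono fun z hz => ?_).trans
    (T.hull_filter_subset_frontier hΩ hreg hK hx hxΩ)⟩)
  exact Finset.mem_filter.2 ⟨hIK hz, fun h => hne (facePiece_eq_zero A hz h)⟩

/-- A boundary facet belongs to only one simplex. -/
theorem cell_unique (hd : 2 ≤ d) (hΩ : IsOpen Ω) (hreg : interior (closure Ω) = Ω)
    (hF : F ∈ T.bdryFacets) (hK : K ∈ T.cells) (hK' : K' ∈ T.cells) (hFK : F ⊆ K)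
    (hFK' : F ⊆ K') : K = K' := by
  by_contra hne
  obtain ⟨hF1, hF2⟩ := T.mem_bdryFacets.1 hF
  obtain ⟨z, hz, hFz⟩ := T.facet_eq_erase hK hF1 hFK
  obtain ⟨z', hz', hFz'⟩ := T.facet_eq_erase hK' hF1 hFK'
  have hC := T.isCell hK
  have hC' := T.isCell hK'
  have hd0 : (0 : ℝ) < d := by positivity
  -- `x` is the barycentre of `F`. Two simplices on `F` will be shown to cover a neighbourhood of
  -- it, which contradicts `x ∈ ∂Ω`.
  obtain ⟨x, hx, hxw⟩ := hC.exists_mem_hull_face hFK (w := fun _ => 1 / (d : ℝ))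
    (by rw [Finset.sum_const, (T.mem_facets.1 hF1).2, nsmul_eq_mul]; field_simp)
    (fun _ _ => by positivity)
  refine notMem_frontier hΩ (x := x) ?_ (hF2 hx)
  rw [← hreg, mem_interior_iff_mem_nhds]
  have hzF : z ∉ F := by rw [hFz]; simp
  have hzF' : z' ∉ F := by rw [hFz']; simp
  have memF : ∀ {w}, w ∈ K → w ≠ z → w ∈ F := fun hw h => by
    rw [hFz]; exact Finset.mem_erase.2 ⟨h, hw⟩
  have memF' : ∀ {w}, w ∈ K' → w ≠ z' → w ∈ F := fun hw h => by
    rw [hFz']; exact Finset.mem_erase.2 ⟨h, hw⟩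
  have hpos : ∀ᶠ y in 𝓝 x, ∀ w ∈ F, 0 < bary K w y := by
    rw [Filter.eventually_all_finset]
    intro w hw
    refine (continuous_bary K w).continuousAt.eventually (lt_mem_nhds ?_)
    dsimp only
    rw [hxw w hw]; positivity
  have hpos' : ∀ᶠ y in 𝓝 x, ∀ w ∈ F, 0 < bary K' w y := by
    rw [Filter.eventually_all_finset]
    intro w hw
    refine (continuous_bary K' w).continuousAt.eventually (lt_mem_nhds ?_)
    dsimp only
    rw [← hC.bary_eq_of_mem_hull hC' hFK hFK' hx, hxw w hw]; positivity
  -- Both coordinates vanish on the hyperplane of `F`, so they are proportional; evaluation at `z`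
  -- gives the factor, whose sign tells on which side of `F` the two apexes lie.
  have hprop : bary K' z' = bary K' z' z • bary K z := by
    refine hC.affineMap_ext fun y hy => ?_
    rw [AffineMap.coe_smul, Pi.smul_apply, hC.bary_vertex z hy]
    by_cases e : y = z
    · simp [e]
    · have hyF := memF hy e
      have e' : y ≠ z' := fun h => hzF' (h ▸ hyF)
      rw [hC'.bary_vertex z' (hFK' hyF), if_neg e', if_neg e, smul_zero]
  have hprop' : ∀ y, bary K' z' y = bary K' z' z * bary K z y := fun y => by
    conv_lhs => rw [hprop]
    simp
  have hxz : bary K z x = 0 := ((hC.mem_hull_face_iff hFK).1 hx).2 z hz hzF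
  -- If both apexes were on the same side, a short step from `x` towards `z` would reach an interior
  -- point of `K` that also lies in `K'`.
  have hc : bary K' z' z ≤ 0 := by
    by_contra! hc
    have htend : Tendsto (fun t : ℝ => x + t • (z - x)) (𝓝[>] 0) (𝓝 x) := by
      have : Continuous fun t : ℝ => x + t • (z - x) := by fun_prop
      simpa using this.continuousWithinAt.tendsto (x := 0) (s := Set.Ioi 0)
    obtain ⟨t, ⟨h1, h2⟩, ht⟩ := ((htend.eventually (hpos.and hpos')).and
      (self_mem_nhdsWithin (a := (0 : ℝ)) (s := Set.Ioi 0))).exists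
    have hval : bary K z (x + t • (z - x)) = t := by
      have := (bary K z).apply_lineMap x z t
      rw [AffineMap.lineMap_apply, AffineMap.lineMap_apply] at this
      simp only [vsub_eq_sub, vadd_eq_add, smul_eq_mul, hxz, hC.bary_vertex z hz] at this
      rw [add_comm, this]; simp
    have ht0 : 0 < t := ht
    refine hne (T.eq_of_mem_interior hK hK' (x := x + t • (z - x)) ?_ ?_)
    · refine hC.mem_interior_hull_iff.2 fun w hw => ?_
      by_cases e : w = z
      · rw [e, hval]; exact ht0
      · exact h1 w (memF hw e)
    · refine hC'.mem_hull_iff.2 fun w hw => ?_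
      by_cases e : w = z'
      · rw [e, hprop', hval]; positivity
      · exact (h2 w (memF' hw e)).le
  filter_upwards [hpos, hpos'] with y hy hy'
  -- The sign of the transversal coordinate decides which of the two simplices contains `y`.
  by_cases hy0 : 0 ≤ bary K z y
  · refine T.hull_subset_closure hK (hC.mem_hull_iff.2 fun w hw => ?_)
    by_cases e : w = z
    · rw [e]; exact hy0
    · exact (hy w (memF hw e)).le
  · refine T.hull_subset_closure hK' (hC'.mem_hull_iff.2 fun w hw => ?_)
    by_cases e : w = z'
    · rw [e, hprop']; exact mul_nonneg_of_nonpos_of_nonpos hc (not_le.1 hy0).le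
    · exact (hy' w (memF' hw e)).le

/-- If the mesh has more than one simplex, then each simplex has an inner facet. -/
theorem exists_inner_facet (hd : 2 ≤ d) (hconn : IsConnected Ω)
    (hreg : interior (closure Ω) = Ω) (hΩ : IsOpen Ω) (hT : 1 < T.cells.card)
    (hK : K ∈ T.cells) : ∃ z ∈ K, K.erase z ∈ T.innerFacets := by
  by_contra! h
  have hC := T.isCell hK
  have hbd : ∀ z ∈ K, hull (K.erase z) ⊆ frontier Ω := by
    intro z hz
    have h1 : K.erase z ∈ T.bdryFacets := by
      by_contra h2
      exact h z hz (Finset.mem_sdiff.2 ⟨T.erase_mem_facets hd hK hz, h2⟩)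
    exact (T.mem_bdryFacets.1 h1).2
  -- If all facets of `K` were in `∂Ω`, the boundary of `K` would not meet `Ω`.
  have hint : hull K ∩ Ω ⊆ interior (hull K) := by
    rintro x ⟨hx, hxΩ⟩
    refine hC.mem_interior_hull_iff.2 fun z hz =>
      lt_of_le_of_ne (hC.mem_hull_iff.1 hx z hz) fun h0 => ?_
    refine notMem_frontier hΩ hxΩ (hbd z hz ((hC.mem_hull_face_iff (K.erase_subset z)).2
      ⟨fun w hw => hC.mem_hull_iff.1 hx w (Finset.mem_of_mem_erase hw), fun w hw hw' => ?_⟩))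
    have : w = z := by by_contra e; exact hw' (Finset.mem_erase.2 ⟨e, hw⟩)
    rw [this, ← h0]
  -- The connected set `Ω` is covered by the disjoint open sets `interior (hull K)` and the
  -- complement of `hull K`, and it meets the first; this leaves no room for a second simplex.
  have hsub : Ω ⊆ interior (hull K) := by
    refine hconn.isPreconnected.subset_left_of_subset_union isOpen_interior
      (isCompact_hull K).isClosed.isOpen_compl
      (Set.disjoint_left.2 fun x hx hx' => hx' (interior_subset hx)) (fun x hx => ?_) ?_
    · by_cases hxK : x ∈ hull K
      · exact Or.inl (hint ⟨hxK, hx⟩)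
      · exact Or.inr hxK
    · obtain ⟨x, hx⟩ := hC.interior_nonempty
      exact ⟨x, T.interior_hull_subset hreg hK hx, hx⟩
  obtain ⟨K', hK', hne⟩ := Finset.exists_mem_ne hT K
  obtain ⟨x, hx⟩ := (T.isCell hK').interior_nonempty
  exact hne (T.eq_of_mem_interior hK' hK hx
    (interior_subset (hsub (T.interior_hull_subset hreg hK' hx))))

end Mesh

end

section

/-! ### Measures on simplices and facets -/

/-- A finite moment problem in `L²` is solvable once every linear relation between the test
functions also holds between the prescribed moments. A dual vector that separates the moments from
the range of the moment map would produce a violated relation. -/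
theorem exists_weight {X ι : Type*} [MeasurableSpace X] {μ : Measure X} (s : Finset ι)
    {f : ι → X → ℝ} (hf : ∀ i ∈ s, MemLp (f i) 2 μ) (a : ι → ℝ)
    (h : ∀ c : ι → ℝ, (fun x => ∑ i ∈ s, c i * f i x) =ᵐ[μ] 0 → ∑ i ∈ s, c i * a i = 0) :
    ∃ g : X → ℝ, MemLp g 2 μ ∧ ∀ i ∈ s, ∫ x, g x * f i x ∂μ = a i := by
  let F : s → Lp ℝ 2 μ := fun i => (hf i i.2).toLp (f i)
  let Φ : Lp ℝ 2 μ →ₗ[ℝ] (s → ℝ) := LinearMap.pi fun i => (innerSL ℝ (F i)).toLinearMap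
  have hmem : (fun i : s => a i) ∈ LinearMap.range Φ := by
    by_contra hn
    obtain ⟨φ, hφ1, hφ2⟩ := Submodule.exists_le_ker_of_notMem hn
    let c : ι → ℝ := fun i => if hi : i ∈ s then φ (Pi.single ⟨i, hi⟩ 1) else 0
    have hφ : ∀ v : s → ℝ, φ v = ∑ i : s, c i * v i := by
      intro v
      conv_lhs => rw [← Finset.univ_sum_single v, map_sum]
      refine Finset.sum_congr rfl fun i _ => ?_
      have : (Pi.single i (v i) : s → ℝ) = v i • Pi.single i 1 := by
        rw [← Pi.single_smul]; simp
      rw [this, map_smul]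
      simp [c, mul_comm]
    -- The dual vector annihilates the moments of every `L²` function. Applied to the combination
    -- itself, this says that its norm is zero.
    have h0 : ∑ i : s, c i • F i = 0 := by
      refine inner_self_eq_zero (𝕜 := ℝ).1 ?_
      have h1 : φ (Φ (∑ i : s, c i • F i)) = 0 := hφ2 ⟨_, rfl⟩
      rw [hφ] at h1
      rw [sum_inner, ← h1]
      exact Finset.sum_congr rfl fun i _ => by rw [inner_smul_left]; rfl
    apply hφ1
    rw [hφ]
    have hae : (fun x => ∑ i ∈ s, c i * f i x) =ᵐ[μ] 0 := by
      have h2 : ((∑ i : s, c i • F i : Lp ℝ 2 μ) : X → ℝ) =ᵐ[μ]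
          fun x => ∑ i ∈ s, c i * f i x := by
        have h3 : ∀ i : s, ((c i • F i : Lp ℝ 2 μ) : X → ℝ) =ᵐ[μ] fun x => c i * f i x := by
          intro i
          filter_upwards [Lp.coeFn_smul (c i) (F i), (hf i i.2).coeFn_toLp] with x h4 h5
          rw [h4, Pi.smul_apply, h5, smul_eq_mul]
        have h6 := Lp.coeFn_finsetSum (μ := μ) (p := 2) Finset.univ fun i : s => c i • F i
        filter_upwards [h6, ae_all_iff.2 h3] with x h7 h8
        rw [h7, Finset.sum_apply, Finset.sum_congr rfl fun i _ => h8 i,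
          Finset.sum_coe_sort s fun i => c i * f i x]
      rw [h0] at h2
      exact h2.symm.trans (Lp.coeFn_zero _ _ _)
    rw [Finset.sum_coe_sort s fun i => c i * a i]
    exact h c hae
  obtain ⟨g, hg⟩ := hmem
  refine ⟨g, Lp.memLp g, fun i hi => ?_⟩
  have := congrFun hg ⟨i, hi⟩
  rw [← this]
  change _ = inner ℝ (F ⟨i, hi⟩) g
  rw [L2.inner_def]
  refine integral_congr_ae ?_
  filter_upwards [(hf i hi).coeFn_toLp] with x hx
  simp only [F, hx, RCLike.inner_apply, conj_trivial]

variable {d : ℕ} {K K' F τ : Finset (Space d)} {z : Space d}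

/-- A continuous function that vanishes almost everywhere on a simplex vanishes on it. -/
theorem IsCell.eq_zero_of_ae (hK : IsCell K) {f : Space d → ℝ} (hf : Continuous f)
    (h : f =ᵐ[volume.restrict (hull K)] 0) {x : Space d} (hx : x ∈ hull K) : f x = 0 := by
  have h1 : f =ᵐ[volume.restrict (interior (hull K))] 0 :=
    ae_restrict_of_ae_restrict_of_subset interior_subset h
  have h2 : Set.EqOn f 0 (interior (hull K)) := by
    refine Measure.eqOn_open_of_ae_eq h1 isOpen_interior hf.continuousOn continuousOn_const
  rw [← hK.closure_interior] at hx
  exact Set.EqOn.closure h2 hf continuous_const hx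

/-- The isometric parametrization of the hyperplane of the facet `F` by its direction. -/
def facetParam (F : Finset (Space d)) (p : Space d) :
    vectorSpan ℝ (F : Set (Space d)) → Space d := fun v => v + p

theorem isometry_facetParam (F : Finset (Space d)) (p : Space d) :
    Isometry (facetParam F p) :=
  (IsometryEquiv.addRight p).isometry.comp isometry_subtype_coe

theorem hull_subset_range_facetParam {p : Space d} (hp : p ∈ F) :
    hull F ⊆ Set.range (facetParam F p) := by
  intro x hx
  have h1 := convexHull_subset_affineSpan (𝕜 := ℝ) (F : Set (Space d)) hx
  have h2 : p ∈ affineSpan ℝ (F : Set (Space d)) := subset_affineSpan ℝ _ hp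
  refine ⟨⟨x - p, ?_⟩, by simp [facetParam]⟩
  rw [← direction_affineSpan]
  exact AffineSubspace.vsub_mem_direction h1 h2

theorem IsCell.finrank_vectorSpan_erase (hd : 2 ≤ d) (hK : IsCell K) (hz : z ∈ K) :
    Module.finrank ℝ (vectorSpan ℝ ((K.erase z : Finset (Space d)) : Set (Space d))) = d - 1 := by
  have h1 : AffineIndependent ℝ ((↑) : ↥(K.erase z) → Space d) :=
    hK.indep.mono (t := (K : Set (Space d))) (by simp)
  have h2 := h1.finrank_vectorSpan (n := d - 1) (by
    rw [Fintype.card_coe, Finset.card_erase_of_mem hz, hK.card_eq]; omega)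
  have h3 : Set.range ((↑) : ↥(K.erase z) → Space d) = ((K.erase z : Finset (Space d)) : Set _) :=
    Subtype.range_coe
  rwa [h3] at h2

/-- Hausdorff measure is invariant under isometries and equals Lebesgue measure on the
`(d-1)`-dimensional direction space. This reduces surface integrals to ordinary ones. -/
theorem IsCell.facetMeasure_eq_map (hd : 2 ≤ d) (hK : IsCell K) (hz : z ∈ K) {p : Space d}
    (hp : p ∈ K.erase z) : facetMeasure (K.erase z) =
      (volume.restrict (facetParam (K.erase z) p ⁻¹' hull (K.erase z))).map
        (facetParam (K.erase z) p) := by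
  have hiso := isometry_facetParam (K.erase z) p
  have h1 := hiso.map_euclideanHausdorffMeasure (d := d - 1)
  have h2 : (Measure.euclideanHausdorffMeasure (d - 1) : Measure
      (vectorSpan ℝ ((K.erase z : Finset (Space d)) : Set (Space d)))) = volume := by
    rw [← hK.finrank_vectorSpan_erase hd hz]
    exact InnerProductSpace.euclideanHausdorffMeasure_eq_volume
  rw [h2] at h1
  rw [← hiso.isClosedEmbedding.measurableEmbedding.restrict_map, h1, facetMeasure,
    Measure.restrict_restrict (isCompact_hull _).measurableSet,
    Set.inter_eq_left.2 (hull_subset_range_facetParam hp)]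

theorem IsCell.isFiniteMeasure_facetMeasure (hd : 2 ≤ d) (hK : IsCell K) (hz : z ∈ K) :
    IsFiniteMeasure (facetMeasure (K.erase z)) := by
  obtain ⟨p, hp⟩ : (K.erase z).Nonempty := Finset.card_pos.1 (by
    rw [Finset.card_erase_of_mem hz, hK.card_eq]; omega)
  rw [hK.facetMeasure_eq_map hd hz hp]
  have : IsCompact (facetParam (K.erase z) p ⁻¹' hull (K.erase z)) :=
    (isometry_facetParam _ p).isClosedEmbedding.isCompact_preimage (isCompact_hull _)
  have : IsFiniteMeasure (volume.restrict (facetParam (K.erase z) p ⁻¹' hull (K.erase z))) :=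
    isFiniteMeasure_restrict.2 this.measure_lt_top.ne
  infer_instance

theorem IsCell.bary_erase (hK : IsCell K) (hz : z ∈ K) {x : Space d}
    (hx : x ∈ hull (K.erase z)) : bary K z x = 0 :=
  ((hK.mem_hull_face_iff (K.erase_subset z)).1 hx).2 z hz (by simp)

theorem IsCell.bary_facetParam (hK : IsCell K) {p : Space d}
    (hp : p ∈ K.erase z) (v) : bary K z (facetParam (K.erase z) p v) = 0 := by
  have h := AffineMap.eqOn_affineSpan (s := ((K.erase z : Finset (Space d)) : Set (Space d)))
    (f := bary K z) (g := AffineMap.const ℝ (Space d) 0) (fun y hy => by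
      have := Finset.mem_erase.1 hy
      rw [hK.bary_vertex z this.2, if_neg this.1]; rfl)
  refine h (x := facetParam (K.erase z) p v) ?_
  have h2 : p ∈ affineSpan ℝ ((K.erase z : Finset (Space d)) : Set (Space d)) :=
    subset_affineSpan ℝ _ hp
  have h3 : (v : Space d) ∈
      (affineSpan ℝ ((K.erase z : Finset (Space d)) : Set (Space d))).direction := by
    rw [direction_affineSpan]; exact v.2
  exact AffineSubspace.vadd_mem_of_mem_direction h3 h2

/-- A continuous function that vanishes almost everywhere on a facet vanishes on it. -/
theorem IsCell.eq_zero_of_ae_facet (hd : 2 ≤ d) (hK : IsCell K) (hz : z ∈ K) {f : Space d → ℝ}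
    (hf : Continuous f) (h : f =ᵐ[facetMeasure (K.erase z)] 0) {x : Space d}
    (hx : x ∈ hull (K.erase z)) : f x = 0 := by
  have hcard : (K.erase z).card = d := by
    rw [Finset.card_erase_of_mem hz, hK.card_eq]; omega
  obtain ⟨p, hp⟩ : (K.erase z).Nonempty := Finset.card_pos.1 (by omega)
  have hE := isometry_facetParam (K.erase z) p
  rw [hK.facetMeasure_eq_map hd hz hp, Filter.EventuallyEq,
    hE.isClosedEmbedding.measurableEmbedding.ae_map_iff] at h
  -- The relative interior of the facet is open in the parameter space, where equality almost
  -- everywhere of continuous functions upgrades to equality.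
  have hrel : ∀ y ∈ hull (K.erase z), (∀ w ∈ K.erase z, 0 < bary K w y) → f y = 0 := by
    intro y hy hpos
    let U := {v | ∀ w ∈ K.erase z, 0 < bary K w (facetParam (K.erase z) p v)}
    have hU : IsOpen U := by
      have : U = ⋂ w ∈ K.erase z, {v | 0 < bary K w (facetParam (K.erase z) p v)} := by
        ext v; simp [U]
      rw [this]
      exact isOpen_biInter_finset fun w _ =>
        isOpen_lt continuous_const ((continuous_bary K w).comp hE.continuous)
    have hUsub : U ⊆ facetParam (K.erase z) p ⁻¹' hull (K.erase z) := by
      intro v hv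
      refine (hK.mem_hull_face_iff (K.erase_subset z)).2 ⟨fun w hw => (hv w hw).le,
        fun w hw hw' => ?_⟩
      have : w = z := by by_contra e; exact hw' (Finset.mem_erase.2 ⟨e, hw⟩)
      rw [this]; exact hK.bary_facetParam hp v
    have h1 := ae_restrict_of_ae_restrict_of_subset hUsub h
    have h2 : Set.EqOn (f ∘ facetParam (K.erase z) p) 0 U :=
      Measure.eqOn_open_of_ae_eq h1 hU (hf.comp hE.continuous).continuousOn continuousOn_const
    obtain ⟨v, rfl⟩ := hull_subset_range_facetParam hp hy
    exact h2 hpos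
  -- The remaining points are limits along segments towards the barycentre `c`.
  obtain ⟨c, hc, hcw⟩ := hK.exists_mem_hull_face (K.erase_subset z) (w := fun _ => 1 / (d : ℝ))
    (by rw [Finset.sum_const, hcard, nsmul_eq_mul]; field_simp) (fun _ _ => by positivity)
  refine tendsto_nhds_unique (f := fun t : ℝ => f (x + t • (c - x)))
    (l := nhdsWithin (0 : ℝ) (Set.Ioi 0)) ?_ (tendsto_const_nhds.congr' ?_)
  · have : Continuous fun t : ℝ => f (x + t • (c - x)) := by fun_prop
    simpa using this.continuousWithinAt.tendsto (x := 0) (s := Set.Ioi 0)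
  · filter_upwards [Ioo_mem_nhdsGT (zero_lt_one (α := ℝ))] with t ht
    refine (hrel _ ((convex_convexHull ℝ _).add_smul_sub_mem hx hc ⟨ht.1.le, ht.2.le⟩)
      fun w hw => ?_).symm
    have h1 : bary K w (x + t • (c - x)) = (1 - t) * bary K w x + t * bary K w c := by
      have := (bary K w).apply_lineMap x c t
      rw [AffineMap.lineMap_apply, AffineMap.lineMap_apply] at this
      simp only [vsub_eq_sub, vadd_eq_add, smul_eq_mul] at this
      rw [add_comm, this]; ring
    have h2 := ((hK.mem_hull_face_iff (K.erase_subset z)).1 hx).1 w hw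
    rw [h1, hcw w hw]
    have := ht.1
    have h4 : 0 < 1 - t := by linarith [ht.2]
    have h5 : (0 : ℝ) < d := by positivity
    positivity

theorem memLp_of_continuous_hull {f : Space d → ℝ} (hf : Continuous f) (s : Finset (Space d))
    (μ : Measure (Space d)) [IsFiniteMeasure (μ.restrict (hull s))] :
    MemLp f 2 (μ.restrict (hull s)) := by
  obtain ⟨C, hC⟩ := (isCompact_hull s).exists_bound_of_continuousOn hf.continuousOn
  exact MemLp.of_bound hf.aestronglyMeasurable C
    (ae_restrict_of_forall_mem (isCompact_hull s).measurableSet hC)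

instance (s : Finset (Space d)) : IsFiniteMeasure (volume.restrict (hull s)) :=
  isFiniteMeasure_restrict.2 (isCompact_hull s).measure_lt_top.ne

/-! ### Existence of admissible weights -/

/-- Moments with respect to the local shape functions can be prescribed on a simplex. -/
theorem IsCell.exists_cell_weight (hd : 2 ≤ d) (hK : IsCell K) {A : Numbering d}
    (hA : ∀ t ⊆ K, t.Nonempty → Set.BijOn (A t) Set.univ (t : Set (Space d))) {k : ℕ}
    (hk : Odd k) (a : Idx d → ℝ) (b : Space d → ℝ) :
    ∃ g : Space d → ℝ, MemLp g 2 (volume.restrict (hull K)) ∧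
      (∀ I ∈ localIdx k K, ∫ x in hull K, g x * facePiece A I K x = a I) ∧
      ∀ z ∈ K, ∫ x in hull K, g x * facetPiece k (K.erase z) K x = b z := by
  obtain ⟨g, hg, h⟩ := exists_weight (μ := volume.restrict (hull K))
    ((localIdx k K).disjSum K)
    (f := Sum.elim (fun I => facePiece A I K) (fun z => facetPiece k (K.erase z) K))
    (by
      rintro (I | z) _
      · exact memLp_of_continuous_hull (continuous_facePiece A I K) K volume
      · exact memLp_of_continuous_hull (continuous_facetPiece k _ K) K volume)
    (Sum.elim a b) (by
      intro c hc
      simp only [Finset.sum_disjSum, Sum.elim_inl, Sum.elim_inr] at hc ⊢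
      obtain ⟨h1, h2⟩ := hK.shape_linearIndependent hd hA hk (fun I => c (Sum.inl I))
        (fun z => c (Sum.inr z)) fun x hx => hK.eq_zero_of_ae (by
          refine (continuous_finsetSum _ fun I _ => continuous_const.mul
            (continuous_facePiece A I K)).add (continuous_finsetSum _ fun z _ =>
            continuous_const.mul (continuous_facetPiece k _ K))) hc hx
      rw [Finset.sum_eq_zero fun I hI => by rw [h1 I hI, zero_mul],
        Finset.sum_eq_zero fun z hz => by rw [h2 z hz, zero_mul], add_zero])
  exact ⟨g, hg, fun I hI => h (Sum.inl I) (Finset.inl_mem_disjSum.2 hI),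
    fun z hz => h (Sum.inr z) (Finset.inr_mem_disjSum.2 hz)⟩

/-- On a facet, the functions of the other facets of the simplex sum up to zero. -/
theorem IsCell.sum_facetPiece_erase (hd : 2 ≤ d) (hK : IsCell K) (hz : z ∈ K) (k : ℕ)
    {x : Space d} (hx : x ∈ hull (K.erase z)) :
    ∑ y ∈ K.erase z, facetPiece k (K.erase y) K x = 0 := by
  have hd0 : (d : ℝ) ≠ 0 := by positivity
  rw [Finset.sum_congr rfl fun y hy => facetPiece_erase (Finset.mem_of_mem_erase hy) k x,
    Finset.sum_sub_distrib, Finset.sum_const, Finset.card_erase_of_mem hz, hK.card_eq]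
  unfold simplexShape
  rw [← Finset.add_sum_erase K _ hz, hK.bary_erase hz hx]
  simp only [mul_zero, sub_zero, jacobi_one, Nat.add_sub_cancel, nsmul_eq_mul]
  field_simp
  ring

/-- The linear relations between the traces of the local shape functions on a facet. -/
theorem IsCell.shape_relation_facet (hd : 2 ≤ d) (hK : IsCell K) (hz : z ∈ K) {A : Numbering d}
    (hA : ∀ t ⊆ K, t.Nonempty → Set.BijOn (A t) Set.univ (t : Set (Space d))) {k : ℕ}
    (hk : Odd k) (c : Idx d → ℝ) (e : Space d → ℝ)
    (h : ∀ x ∈ hull (K.erase z), ∑ I ∈ localIdx k (K.erase z), c I * facePiece A I K x +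
      ∑ y ∈ K, e y * facetPiece k (K.erase y) K x = 0) :
    (∀ I ∈ localIdx k (K.erase z), c I = 0) ∧ e z = 0 ∧ ∃ C, ∀ y ∈ K.erase z, e y = C := by
  have hd0 : (d : ℝ) ≠ 0 := by positivity
  -- The values at the `d` vertices of the facet force the coefficients of the other facets to be
  -- equal.
  have h1 : ∀ y ∈ K.erase z, e y = (∑ w ∈ K, e w) / d := by
    intro y hy
    have hyK := Finset.mem_of_mem_erase hy
    have h2 := h y (subset_convexHull ℝ _ hy)
    rw [Finset.sum_eq_zero fun I hI => by
      rw [hK.facePiece_vertex A (mem_localIdx.1 hI).2.1.1 hyK, mul_zero], zero_add,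
      Finset.sum_congr rfl fun w hw => by rw [hK.facetPiece_vertex hd hk hw hyK]] at h2
    have h3 : ∑ w ∈ K, e w * (vertexScale d k / d * (1 - if y = w then (d : ℝ) else 0)) =
        vertexScale d k / d * (∑ w ∈ K, e w - d * e y) := by
      have h4 : (d : ℝ) * e y = ∑ w ∈ K, if y = w then (d : ℝ) * e w else 0 := by
        rw [Finset.sum_ite_eq, if_pos hyK]
      rw [h4, ← Finset.sum_sub_distrib, Finset.mul_sum]
      refine Finset.sum_congr rfl fun w _ => ?_
      split_ifs <;> ring
    rw [h3] at h2
    have := (mul_eq_zero.1 h2).resolve_left (div_ne_zero (vertexScale_pos d k).ne' hd0)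
    field_simp
    linarith
  -- Adding these `d` equations shows that the coefficients other than `e z` already sum to the full
  -- total.
  have hez : e z = 0 := by
    have h2 := Finset.sum_congr rfl h1
    rw [Finset.sum_const, Finset.card_erase_of_mem hz, hK.card_eq, nsmul_eq_mul,
      Nat.add_sub_cancel, mul_div_cancel₀ _ hd0, ← Finset.add_sum_erase K e hz] at h2
    linarith
  refine ⟨hK.facePiece_linearIndependent (K.erase_subset z) hA k c fun x hx => ?_, hez, _, h1⟩
  have h2 := h x hx
  rw [← Finset.add_sum_erase K _ hz, hez, zero_mul, zero_add,
    Finset.sum_congr (s₁ := K.erase z) rfl fun y hy => by rw [h1 y hy], ← Finset.mul_sum,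
    hK.sum_facetPiece_erase hd hz k hx, mul_zero, add_zero] at h2
  exact h2

/-- Moments with respect to the traces of the local shape functions can be prescribed on a facet,
subject to one compatibility condition. -/
theorem IsCell.exists_facet_weight (hd : 2 ≤ d) (hK : IsCell K) (hz : z ∈ K) {A : Numbering d}
    (hA : ∀ t ⊆ K, t.Nonempty → Set.BijOn (A t) Set.univ (t : Set (Space d))) {k : ℕ}
    (hk : Odd k) (a : Idx d → ℝ) (b : Space d → ℝ) (hb : ∑ y ∈ K.erase z, b y = 0) :
    ∃ g : Space d → ℝ, MemLp g 2 (facetMeasure (K.erase z)) ∧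
      (∀ I ∈ localIdx k (K.erase z),
        ∫ x, g x * facePiece A I K x ∂(facetMeasure (K.erase z)) = a I) ∧
      ∀ y ∈ K, ∫ x, g x * facetPiece k (K.erase y) K x ∂(facetMeasure (K.erase z)) = b y := by
  have hfin := hK.isFiniteMeasure_facetMeasure hd hz
  obtain ⟨g, hg, h⟩ := exists_weight (μ := facetMeasure (K.erase z))
    ((localIdx k (K.erase z)).disjSum K)
    (f := Sum.elim (fun I => facePiece A I K) (fun y => facetPiece k (K.erase y) K))
    (by
      unfold facetMeasure at hfin ⊢
      rintro (I | y) _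
      · exact memLp_of_continuous_hull (continuous_facePiece A I K) _ _
      · exact memLp_of_continuous_hull (continuous_facetPiece k _ K) _ _)
    (Sum.elim a b) (by
      intro c hc
      simp only [Finset.sum_disjSum, Sum.elim_inl, Sum.elim_inr] at hc ⊢
      -- Any relation has constant coefficients on the other facets and zero coefficients elsewhere,
      -- so the hypothesis `hb` is exactly the compatibility of the moments.
      obtain ⟨h1, h2, C, h3⟩ := hK.shape_relation_facet hd hz hA hk (fun I => c (Sum.inl I))
        (fun z => c (Sum.inr z)) fun x hx => hK.eq_zero_of_ae_facet hd hz (by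
          refine (continuous_finsetSum _ fun I _ => continuous_const.mul
            (continuous_facePiece A I K)).add (continuous_finsetSum _ fun z _ =>
            continuous_const.mul (continuous_facetPiece k _ K))) hc hx
      rw [Finset.sum_eq_zero fun I hI => by rw [h1 I hI, zero_mul],
        ← Finset.add_sum_erase K _ hz, h2,
        Finset.sum_congr rfl fun y hy => by rw [h3 y hy], ← Finset.mul_sum, hb]
      ring)
  exact ⟨g, hg, fun I hI => h (Sum.inl I) (Finset.inl_mem_disjSum.2 hI),
    fun z hz => h (Sum.inr z) (Finset.inr_mem_disjSum.2 hz)⟩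

namespace Mesh

variable {Ω : Set (Space d)} (T : Mesh Ω)

theorem IsNumbering.bijOn {T : Mesh Ω} {A : Numbering d} (hA : T.IsNumbering A)
    (hK : K ∈ T.cells) : ∀ t ⊆ K, t.Nonempty → Set.BijOn (A t) Set.univ (t : Set (Space d)) :=
  fun t ht hne => hA t (T.mem_faces_of_subset (T.cell_mem_faces hK) ht hne)

theorem erase_injOn {y : Space d} (hz : z ∈ K) (h : K.erase z = K.erase y) : z = y := by
  by_contra hne
  have : z ∈ K.erase y := Finset.mem_erase.2 ⟨hne, hz⟩
  rw [← h] at this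
  simp at this

/-- On simplices arbitrary moments are allowed. On a boundary facet `F` the moments of the facets
other than `F` must sum to zero. Face weights and the weight of `F` itself take zero there; the
weight of another boundary facet is balanced at an inner facet, where it is unconstrained. -/
theorem exists_isBidual (hd : 2 ≤ d) {k : ℕ} (hk : Odd k) (hΩ : IsOpen Ω)
    (hconn : IsConnected Ω) (hreg : interior (closure Ω) = Ω) (hT : 1 < T.cells.card)
    {A : Numbering d} (hA : T.IsNumbering A) : ∃ W : Weights d, T.IsBidual k A W := by
  have e1 : ∀ (K : Finset (Space d)) (I : Idx d), ∃ g : Space d → ℝ, K ∈ T.cells →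
      MemLp g 2 (volume.restrict (hull K)) ∧
      (∀ J ∈ localIdx k K, ∫ x in hull K, g x * facePiece A J K x = if I = J then 1 else 0) ∧
      ∀ z ∈ K, ∫ x in hull K, g x * facetPiece k (K.erase z) K x = 0 := by
    intro K I
    by_cases hK : K ∈ T.cells
    · obtain ⟨g, hg⟩ := (T.isCell hK).exists_cell_weight hd (hA.bijOn hK) hk
        (fun J => if I = J then 1 else 0) (fun _ => 0)
      exact ⟨g, fun _ => hg⟩
    · exact ⟨0, fun h => absurd h hK⟩
  have e2 : ∀ K F : Finset (Space d), ∃ g : Space d → ℝ, K ∈ T.cells →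
      MemLp g 2 (volume.restrict (hull K)) ∧
      (∀ J ∈ localIdx k K, ∫ x in hull K, g x * facePiece A J K x = 0) ∧
      ∀ z ∈ K, ∫ x in hull K, g x * facetPiece k (K.erase z) K x =
        if F = K.erase z then 1 else 0 := by
    intro K F
    by_cases hK : K ∈ T.cells
    · obtain ⟨g, hg⟩ := (T.isCell hK).exists_cell_weight hd (hA.bijOn hK) hk
        (fun _ => 0) (fun z => if F = K.erase z then 1 else 0)
      exact ⟨g, fun _ => hg⟩
    · exact ⟨0, fun h => absurd h hK⟩
  have e3 : ∀ (F : Finset (Space d)) (I : Idx d), ∃ g : Space d → ℝ, F ∈ T.bdryFacets →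
      ∀ K ∈ T.cells, F ⊆ K → MemLp g 2 (facetMeasure F) ∧
      (∀ J ∈ localIdx k F, ∫ x, g x * facePiece A J K x ∂(facetMeasure F) =
        if I = J then 1 else 0) ∧
      ∀ y ∈ K, ∫ x, g x * facetPiece k (K.erase y) K x ∂(facetMeasure F) = 0 := by
    intro F I
    by_cases hF : F ∈ T.bdryFacets
    · have hF' := (T.mem_bdryFacets.1 hF).1
      obtain ⟨K, hK, hFK⟩ := T.exists_cell (T.mem_facets.1 hF').1
      obtain ⟨z, hz, rfl⟩ := T.facet_eq_erase hK hF' hFK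
      obtain ⟨g, hg⟩ := (T.isCell hK).exists_facet_weight hd hz (hA.bijOn hK) hk
        (fun J => if I = J then 1 else 0) (fun _ => 0) (by simp)
      refine ⟨g, fun _ L hL hFL => ?_⟩
      obtain rfl := T.cell_unique hd hΩ hreg hF hK hL hFK hFL
      exact hg
    · exact ⟨0, fun h => absurd h hF⟩
  have e4 : ∀ F F' : Finset (Space d), ∃ g : Space d → ℝ, F ∈ T.bdryFacets →
      ∀ K ∈ T.cells, F ⊆ K → F' ∈ T.bdryFacets → F' ⊆ K → MemLp g 2 (facetMeasure F) ∧
      (∀ J ∈ localIdx k F, ∫ x, g x * facePiece A J K x ∂(facetMeasure F) = 0) ∧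
      (∀ y ∈ K, K.erase y ∈ T.bdryFacets →
        ∫ x, g x * facetPiece k (K.erase y) K x ∂(facetMeasure F) =
          if F' = K.erase y then 1 else 0) ∧
      (F' = F → ∀ y ∈ K, K.erase y ∈ T.innerFacets →
        ∫ x, g x * facetPiece k (K.erase y) K x ∂(facetMeasure F) = 0) := by
    intro F F'
    by_cases hF : F ∈ T.bdryFacets
    swap
    · exact ⟨0, fun h => absurd h hF⟩
    have hF0 := (T.mem_bdryFacets.1 hF).1
    obtain ⟨K, hK, hFK⟩ := T.exists_cell (T.mem_facets.1 hF0).1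
    by_cases hF' : F' ∈ T.bdryFacets ∧ F' ⊆ K
    swap
    · refine ⟨0, fun _ L hL hFL h1 h2 => ?_⟩
      obtain rfl := T.cell_unique hd hΩ hreg hF hK hL hFK hFL
      exact absurd ⟨h1, h2⟩ hF'
    obtain ⟨z, hz, rfl⟩ := T.facet_eq_erase hK hF0 hFK
    obtain ⟨z', hz', rfl⟩ := T.facet_eq_erase hK (T.mem_bdryFacets.1 hF'.1).1 hF'.2
    obtain ⟨w, hw, hwin⟩ := T.exists_inner_facet hd hconn hreg hΩ hT hK
    have hwb : K.erase w ∉ T.bdryFacets := (Finset.mem_sdiff.1 hwin).2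
    have hwz : w ≠ z := fun e => hwb (e ▸ hF)
    have hwz' : w ≠ z' := fun e => hwb (e ▸ hF'.1)
    -- The prescribed moment is `1` at `F'` and, only when `F'` differs from `F`, it is `-1` at the
    -- inner facet opposite to `w`.
    have hsum : ∑ y ∈ K.erase z, ((if y = z' then (1 : ℝ) else 0) -
        if y = w ∧ z' ≠ z then 1 else 0) = 0 := by
      rw [Finset.sum_sub_distrib, Finset.sum_ite_eq']
      by_cases hzz : z' = z
      · simp [hzz]
      · have h1 : z' ∈ K.erase z := Finset.mem_erase.2 ⟨hzz, hz'⟩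
        have h2 : w ∈ K.erase z := Finset.mem_erase.2 ⟨hwz, hw⟩
        simp only [hzz, ne_eq, not_false_eq_true, and_true]
        rw [Finset.sum_ite_eq', if_pos h1, if_pos h2, sub_self]
    obtain ⟨g, hg1, hg2, hg3⟩ := (T.isCell hK).exists_facet_weight hd hz (hA.bijOn hK) hk
      (fun _ => 0) _ hsum
    refine ⟨g, fun _ L hL hFL _ _ => ?_⟩
    obtain rfl := T.cell_unique hd hΩ hreg hF hK hL hFK hFL
    refine ⟨hg1, hg2, fun y hy hyb => ?_, fun hzz y hy hyi => ?_⟩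
    · rw [hg3 y hy, if_neg (fun h : y = w ∧ z' ≠ z => hwb (h.1 ▸ hyb)), sub_zero]
      congr 1
      exact propext ⟨fun h => by rw [h], fun h => (erase_injOn hz' h).symm⟩
    · have hz' : z' = z := erase_injOn hz' hzz
      have hyz : y ≠ z' := fun e => (Finset.mem_sdiff.1 hyi).2 (e ▸ hF'.1)
      rw [hg3 y hy, if_neg hyz, if_neg (fun h => h.2 hz'), sub_zero]
  choose g1 hg1 using e1
  choose g2 hg2 using e2
  choose g3 hg3 using e3
  choose g4 hg4 using e4
  refine ⟨⟨g1, g2, g3, g4⟩, fun K hK => ?_, fun F hF K hK hFK => ?_⟩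
  · have hid := T.idxIn_eq k (T.cell_mem_faces hK)
    have hfac : ∀ {F}, F ∈ T.facets → F ⊆ K → ∃ z ∈ K, F = K.erase z := T.facet_eq_erase hK
    refine ⟨fun I _ => (hg1 K I hK).1, fun F _ _ => (hg2 K F hK).1,
      fun I _ J hJ => (hg1 K I hK).2.1 J (hid ▸ hJ), fun I _ F hF hFK => ?_,
      fun F _ _ J hJ => (hg2 K F hK).2.1 J (hid ▸ hJ), fun F _ _ F' hF' hFK' => ?_⟩
    · obtain ⟨z, hz, rfl⟩ := hfac hF hFK
      exact (hg1 K I hK).2.2 z hz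
    · obtain ⟨z, hz, rfl⟩ := hfac hF' hFK'
      exact (hg2 K F hK).2.2 z hz
  · have hid := T.idxIn_eq k (T.mem_facets.1 (T.mem_bdryFacets.1 hF).1).1
    have hfac : ∀ {F}, F ∈ T.facets → F ⊆ K → ∃ z ∈ K, F = K.erase z := T.facet_eq_erase hK
    refine ⟨fun I _ => (hg3 F I hF K hK hFK).1, fun F' hF' hFK' => (hg4 F F' hF K hK hFK hF' hFK').1,
      fun I _ J hJ => (hg3 F I hF K hK hFK).2.1 J (hid ▸ hJ), fun I _ F' hF' hFK' => ?_,
      fun F' hF' hFK' J hJ => (hg4 F F' hF K hK hFK hF' hFK').2.1 J (hid ▸ hJ),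
      fun F' hF' hFK' F'' hF'' hFK'' => ?_, fun I _ F' hF' hFK' => ?_, fun F' hF' hFK' => ?_⟩
    · obtain ⟨z, hz, rfl⟩ := hfac (T.mem_bdryFacets.1 hF').1 hFK'
      exact (hg3 F I hF K hK hFK).2.2 z hz
    · obtain ⟨z, hz, rfl⟩ := hfac (T.mem_bdryFacets.1 hF'').1 hFK''
      exact (hg4 F F' hF K hK hFK hF' hFK').2.2.1 z hz hF''
    · obtain ⟨z, hz, rfl⟩ := hfac (Finset.mem_sdiff.1 hF').1 hFK'
      exact (hg3 F I hF K hK hFK).2.2 z hz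
    · obtain ⟨z, hz, rfl⟩ := hfac (Finset.mem_sdiff.1 hF').1 hFK'
      exact (hg4 F F hF K hK hFK hF hFK).2.2.2 rfl z hz hF'

end Mesh

end

section

/-! ### The trace inequality -/

/-- The function `(s - a) * g s ^ 2` vanishes at `a` and equals `-a * g 0 ^ 2` at `0`. Its
derivative is integrated, and the mixed term is split by `-2 g g' ≤ g² + g'²`. -/
theorem sq_le_integral_of_hasDerivAt {g g' : ℝ → ℝ} (hg : ∀ s, HasDerivAt g (g' s) s)
    (hg' : Continuous g') {a : ℝ} (ha : 0 < a) :
    a * g 0 ^ 2 ≤ ∫ s in (0 : ℝ)..a, ((1 + a) * g s ^ 2 + a * g' s ^ 2) := by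
  have hcg : Continuous g := continuous_iff_continuousAt.2 fun s => (hg s).continuousAt
  have hder : ∀ s ∈ Set.uIcc (0 : ℝ) a, HasDerivAt (fun s => (s - a) * g s ^ 2)
      (g s ^ 2 + (s - a) * (2 * g s * g' s)) s := by
    intro s _
    have h1 := ((hasDerivAt_id s).sub_const a).mul ((hg s).pow 2)
    convert! h1 using 1
    simp
  have hint := intervalIntegral.integral_eq_sub_of_hasDerivAt hder
    (Continuous.intervalIntegrable (by fun_prop) _ _)
  have h2 : a * g 0 ^ 2 = ∫ s in (0 : ℝ)..a, (g s ^ 2 + (s - a) * (2 * g s * g' s)) := by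
    rw [hint]; ring
  rw [h2]
  refine intervalIntegral.integral_mono_on ha.le (Continuous.intervalIntegrable (by fun_prop) _ _)
    (Continuous.intervalIntegrable (by fun_prop) _ _) fun s hs => ?_
  have h3 : 0 ≤ a - s := by linarith [hs.2]
  nlinarith [mul_nonneg h3 (sq_nonneg (g s + g' s)), mul_nonneg hs.1 (sq_nonneg (g s)),
    mul_nonneg hs.1 (sq_nonneg (g' s))]

variable {d : ℕ} {K K' F τ : Finset (Space d)} {z : Space d}

theorem fderiv_eq_sum_pd (φ : Space d → ℝ) (x w : Space d) :
    fderiv ℝ φ x w = ∑ i, w i * pd i φ x := by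
  have h2 : w = ∑ i, w i • EuclideanSpace.single i (1 : ℝ) := by
    ext j; simp [Finset.sum_apply, Pi.single_apply]
  conv_lhs => rw [h2, map_sum]
  simp [pd]

theorem sq_le_lintegral_segment {φ : Space d → ℝ} (hφ : ContDiff ℝ ∞ φ) (y w : Space d) {a : ℝ}
    (ha : 0 < a) : ENNReal.ofReal a * ENNReal.ofReal (φ y ^ 2) ≤
      ∫⁻ s in Set.Ioc 0 a, ENNReal.ofReal
        ((1 + a) * φ (y + s • w) ^ 2 + a * fderiv ℝ φ (y + s • w) w ^ 2) := by
  have hc : Continuous fun s : ℝ => y + s • w := by fun_prop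
  have hcf : Continuous fun s : ℝ => fderiv ℝ φ (y + s • w) w :=
    ((hφ.continuous_fderiv (by simp)).comp hc).clm_apply continuous_const
  have hcφ : Continuous fun s : ℝ => φ (y + s • w) := hφ.continuous.comp hc
  have h1 := sq_le_integral_of_hasDerivAt (g := fun s => φ (y + s • w))
    (g' := fun s => fderiv ℝ φ (y + s • w) w) (fun s => by
      have h2 : HasDerivAt (fun s : ℝ => y + s • w) w s := by
        simpa using ((hasDerivAt_id s).smul_const w).const_add y
      exact ((hφ.differentiable (by simp)) _).hasFDerivAt.comp_hasDerivAt s h2) hcf ha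
  rw [← ENNReal.ofReal_mul ha.le, ← ofReal_integral_eq_lintegral_ofReal,
    ← intervalIntegral.integral_of_le ha.le]
  · simp only [zero_smul, add_zero] at h1
    exact ENNReal.ofReal_le_ofReal h1
  · refine (intervalIntegrable_iff_integrableOn_Ioc_of_le ha.le).1 ?_
    exact Continuous.intervalIntegrable (by fun_prop) _ _
  · exact Filter.Eventually.of_forall fun s => by positivity

/-- Integration over a part of a facet, and then over segments that start there and stay in a set,
is controlled by the integral over this set. -/
theorem IsCell.exists_lintegral_slab_le (hd : 2 ≤ d) (hK : IsCell K) (hz : z ∈ K) {p : Space d}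
    (hp : p ∈ K.erase z) {w : Space d} (hw : bary K z (p + w) ≠ 0) :
    ∃ C : ℝ≥0∞, C ≠ ⊤ ∧ ∀ (S : Set (vectorSpan ℝ ((K.erase z : Finset (Space d)) : Set (Space d))))
      (R : Set ℝ) (B : Set (Space d)), MeasurableSet B →
      (∀ v ∈ S, ∀ s ∈ R, facetParam (K.erase z) p v + s • w ∈ B) →
      ∀ H : Space d → ℝ≥0∞, Measurable H →
        ∫⁻ v in S, ∫⁻ s in R, H (facetParam (K.erase z) p v + s • w) ≤ C * ∫⁻ x in B, H x := by
  set V := vectorSpan ℝ ((K.erase z : Finset (Space d)) : Set (Space d))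
  -- As `w` is transversal to the facet, `(v, s) ↦ v + s w` is a linear isomorphism onto the whole
  -- space.
  let L : (V × ℝ) →ₗ[ℝ] Space d :=
    V.subtype.coprod (LinearMap.toSpanSingleton ℝ (Space d) w)
  have hL : ∀ q, L q = q.1 + q.2 • w := fun q => by simp [L]
  have hbase : bary K z p = 0 := by
    have h := Finset.mem_erase.1 hp
    rw [hK.bary_vertex z h.2, if_neg h.1]
  have hlin : ∀ v : V, (bary K z).linear v = 0 := by
    intro v
    have h1 := hK.bary_facetParam hp v
    have h2 := (bary K z).map_vadd p (v : Space d)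
    simp only [vadd_eq_add, hbase, add_zero] at h2
    rw [← h2]; exact h1
  have hlinw : (bary K z).linear w ≠ 0 := by
    have h2 := (bary K z).map_vadd p w
    simp only [vadd_eq_add, hbase, add_zero] at h2
    rw [← h2, add_comm]; exact hw
  have hinj : Function.Injective L := by
    rw [← LinearMap.ker_eq_bot, LinearMap.ker_eq_bot']
    rintro ⟨v, s⟩ h
    rw [hL] at h
    have h3 := congrArg (bary K z).linear h
    simp only [map_add, hlin, map_smul, map_zero, zero_add, smul_eq_mul] at h3
    have hs : s = 0 := (mul_eq_zero.1 h3).resolve_right hlinw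
    subst hs
    simp only [zero_smul, add_zero] at h
    rw [Submodule.coe_eq_zero.1 h]; rfl
  have hfin : Module.finrank ℝ (V × ℝ) = Module.finrank ℝ (Space d) := by
    rw [Module.finrank_prod, hK.finrank_vectorSpan_erase hd hz]
    simp; omega
  let e : (V × ℝ) ≃L[ℝ] Space d :=
    (LinearEquiv.ofInjectiveOfFinrankEq L hinj hfin).toContinuousLinearEquiv
  have he : ∀ q, e q = q.1 + q.2 • w := fun q => by rw [← hL]; rfl
  let μ : Measure (Space d) := (volume.prod volume).map e
  have hμ : μ.IsAddHaarMeasure := e.isAddHaarMeasure_map _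
  -- The image of the product measure is a Haar measure, so the Jacobian is a constant, and it
  -- serves as the bound.
  obtain ⟨c, hc⟩ : ∃ c : NNReal, μ = c • volume := ⟨_, Measure.isAddLeftInvariant_eq_smul μ volume⟩
  refine ⟨c, ENNReal.coe_ne_top,
    fun S R B hB hmem H hH => ?_⟩
  have hE := isometry_facetParam (K.erase z) p
  have hΨ : ∀ q : V × ℝ, facetParam (K.erase z) p q.1 + q.2 • w = e q + p := fun q => by
    rw [he, facetParam]; abel
  have hmeas : Measurable fun q : V × ℝ => H (facetParam (K.erase z) p q.1 + q.2 • w) := by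
    simp only [hΨ]
    exact hH.comp ((e.continuous.add continuous_const).measurable)
  calc ∫⁻ v in S, ∫⁻ s in R, H (facetParam (K.erase z) p v + s • w)
      = ∫⁻ q in S ×ˢ R, H (facetParam (K.erase z) p q.1 + q.2 • w) ∂(volume.prod volume) := by
        rw [← Measure.prod_restrict, lintegral_prod _ hmeas.aemeasurable]
    _ ≤ ∫⁻ q in (fun q => e q + p) ⁻¹' B, H (e q + p) ∂(volume.prod volume) := by
        simp only [hΨ]
        refine lintegral_mono_set fun q hq => ?_
        have := hmem q.1 hq.1 q.2 hq.2
        rw [hΨ] at this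
        exact this
    _ = ∫⁻ x in (fun x => x + p) ⁻¹' B, H (x + p) ∂μ := by
        exact (setLIntegral_map (f := fun x => H (x + p)) (measurable_add_const p hB)
          (hH.comp (measurable_add_const p)) e.continuous.measurable).symm
    _ = c * ∫⁻ x in (fun x => x + p) ⁻¹' B, H (x + p) := by
        rw [hc, Measure.restrict_smul, lintegral_smul_measure]; rfl
    _ = c * ∫⁻ x in B, H x := by
        congr 1
        exact (measurePreserving_add_right volume p).setLIntegral_comp_preimage hB hH

theorem sq_eLpNorm_two {X : Type*} [MeasurableSpace X] (μ : Measure X) (f : X → ℝ) :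
    eLpNorm f 2 μ ^ 2 = ∫⁻ x, ENNReal.ofReal (f x ^ 2) ∂μ := by
  rw [eLpNorm_eq_lintegral_rpow_enorm_toReal (by norm_num) (by norm_num), ← ENNReal.rpow_natCast,
    ← ENNReal.rpow_mul]
  norm_num
  refine lintegral_congr fun x => ?_
  rw [Real.enorm_eq_ofReal_abs, ← ENNReal.ofReal_pow (abs_nonneg _), sq_abs]

theorem sum_sq_le_sq_sum {ι : Type*} (s : Finset ι) (f : ι → ℝ≥0∞) :
    ∑ i ∈ s, f i ^ 2 ≤ (∑ i ∈ s, f i) ^ 2 := by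
  rw [sq (∑ i ∈ s, f i), Finset.sum_mul]
  refine Finset.sum_le_sum fun i hi => ?_
  rw [sq]
  gcongr
  exact Finset.single_le_sum (f := f) (fun _ _ => zero_le) hi

theorem sq_fderiv_le (φ : Space d → ℝ) (x w : Space d) :
    fderiv ℝ φ x w ^ 2 ≤ ‖w‖ ^ 2 * ∑ i, pd i φ x ^ 2 := by
  rw [fderiv_eq_sum_pd, EuclideanSpace.norm_sq_eq]
  simpa using Finset.sum_mul_sq_le_sq_mul_sq Finset.univ (fun i => w i) fun i => pd i φ x

/-- The trace inequality on a simplex. -/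
theorem IsCell.exists_trace_bound (hd : 2 ≤ d) (hK : IsCell K) (hz : z ∈ K) :
    ∃ C : ℝ≥0∞, C ≠ ⊤ ∧ ∀ φ : Space d → ℝ, ContDiff ℝ ∞ φ →
      eLpNorm φ 2 (facetMeasure (K.erase z)) ≤ C * (eLpNorm φ 2 (volume.restrict (hull K)) +
        ∑ i, eLpNorm (pd i φ) 2 (volume.restrict (hull K))) := by
  have hcard : (K.erase z).card = d := by
    rw [Finset.card_erase_of_mem hz, hK.card_eq]; omega
  obtain ⟨p, hp⟩ : (K.erase z).Nonempty := Finset.card_pos.1 (by omega)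
  have hd0 : (0 : ℝ) < d := by positivity
  -- At each point of the facet some coordinate `λ_u` is at least `1 / d`, because the `d`
  -- coordinates sum to one. Moving by at most `a` in direction `z - u` lowers `λ_u` and raises
  -- `λ_z`, and so stays in `K`.
  set a : ℝ := 1 / d
  have ha : 0 < a := by positivity
  have ha1 : a ≤ 1 := by
    rw [div_le_one hd0]
    have : (2 : ℝ) ≤ d := by exact_mod_cast hd
    linarith
  have hpz : bary K z p = 0 := by
    have h := Finset.mem_erase.1 hp
    rw [hK.bary_vertex z h.2, if_neg h.1]
  have hdir : ∀ u ∈ K.erase z, ∀ (y : K) (x : Space d) (s : ℝ), bary K y (x + s • (z - u)) =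
      bary K y x + s * ((if z = (y : Space d) then 1 else 0) - if u = (y : Space d) then 1 else 0) := by
    intro u hu y x s
    have h1 := (bary K y).map_vadd x (s • (z - u))
    have h2 := (bary K y).linearMap_vsub z u
    rw [hK.bary_vertex y hz, hK.bary_vertex y (Finset.mem_of_mem_erase hu)] at h2
    simp only [vadd_eq_add, vsub_eq_sub, map_smul, smul_eq_mul] at h1 h2
    rw [add_comm x, h1, h2]; ring
  -- One slab per vertex `u`: the part of the facet where `λ_u ≥ a`, swept in direction `z - u`.
  have hslab : ∀ u : Space d, ∃ C : ℝ≥0∞, C ≠ ⊤ ∧ (u ∈ K.erase z → ∀ H : Space d → ℝ≥0∞,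
      Measurable H →
      ∫⁻ v in {v | facetParam (K.erase z) p v ∈ hull (K.erase z) ∧
          a ≤ bary K u (facetParam (K.erase z) p v)}, ∫⁻ s in Set.Ioc 0 a,
        H (facetParam (K.erase z) p v + s • (z - u)) ≤ C * ∫⁻ x in hull K, H x) := by
    intro u
    by_cases hu : u ∈ K.erase z
    swap
    · exact ⟨0, by simp, fun h => absurd h hu⟩
    have huz : u ≠ z := (Finset.mem_erase.1 hu).1
    obtain ⟨C, hC, h⟩ := hK.exists_lintegral_slab_le hd hz hp (w := z - u) (by
      have := hdir u hu ⟨z, hz⟩ p 1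
      simp only [one_smul, if_true, if_neg huz, hpz] at this
      rw [this]; norm_num)
    refine ⟨C, hC, fun _ H hH => h _ _ _ (isCompact_hull K).measurableSet ?_ H hH⟩
    rintro v ⟨hv, hva⟩ s hs
    refine hK.mem_hull_iff.2 fun y hy => ?_
    rw [hdir u hu ⟨y, hy⟩]
    have h1 := hK.mem_hull_iff.1 (hull_mono (K.erase_subset z) hv) y hy
    have hs1 := hs.1
    have hs2 := hs.2
    dsimp only
    by_cases h2 : u = y
    · subst h2
      rw [if_neg huz.symm, if_pos rfl]; linarith
    · rw [if_neg h2]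
      split_ifs <;> nlinarith
  choose C hC hCb using hslab
  -- Since `a ≤ 1`, this dominates both `1 + a` and `a * ‖z - u‖ ^ 2`, the factors of the function
  -- and of its gradient.
  set M : Space d → ℝ≥0∞ := fun u => ENNReal.ofReal (2 + ‖z - u‖ ^ 2)
  set D : ℝ≥0∞ := ∑ u ∈ K.erase z, C u * M u
  have hD : D ≠ ⊤ := ENNReal.sum_ne_top.2 fun u _ => ENNReal.mul_ne_top (hC u) ENNReal.ofReal_ne_top
  have ha' : ENNReal.ofReal a ≠ 0 := by simpa using ha
  refine ⟨(ENNReal.ofReal a)⁻¹ * D + 1,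
    ENNReal.add_ne_top.2 ⟨ENNReal.mul_ne_top (ENNReal.inv_ne_top.2 ha') hD, by simp⟩, fun φ hφ => ?_⟩
  have hpd : ∀ i, Continuous (pd i φ) := fun i => continuous_pd i hφ
  set N : ℝ≥0∞ := eLpNorm φ 2 (volume.restrict (hull K)) ^ 2 +
    ∑ i, eLpNorm (pd i φ) 2 (volume.restrict (hull K)) ^ 2
  have hcf : ∀ w : Space d, Continuous fun x => fderiv ℝ φ x w := fun w =>
    (hφ.continuous_fderiv (by simp)).clm_apply continuous_const
  have hpiece : ∀ u ∈ K.erase z, ENNReal.ofReal a * ∫⁻ v in {v |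
      facetParam (K.erase z) p v ∈ hull (K.erase z) ∧ a ≤ bary K u (facetParam (K.erase z) p v)},
      ENNReal.ofReal (φ (facetParam (K.erase z) p v) ^ 2) ≤ C u * M u * N := by
    intro u hu
    set H : Space d → ℝ≥0∞ := fun x =>
      ENNReal.ofReal ((1 + a) * φ x ^ 2 + a * fderiv ℝ φ x (z - u) ^ 2)
    have hHm : Measurable H := by
      have := hφ.continuous
      have := hcf (z - u)
      exact ENNReal.measurable_ofReal.comp (by fun_prop : Continuous _).measurable
    calc _ = ∫⁻ v in {v | facetParam (K.erase z) p v ∈ hull (K.erase z) ∧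
          a ≤ bary K u (facetParam (K.erase z) p v)},
          ENNReal.ofReal a * ENNReal.ofReal (φ (facetParam (K.erase z) p v) ^ 2) := by
          rw [lintegral_const_mul' _ _ ENNReal.ofReal_ne_top]
      _ ≤ ∫⁻ v in {v | facetParam (K.erase z) p v ∈ hull (K.erase z) ∧
          a ≤ bary K u (facetParam (K.erase z) p v)}, ∫⁻ s in Set.Ioc 0 a,
          H (facetParam (K.erase z) p v + s • (z - u)) :=
          lintegral_mono fun v => sq_le_lintegral_segment hφ _ _ ha
      _ ≤ C u * ∫⁻ x in hull K, H x := hCb u hu H hHm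
      _ ≤ C u * (M u * N) := by
          gcongr
          have hHle : ∀ x, H x ≤ M u * (ENNReal.ofReal (φ x ^ 2) +
              ∑ i, ENNReal.ofReal (pd i φ x ^ 2)) := by
            intro x
            rw [← ENNReal.ofReal_sum_of_nonneg fun i _ => sq_nonneg _,
              ← ENNReal.ofReal_add (sq_nonneg _) (Finset.sum_nonneg fun i _ => sq_nonneg _),
              ← ENNReal.ofReal_mul (by positivity)]
            refine ENNReal.ofReal_le_ofReal ?_
            have h1 := sq_fderiv_le φ x (z - u)
            have h2 : 0 ≤ ∑ i, pd i φ x ^ 2 := Finset.sum_nonneg fun i _ => sq_nonneg _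
            have h3 := sq_nonneg (φ x)
            have h4 := sq_nonneg ‖z - u‖
            have h5 : a * fderiv ℝ φ x (z - u) ^ 2 ≤ 1 * (‖z - u‖ ^ 2 * ∑ i, pd i φ x ^ 2) :=
              mul_le_mul ha1 h1 (sq_nonneg _) zero_le_one
            nlinarith [mul_nonneg h4 h3]
          calc ∫⁻ x in hull K, H x ≤ ∫⁻ x in hull K, M u * (ENNReal.ofReal (φ x ^ 2) +
                ∑ i, ENNReal.ofReal (pd i φ x ^ 2)) := lintegral_mono hHle
            _ = M u * N := by
                have hm : Measurable fun x => ENNReal.ofReal (φ x ^ 2) :=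
                  ENNReal.measurable_ofReal.comp (hφ.continuous.pow 2).measurable
                have hm' : ∀ i, Measurable fun x => ENNReal.ofReal (pd i φ x ^ 2) := fun i =>
                  ENNReal.measurable_ofReal.comp ((hpd i).pow 2).measurable
                rw [lintegral_const_mul' _ _ ENNReal.ofReal_ne_top, lintegral_add_left hm,
                  lintegral_finsetSum _ fun i _ => hm' i]
                simp only [N, M, sq_eLpNorm_two]
      _ = C u * M u * N := by ring
  have hE := isometry_facetParam (K.erase z) p
  have hsq : eLpNorm φ 2 (facetMeasure (K.erase z)) ^ 2 ≤ (ENNReal.ofReal a)⁻¹ * (D * N) := by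
    rw [sq_eLpNorm_two, hK.facetMeasure_eq_map hd hz hp,
      hE.isClosedEmbedding.measurableEmbedding.lintegral_map]
    have hcover : facetParam (K.erase z) p ⁻¹' hull (K.erase z) ⊆ ⋃ u : ↥(K.erase z), {v |
        facetParam (K.erase z) p v ∈ hull (K.erase z) ∧
        a ≤ bary K u (facetParam (K.erase z) p v)} := by
      intro v hv
      have hsum := hK.sum_bary_face (K.erase_subset z) hv
      obtain ⟨u, hu, hua⟩ := Finset.exists_le_of_sum_le (s := K.erase z) (f := fun _ => a)
        (g := fun u => bary K u (facetParam (K.erase z) p v)) ⟨p, hp⟩ (by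
          rw [hsum, Finset.sum_const, hcard, nsmul_eq_mul]
          simp only [a]; field_simp; rfl)
      exact Set.mem_iUnion.2 ⟨⟨u, hu⟩, hv, hua⟩
    rw [← ENNReal.mul_le_iff_le_inv ha' ENNReal.ofReal_ne_top]
    calc _ ≤ ENNReal.ofReal a * ∑ u : ↥(K.erase z), ∫⁻ v in {v |
          facetParam (K.erase z) p v ∈ hull (K.erase z) ∧
          a ≤ bary K u (facetParam (K.erase z) p v)},
          ENNReal.ofReal (φ (facetParam (K.erase z) p v) ^ 2) := by
          gcongr
          refine (lintegral_mono_set hcover).trans ((lintegral_iUnion_le _ _).trans ?_)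
          rw [tsum_fintype]
      _ ≤ ∑ u : ↥(K.erase z), C u * M u * N := by
          rw [Finset.mul_sum]
          exact Finset.sum_le_sum fun u _ => hpiece u u.2
      _ = D * N := by
          rw [← Finset.sum_mul, Finset.sum_coe_sort (K.erase z) fun u => C u * M u]
  set S := eLpNorm φ 2 (volume.restrict (hull K)) +
    ∑ i, eLpNorm (pd i φ) 2 (volume.restrict (hull K))
  have hNS : N ≤ S ^ 2 := by
    simp only [N, S, add_sq]
    have := sum_sq_le_sq_sum Finset.univ fun i => eLpNorm (pd i φ) 2 (volume.restrict (hull K))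
    calc _ ≤ eLpNorm φ 2 (volume.restrict (hull K)) ^ 2 +
          (∑ i, eLpNorm (pd i φ) 2 (volume.restrict (hull K))) ^ 2 := by gcongr
      _ ≤ _ := by gcongr; exact le_self_add
  rw [← ENNReal.pow_le_pow_left_iff two_ne_zero, mul_pow]
  refine hsq.trans ?_
  rw [← mul_assoc]
  -- The estimate for squares has the constant `X`; bounding it by `(X + 1) ^ 2` avoids a square
  -- root in the final constant.
  set X := (ENNReal.ofReal a)⁻¹ * D
  calc X * N ≤ (X + 1) ^ 2 * N := by
        gcongr
        calc X ≤ X + 1 := le_self_add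
          _ ≤ (X + 1) ^ 2 := le_self_pow (by simp) two_ne_zero
    _ ≤ _ := by gcongr

end

section

/-! ### Traces -/

open Filter Topology

variable {d : ℕ} {K K' F τ : Finset (Space d)} {z : Space d}

theorem tendsto_integral_mul_zero {X : Type*} [MeasurableSpace X] {μ : Measure X} {ψ : X → ℝ}
    (hψ : MemLp ψ 2 μ) {f : ℕ → X → ℝ} (hf : ∀ n, AEStronglyMeasurable (f n) μ)
    (h : Tendsto (fun n => eLpNorm (f n) 2 μ) atTop (𝓝 0)) :
    Tendsto (fun n => ∫ x, ψ x * f n x ∂μ) atTop (𝓝 0) := by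
  rw [tendsto_iff_enorm_sub_tendsto_zero]
  simp only [sub_zero]
  have hlim : Tendsto (fun n => eLpNorm ψ 2 μ * eLpNorm (f n) 2 μ) atTop (𝓝 0) := by
    have := ENNReal.Tendsto.const_mul h (Or.inr hψ.2.ne)
    simpa using this
  refine tendsto_of_tendsto_of_tendsto_of_le_of_le tendsto_const_nhds hlim
    (fun _ => zero_le) fun n => ?_
  calc ‖∫ x, ψ x * f n x ∂μ‖ₑ ≤ ∫⁻ x, ‖ψ x * f n x‖ₑ ∂μ := enorm_integral_le_lintegral_enorm _
    _ = eLpNorm (ψ • f n) 1 μ := by rw [eLpNorm_one_eq_lintegral_enorm]; rfl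
    _ ≤ eLpNorm ψ 2 μ * eLpNorm (f n) 2 μ := eLpNorm_smul_le_mul_eLpNorm (hf n) hψ.1

theorem pd_add {φ ψ : Space d → ℝ} (hφ : ContDiff ℝ ∞ φ) (hψ : ContDiff ℝ ∞ ψ) (i : Fin d) :
    pd i (φ + ψ) = pd i φ + pd i ψ := by
  funext x
  simp [pd, fderiv_add ((hφ.differentiable (by simp)) x) ((hψ.differentiable (by simp)) x)]

theorem pd_sub {φ ψ : Space d → ℝ} (hφ : ContDiff ℝ ∞ φ) (hψ : ContDiff ℝ ∞ ψ) (i : Fin d) :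
    pd i (φ - ψ) = pd i φ - pd i ψ := by
  funext x
  simp [pd, fderiv_sub ((hφ.differentiable (by simp)) x) ((hψ.differentiable (by simp)) x)]

theorem pd_const_smul {φ : Space d → ℝ} (hφ : ContDiff ℝ ∞ φ) (c : ℝ) (i : Fin d) :
    pd i (c • φ) = c • pd i φ := by
  funext x
  simp [pd, fderiv_const_smul ((hφ.differentiable (by simp)) x)]

theorem integral_mul_pd {φ ψ : Space d → ℝ} (hφ : ContDiff ℝ ∞ φ) (hψ : ContDiff ℝ ∞ ψ)
    (hc : HasCompactSupport ψ) (i : Fin d) :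
    ∫ x, ψ x * pd i φ x = - ∫ x, pd i ψ x * φ x := by
  have hcψ : HasCompactSupport (pd i ψ) := (hc.fderiv (𝕜 := ℝ)).comp_left
    (g := fun L : Space d →L[ℝ] ℝ => L (EuclideanSpace.single i 1)) (by simp)
  refine integral_mul_fderiv_eq_neg_fderiv_mul_of_integrable ?_ ?_ ?_
    (fun x _ => (hψ.differentiable (by simp)) x) (fun x _ => (hφ.differentiable (by simp)) x)
  · exact ((continuous_pd i hψ).mul hφ.continuous).integrable_of_hasCompactSupport
      (hcψ.mul_right)
  · exact (hψ.continuous.mul (continuous_pd i hφ)).integrable_of_hasCompactSupport hc.mul_right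
  · exact (hψ.continuous.mul hφ.continuous).integrable_of_hasCompactSupport hc.mul_right

theorem memLp_hull_of_continuous {f : Space d → ℝ} (hf : Continuous f) (K : Finset (Space d)) :
    MemLp f 2 (volume.restrict (hull K)) := memLp_of_continuous_hull hf K volume

/-- The gradient is a closable operator. -/
theorem ae_zero_of_tendsto_pd {χ : ℕ → Space d → ℝ} (hχ : ∀ n, ContDiff ℝ ∞ (χ n)) {i : Fin d}
    {h : Space d → ℝ} (hh : MemLp h 2 (volume.restrict (hull K)))
    (h0 : Tendsto (fun n => eLpNorm (χ n) 2 (volume.restrict (hull K))) atTop (𝓝 0))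
    (h1 : Tendsto (fun n => eLpNorm (h - pd i (χ n)) 2 (volume.restrict (hull K))) atTop (𝓝 0)) :
    h =ᵐ[volume.restrict (hull K)] 0 := by
  have hint : Integrable h (volume.restrict (hull K)) := hh.integrable (by norm_num)
  have key := isOpen_interior.ae_eq_zero_of_integral_contDiff_smul_eq_zero (μ := volume)
    (U := interior (hull K)) (f := h)
    ((IntegrableOn.mono_set (μ := volume) hint interior_subset).locallyIntegrableOn)
    (fun ψ hψ hc hs => by
      have hsupp : ∀ f : Space d → ℝ, Function.support f ⊆ tsupport ψ →
          ∫ x in hull K, f x = ∫ x, f x := fun f hf =>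
        setIntegral_eq_integral_of_forall_compl_eq_zero fun x hx => by
          by_contra hne
          exact hx (interior_subset (hs (hf hne)))
      have hψL := memLp_hull_of_continuous hψ.continuous K
      have hψ' : Continuous (pd i ψ) := continuous_pd i hψ
      have hψ'L := memLp_hull_of_continuous hψ' K
      have hpdL : ∀ n, MemLp (pd i (χ n)) 2 (volume.restrict (hull K)) := fun n =>
        memLp_hull_of_continuous (continuous_pd i (hχ n)) K
      -- Integration by parts moves the derivative from `χ n` to the test function, after which both
      -- terms tend to zero.
      have e : ∀ n, ∫ x in hull K, ψ x * h x =
          (∫ x in hull K, ψ x * (h - pd i (χ n)) x) - ∫ x in hull K, pd i ψ x * χ n x := by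
        intro n
        have e1 : ∫ x in hull K, ψ x * pd i (χ n) x = - ∫ x in hull K, pd i ψ x * χ n x := by
          rw [hsupp _ fun x hx => subset_tsupport _ (left_ne_zero_of_mul hx),
            hsupp (fun x => pd i ψ x * χ n x) fun x hx => ?_, integral_mul_pd (hχ n) hψ hc i]
          have h2 : pd i ψ x ≠ 0 := left_ne_zero_of_mul hx
          have h3 : fderiv ℝ ψ x ≠ 0 := fun h => h2 (by simp [pd, h])
          exact support_fderiv_subset ℝ h3
        rw [sub_eq_add_neg, ← e1, ← integral_add]
        · refine integral_congr_ae (Eventually.of_forall fun x => ?_)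
          simp only [Pi.sub_apply]; ring
        · exact hψL.integrable_mul (hh.sub (hpdL n))
        · exact hψL.integrable_mul (hpdL n)
      have lim : Tendsto (fun n => (∫ x in hull K, ψ x * (h - pd i (χ n)) x) -
          ∫ x in hull K, pd i ψ x * χ n x) atTop (𝓝 (0 - 0)) :=
        (tendsto_integral_mul_zero hψL (fun n => (hh.sub (hpdL n)).1) h1).sub
          (tendsto_integral_mul_zero hψ'L
            (fun n => (hχ n).continuous.aestronglyMeasurable) h0)
      simp only [← e, sub_zero] at lim
      have e2 := tendsto_nhds_unique lim tendsto_const_nhds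
      simp only [smul_eq_mul]
      rw [← hsupp (fun x => ψ x * h x) fun x hx => subset_tsupport _ (left_ne_zero_of_mul hx)]
      exact e2.symm)
  rw [← Measure.restrict_congr_set (interior_hull_ae_eq K)]
  exact (ae_restrict_iff' isOpen_interior.measurableSet).2 key

theorem IsTraceFrom.exists_seq {u w : Space d → ℝ} (h : IsTraceFrom K F u w) :
    ∃ g : Fin d → Space d → ℝ, (∀ i, MemLp (g i) 2 (volume.restrict (hull K))) ∧
      ∃ φ : ℕ → Space d → ℝ, (∀ n, ContDiff ℝ ∞ (φ n)) ∧
        Tendsto (fun n => eLpNorm (u - φ n) 2 (volume.restrict (hull K))) atTop (𝓝 0) ∧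
        (∀ i, Tendsto (fun n => eLpNorm (g i - pd i (φ n)) 2 (volume.restrict (hull K)))
          atTop (𝓝 0)) ∧
        Tendsto (fun n => eLpNorm (w - φ n) 2 (facetMeasure F)) atTop (𝓝 0) := by
  obtain ⟨_, g, hg, h⟩ := h
  -- For `n = 0` the tolerance is infinite, which is harmless since only positivity and the limit
  -- matter.
  have hpos : ∀ n : ℕ, (0 : ℝ≥0∞) < ((n : ℝ≥0∞))⁻¹ := fun n => by simp
  choose φ hφ h1 h2 h3 using fun n : ℕ => h _ (hpos n)
  have hsq : ∀ f : ℕ → ℝ≥0∞, (∀ n, f n < ((n : ℝ≥0∞))⁻¹) → Tendsto f atTop (𝓝 0) := fun f hf =>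
    tendsto_of_tendsto_of_tendsto_of_le_of_le tendsto_const_nhds
      ENNReal.tendsto_inv_nat_nhds_zero (fun _ => zero_le) fun n => (hf n).le
  exact ⟨g, hg, φ, hφ, hsq _ h1, fun i => hsq _ fun n => h2 n i, hsq _ h3⟩

theorem IsTraceFrom.of_seq {u w : Space d → ℝ} (hw : MemLp w 2 (facetMeasure F))
    {g : Fin d → Space d → ℝ} (hg : ∀ i, MemLp (g i) 2 (volume.restrict (hull K)))
    {φ : ℕ → Space d → ℝ} (hφ : ∀ n, ContDiff ℝ ∞ (φ n))
    (h1 : Tendsto (fun n => eLpNorm (u - φ n) 2 (volume.restrict (hull K))) atTop (𝓝 0))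
    (h2 : ∀ i, Tendsto (fun n => eLpNorm (g i - pd i (φ n)) 2 (volume.restrict (hull K)))
      atTop (𝓝 0))
    (h3 : Tendsto (fun n => eLpNorm (w - φ n) 2 (facetMeasure F)) atTop (𝓝 0)) :
    IsTraceFrom K F u w := by
  refine ⟨hw, g, hg, fun ε hε => ?_⟩
  obtain ⟨n, e1, e2, e3⟩ := ((h1.eventually (gt_mem_nhds hε)).and
    ((eventually_all.2 fun i => (h2 i).eventually (gt_mem_nhds hε)).and
      (h3.eventually (gt_mem_nhds hε)))).exists
  exact ⟨φ n, hφ n, e1, e2, e3⟩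

theorem tendsto_eLpNorm_of_le_add {X : Type*} [MeasurableSpace X] {μ : Measure X}
    {f : ℕ → X → ℝ} {a b : ℕ → ℝ≥0∞} (ha : Tendsto a atTop (𝓝 0)) (hb : Tendsto b atTop (𝓝 0))
    (h : ∀ n, eLpNorm (f n) 2 μ ≤ a n + b n) :
    Tendsto (fun n => eLpNorm (f n) 2 μ) atTop (𝓝 0) := by
  have := ha.add hb
  rw [add_zero] at this
  exact tendsto_of_tendsto_of_tendsto_of_le_of_le tendsto_const_nhds this (fun _ => zero_le) h

theorem tendsto_eLpNorm_sub {X : Type*} [MeasurableSpace X] {μ : Measure X} {u v : X → ℝ}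
    (huv : AEStronglyMeasurable u μ) (hv : AEStronglyMeasurable v μ) {φ ψ : ℕ → X → ℝ}
    (hφ : ∀ n, AEStronglyMeasurable (φ n) μ) (hψ : ∀ n, AEStronglyMeasurable (ψ n) μ)
    (h1 : Tendsto (fun n => eLpNorm (u - φ n) 2 μ) atTop (𝓝 0))
    (h2 : Tendsto (fun n => eLpNorm (v - ψ n) 2 μ) atTop (𝓝 0)) :
    Tendsto (fun n => eLpNorm ((u - v) - (φ n - ψ n)) 2 μ) atTop (𝓝 0) := by
  refine tendsto_eLpNorm_of_le_add h1 h2 fun n => ?_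
  rw [show (u - v) - (φ n - ψ n) = (u - φ n) - (v - ψ n) by abel]
  exact eLpNorm_sub_le (huv.sub (hφ n)) (hv.sub (hψ n)) (by norm_num)

theorem tendsto_eLpNorm_add {X : Type*} [MeasurableSpace X] {μ : Measure X} {u v : X → ℝ}
    (huv : AEStronglyMeasurable u μ) (hv : AEStronglyMeasurable v μ) {φ ψ : ℕ → X → ℝ}
    (hφ : ∀ n, AEStronglyMeasurable (φ n) μ) (hψ : ∀ n, AEStronglyMeasurable (ψ n) μ)
    (h1 : Tendsto (fun n => eLpNorm (u - φ n) 2 μ) atTop (𝓝 0))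
    (h2 : Tendsto (fun n => eLpNorm (v - ψ n) 2 μ) atTop (𝓝 0)) :
    Tendsto (fun n => eLpNorm ((u + v) - (φ n + ψ n)) 2 μ) atTop (𝓝 0) := by
  refine tendsto_eLpNorm_of_le_add h1 h2 fun n => ?_
  rw [add_sub_add_comm]
  exact eLpNorm_add_le (huv.sub (hφ n)) (hv.sub (hψ n)) (by norm_num)

theorem IsTraceFrom.add {u u' w w' : Space d → ℝ}
    (hu : AEStronglyMeasurable u (volume.restrict (hull K)))
    (hu' : AEStronglyMeasurable u' (volume.restrict (hull K)))
    (h : IsTraceFrom K F u w) (h' : IsTraceFrom K F u' w') :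
    IsTraceFrom K F (u + u') (w + w') := by
  obtain ⟨g, hg, φ, hφ, h1, h2, h3⟩ := h.exists_seq
  obtain ⟨g', hg', φ', hφ', h1', h2', h3'⟩ := h'.exists_seq
  refine IsTraceFrom.of_seq (h.1.add h'.1) (g := g + g') (fun i => (hg i).add (hg' i))
    (φ := fun n => φ n + φ' n) (fun n => (hφ n).add (hφ' n)) ?_ (fun i => ?_) ?_
  · exact tendsto_eLpNorm_add hu hu' (fun n => (hφ n).continuous.aestronglyMeasurable)
      (fun n => (hφ' n).continuous.aestronglyMeasurable) h1 h1'
  · simp only [fun n => pd_add (hφ n) (hφ' n) i]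
    exact tendsto_eLpNorm_add (hg i).1 (hg' i).1
      (fun n => (continuous_pd i (hφ n)).aestronglyMeasurable)
      (fun n => (continuous_pd i (hφ' n)).aestronglyMeasurable) (h2 i) (h2' i)
  · exact tendsto_eLpNorm_add h.1.1 h'.1.1 (fun n => (hφ n).continuous.aestronglyMeasurable)
      (fun n => (hφ' n).continuous.aestronglyMeasurable) h3 h3'

theorem tendsto_eLpNorm_const_smul {X : Type*} [MeasurableSpace X] {μ : Measure X} (c : ℝ)
    {u : X → ℝ} {φ : ℕ → X → ℝ} (h : Tendsto (fun n => eLpNorm (u - φ n) 2 μ) atTop (𝓝 0)) :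
    Tendsto (fun n => eLpNorm (c • u - c • φ n) 2 μ) atTop (𝓝 0) := by
  simp only [← smul_sub, eLpNorm_const_smul]
  have := ENNReal.Tendsto.const_mul (a := ‖c‖ₑ) h (Or.inr (by simp))
  simpa using this

theorem IsTraceFrom.const_smul {u w : Space d → ℝ} (c : ℝ) (h : IsTraceFrom K F u w) :
    IsTraceFrom K F (c • u) (c • w) := by
  obtain ⟨g, hg, φ, hφ, h1, h2, h3⟩ := h.exists_seq
  refine IsTraceFrom.of_seq (h.1.const_smul c) (g := c • g) (fun i => (hg i).const_smul c)
    (φ := fun n => c • φ n) (fun n => (hφ n).const_smul c) (tendsto_eLpNorm_const_smul c h1)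
    (fun i => ?_) (tendsto_eLpNorm_const_smul c h3)
  simp only [fun n => pd_const_smul (hφ n) c i]
  exact tendsto_eLpNorm_const_smul c (h2 i)

theorem IsTraceFrom.congr {u u' w : Space d → ℝ} (h : IsTraceFrom K F u w)
    (hu : u =ᵐ[volume.restrict (hull K)] u') : IsTraceFrom K F u' w := by
  obtain ⟨hw, g, hg, h⟩ := h
  refine ⟨hw, g, hg, fun ε hε => ?_⟩
  obtain ⟨φ, h1, h2, h3⟩ := h ε hε
  refine ⟨φ, h1, ?_, h3⟩
  rwa [eLpNorm_congr_ae (hu.symm.sub (ae_eq_refl φ))]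

theorem isTraceFrom_of_contDiff {φ : Space d → ℝ} (hφ : ContDiff ℝ ∞ φ)
    (hF : IsFiniteMeasure (facetMeasure F)) : IsTraceFrom K F φ φ := by
  have : IsFiniteMeasure ((Measure.euclideanHausdorffMeasure (d - 1) :
    Measure (Space d)).restrict (hull F)) := hF
  refine ⟨memLp_of_continuous_hull hφ.continuous F _, fun i => pd i φ,
    fun i => memLp_hull_of_continuous (continuous_pd i hφ) K, fun ε hε => ⟨φ, hφ, ?_, fun i => ?_, ?_⟩⟩ <;>
  simpa using hε

/-- Traces are unique. -/
theorem IsCell.trace_unique (hd : 2 ≤ d) (hK : IsCell K) (hz : z ∈ K) {u w w' : Space d → ℝ}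
    (hu : AEStronglyMeasurable u (volume.restrict (hull K)))
    (h : IsTraceFrom K (K.erase z) u w) (h' : IsTraceFrom K (K.erase z) u w') :
    w =ᵐ[facetMeasure (K.erase z)] w' := by
  obtain ⟨g, hg, φ, hφ, h1, h2, h3⟩ := h.exists_seq
  obtain ⟨g', hg', φ', hφ', h1', h2', h3'⟩ := h'.exists_seq
  obtain ⟨C, hC, hbound⟩ := hK.exists_trace_bound hd hz
  have hφm : ∀ (μ : Measure (Space d)) n, AEStronglyMeasurable (φ n) μ :=
    fun μ n => (hφ n).continuous.aestronglyMeasurable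
  have hφm' : ∀ (μ : Measure (Space d)) n, AEStronglyMeasurable (φ' n) μ :=
    fun μ n => (hφ' n).continuous.aestronglyMeasurable
  have hχ : ∀ n, ContDiff ℝ ∞ (φ n - φ' n) := fun n => (hφ n).sub (hφ' n)
  have e0 : Tendsto (fun n => eLpNorm (φ n - φ' n) 2 (volume.restrict (hull K))) atTop (𝓝 0) := by
    have := tendsto_eLpNorm_sub hu hu (hφm _) (hφm' _) h1 h1'
    simpa only [sub_self, zero_sub, eLpNorm_neg] using this
  have e1 : ∀ i, Tendsto (fun n => eLpNorm ((g i - g' i) - pd i (φ n - φ' n)) 2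
      (volume.restrict (hull K))) atTop (𝓝 0) := by
    intro i
    simp only [fun n => pd_sub (hφ n) (hφ' n) i]
    exact tendsto_eLpNorm_sub (hg i).1 (hg' i).1
      (fun n => (continuous_pd i (hφ n)).aestronglyMeasurable)
      (fun n => (continuous_pd i (hφ' n)).aestronglyMeasurable) (h2 i) (h2' i)
  have e2 : ∀ i, Tendsto (fun n => eLpNorm (pd i (φ n - φ' n)) 2 (volume.restrict (hull K)))
      atTop (𝓝 0) := by
    intro i
    -- The differences of the two approximating sequences tend to zero in `L²(K)` and their
    -- gradients tend to `g - g'`; closability makes this limit zero.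
    have hz := ae_zero_of_tendsto_pd hχ ((hg i).sub (hg' i)) e0 (e1 i)
    refine (e1 i).congr fun n => ?_
    rw [eLpNorm_congr_ae (hz.sub (ae_eq_refl (pd i (φ n - φ' n)))), zero_sub, eLpNorm_neg]
  -- The trace inequality carries the convergence to zero over to the facet.
  have e3 : Tendsto (fun n => eLpNorm (φ n - φ' n) 2 (facetMeasure (K.erase z))) atTop (𝓝 0) := by
    have hlim := ENNReal.Tendsto.const_mul (a := C)
      (e0.add (tendsto_finsetSum Finset.univ fun i _ => e2 i)) (Or.inr hC)
    simp only [Finset.sum_const_zero, add_zero, mul_zero] at hlim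
    exact tendsto_of_tendsto_of_tendsto_of_le_of_le tendsto_const_nhds hlim (fun _ => zero_le)
      fun n => hbound _ (hχ n)
  have e4 := tendsto_eLpNorm_sub h.1.1 h'.1.1 (hφm _) (hφm' _) h3 h3'
  have e5 : Tendsto (fun _ : ℕ => eLpNorm (w - w') 2 (facetMeasure (K.erase z))) atTop (𝓝 0) := by
    refine tendsto_eLpNorm_of_le_add e4 e3 fun n => ?_
    conv_lhs => rw [show w - w' = (w - w' - (φ n - φ' n)) + (φ n - φ' n) by abel]
    exact eLpNorm_add_le ((h.1.1.sub h'.1.1).sub ((hφm _ n).sub (hφm' _ n)))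
      ((hφm _ n).sub (hφm' _ n)) (by norm_num)
  have e6 := tendsto_nhds_unique tendsto_const_nhds e5
  rw [eLpNorm_eq_zero_iff (h.1.1.sub h'.1.1) (by norm_num)] at e6
  filter_upwards [e6] with x hx
  simpa [sub_eq_zero] using hx

/-- A function that is a limit of smooth functions in `H¹(K)` has a trace. -/
theorem IsCell.exists_trace (hd : 2 ≤ d) (hK : IsCell K) (hz : z ∈ K) {u : Space d → ℝ}
    (hu : AEStronglyMeasurable u (volume.restrict (hull K)))
    {g : Fin d → Space d → ℝ} (hg : ∀ i, MemLp (g i) 2 (volume.restrict (hull K)))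
    (h : ∀ ε : ℝ≥0∞, 0 < ε → ∃ φ : Space d → ℝ, ContDiff ℝ ∞ φ ∧
      eLpNorm (u - φ) 2 (volume.restrict (hull K)) < ε ∧
      ∀ i, eLpNorm (g i - pd i φ) 2 (volume.restrict (hull K)) < ε) :
    ∃ w, IsTraceFrom K (K.erase z) u w := by
  obtain ⟨C, hC, hbound⟩ := hK.exists_trace_bound hd hz
  have hfin := hK.isFiniteMeasure_facetMeasure hd hz
  -- Geometric tolerances make the Cauchy bounds on the facet summable, as the completeness of `L²`
  -- is used in that form.
  have hpos : ∀ n : ℕ, (0 : ℝ≥0∞) < (2⁻¹ : ℝ≥0∞) ^ n := fun n => ENNReal.pow_pos (by simp) n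
  have hhalf : ∀ n : ℕ, (2⁻¹ : ℝ≥0∞) ^ n ≠ ⊤ := fun n => ENNReal.pow_ne_top (by simp)
  choose φ hφ h1 h2 using fun n : ℕ => h _ (hpos n)
  have hφm : ∀ (μ : Measure (Space d)) n, AEStronglyMeasurable (φ n) μ :=
    fun μ n => (hφ n).continuous.aestronglyMeasurable
  have hlim : Tendsto (fun n : ℕ => (2⁻¹ : ℝ≥0∞) ^ n) atTop (𝓝 0) :=
    ENNReal.tendsto_pow_atTop_nhds_zero_of_lt_one (by simp)
  have hsq : ∀ f : ℕ → ℝ≥0∞, (∀ n, f n < (2⁻¹ : ℝ≥0∞) ^ n) → Tendsto f atTop (𝓝 0) := fun f hf =>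
    tendsto_of_tendsto_of_tendsto_of_le_of_le tendsto_const_nhds hlim (fun _ => zero_le)
      fun n => (hf n).le
  -- The trace inequality gives the factor `C * (2 + d * 2)`; the extra `1` makes the Cauchy
  -- estimate strict.
  have hD : C * (2 + d * 2) + 1 ≠ ⊤ := ENNReal.add_ne_top.2
    ⟨ENNReal.mul_ne_top hC (ENNReal.add_ne_top.2 ⟨by simp, ENNReal.mul_ne_top (by simp) (by simp)⟩),
      by simp⟩
  have hanti : ∀ {N n : ℕ}, N ≤ n → (2⁻¹ : ℝ≥0∞) ^ n ≤ 2⁻¹ ^ N := fun hn =>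
    pow_le_pow_right_of_le_one' (by simp) hn
  have hcau : ∀ N n m : ℕ, N ≤ n → N ≤ m →
      eLpNorm (φ n - φ m) 2 (facetMeasure (K.erase z)) < (C * (2 + d * 2) + 1) * 2⁻¹ ^ N := by
    intro N n m hn hm
    have b1 : eLpNorm (φ n - φ m) 2 (volume.restrict (hull K)) ≤ 2 * 2⁻¹ ^ N := by
      rw [show φ n - φ m = (u - φ m) - (u - φ n) by abel]
      refine (eLpNorm_sub_le (hu.sub (hφm _ m)) (hu.sub (hφm _ n)) (by norm_num)).trans ?_
      rw [two_mul]
      exact add_le_add ((h1 m).le.trans (hanti hm)) ((h1 n).le.trans (hanti hn))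
    have b2 : ∀ i, eLpNorm (pd i (φ n - φ m)) 2 (volume.restrict (hull K)) ≤ 2 * 2⁻¹ ^ N := by
      intro i
      have hpm : ∀ n, AEStronglyMeasurable (pd i (φ n)) (volume.restrict (hull K)) :=
        fun n => (continuous_pd i (hφ n)).aestronglyMeasurable
      rw [pd_sub (hφ n) (hφ m), show pd i (φ n) - pd i (φ m) =
        (g i - pd i (φ m)) - (g i - pd i (φ n)) by abel]
      refine (eLpNorm_sub_le ((hg i).1.sub (hpm m)) ((hg i).1.sub (hpm n)) (by norm_num)).trans ?_
      rw [two_mul]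
      exact add_le_add ((h2 m i).le.trans (hanti hm)) ((h2 n i).le.trans (hanti hn))
    calc _ ≤ C * (2 * 2⁻¹ ^ N + ∑ _i : Fin d, 2 * 2⁻¹ ^ N) :=
          (hbound _ ((hφ n).sub (hφ m))).trans
            (mul_le_mul_right (add_le_add b1 (Finset.sum_le_sum fun i _ => b2 i)) C)
      _ = C * (2 + d * 2) * 2⁻¹ ^ N := by
          rw [Finset.sum_const, Finset.card_univ, Fintype.card_fin, nsmul_eq_mul]; ring
      _ < C * (2 + d * 2) * 2⁻¹ ^ N + 1 * 2⁻¹ ^ N := by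
          refine ENNReal.lt_add_right ?_ ?_
          · exact ENNReal.mul_ne_top (ENNReal.mul_ne_top hC (ENNReal.add_ne_top.2
              ⟨by simp, ENNReal.mul_ne_top (by simp) (by simp)⟩)) (hhalf N)
          · simp
      _ = (C * (2 + d * 2) + 1) * 2⁻¹ ^ N := by ring
  have hB : ∑' N : ℕ, (C * (2 + d * 2) + 1) * (2⁻¹ : ℝ≥0∞) ^ N ≠ ⊤ := by
    rw [ENNReal.tsum_mul_left, ENNReal.tsum_geometric]
    refine ENNReal.mul_ne_top hD (ENNReal.inv_ne_top.2 ?_)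
    simp
  have hfin' : IsFiniteMeasure ((Measure.euclideanHausdorffMeasure (d - 1) :
    Measure (Space d)).restrict (hull (K.erase z))) := hfin
  obtain ⟨w, hw, hlimw⟩ := Lp.cauchy_complete_eLpNorm (p := 2) (by norm_num)
    (fun n => memLp_of_continuous_hull (hφ n).continuous (K.erase z) _) hB hcau
  refine ⟨w, IsTraceFrom.of_seq hw hg hφ (hsq _ h1) (fun i => hsq _ fun n => h2 n i) ?_⟩
  refine hlimw.congr fun n => ?_
  rw [eLpNorm_sub_comm]; rfl

end

section

/-! ### Approximation by smooth functions on a simplex -/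

open Filter Topology

variable {d : ℕ} {K : Finset (Space d)}

/-- The mollification of `f` with the bump function `b`. -/
def mollify (b : ContDiffBump (0 : Space d)) (f : Space d → ℝ) : Space d → ℝ :=
  convolution (b.normed volume) f (ContinuousLinearMap.lsmul ℝ ℝ) volume

theorem mollify_eq (b : ContDiffBump (0 : Space d)) (f : Space d → ℝ) (x : Space d) :
    mollify b f x = ∫ y, f y * b.normed volume (x - y) := by
  unfold mollify
  rw [convolution_eq_swap]
  refine integral_congr_ae (Eventually.of_forall fun y => ?_)
  simp [mul_comm]

theorem contDiff_mollify (b : ContDiffBump (0 : Space d)) {f : Space d → ℝ}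
    (hf : LocallyIntegrable f volume) : ContDiff ℝ ∞ (mollify b f) :=
  b.hasCompactSupport_normed.contDiff_convolution_left _ b.contDiff_normed hf

theorem pd_mollify (b : ContDiffBump (0 : Space d)) {f : Space d → ℝ}
    (hf : LocallyIntegrable f volume) (i : Fin d) (x : Space d) :
    pd i (mollify b f) x = ∫ y, f y * pd i (b.normed volume) (x - y) := by
  have hcd : ContDiff ℝ ∞ (b.normed volume : Space d → ℝ) := b.contDiff_normed
  have h1 : ContDiff ℝ 1 (b.normed volume : Space d → ℝ) := hcd.of_le (by simp)
  have h := b.hasCompactSupport_normed.hasFDerivAt_convolution_left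
    (ContinuousLinearMap.lsmul ℝ ℝ) (μ := volume) h1 hf x
  have hex : ConvolutionExistsAt (fderiv ℝ (b.normed volume)) f x
      ((ContinuousLinearMap.lsmul ℝ ℝ).precompL (Space d)) volume :=
    (b.hasCompactSupport_normed.fderiv (𝕜 := ℝ)).convolutionExists_left _
      (hcd.continuous_fderiv (by simp)) hf x
  unfold pd
  rw [show fderiv ℝ (mollify b f) x = _ from h.fderiv, convolution_eq_swap,
    ContinuousLinearMap.integral_apply hex.integrable_swap]
  refine integral_congr_ae (Eventually.of_forall fun y => ?_)
  simp [ContinuousLinearMap.precompL_apply, mul_comm]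

/-- The probability measure whose density is a bump function. -/
def bumpMeasure (b : ContDiffBump (0 : Space d)) : Measure (Space d) :=
  volume.withDensity fun s => ENNReal.ofReal (b.normed volume s)

instance (b : ContDiffBump (0 : Space d)) : IsProbabilityMeasure (bumpMeasure b) := by
  constructor
  rw [bumpMeasure, withDensity_apply _ MeasurableSet.univ, Measure.restrict_univ,
    ← ofReal_integral_eq_lintegral_ofReal b.integrable_normed
      (Eventually.of_forall b.nonneg_normed), b.integral_normed, ENNReal.ofReal_one]

theorem mollify_eq_integral_bumpMeasure (b : ContDiffBump (0 : Space d)) (f : Space d → ℝ)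
    (x : Space d) : mollify b f x = ∫ s, f (x - s) ∂(bumpMeasure b) := by
  rw [bumpMeasure, integral_withDensity_eq_integral_toReal_smul
    (b.continuous_normed.measurable.ennreal_ofReal) (Eventually.of_forall fun _ => by simp)]
  refine integral_congr_ae (Eventually.of_forall fun s => ?_)
  simp [ENNReal.toReal_ofReal (b.nonneg_normed s)]

/-- A mollification is an average of translates over a probability measure, so this is Jensen's
inequality. -/
theorem sq_enorm_mollify_le (b : ContDiffBump (0 : Space d)) {f : Space d → ℝ}
    (hf : StronglyMeasurable f) (x : Space d) :
    ‖mollify b f x‖ₑ ^ 2 ≤ ∫⁻ s, ‖f (x - s)‖ₑ ^ 2 ∂(bumpMeasure b) := by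
  rw [mollify_eq_integral_bumpMeasure]
  have hm : AEStronglyMeasurable (fun s => f (x - s)) (bumpMeasure b) :=
    (hf.comp_measurable (measurable_const.sub measurable_id)).aestronglyMeasurable
  calc _ ≤ (eLpNorm (fun s => f (x - s)) 1 (bumpMeasure b)) ^ 2 := by
        gcongr
        rw [eLpNorm_one_eq_lintegral_enorm]
        exact enorm_integral_le_lintegral_enorm _
    _ ≤ (eLpNorm (fun s => f (x - s)) 2 (bumpMeasure b)) ^ 2 := by
        gcongr
        exact eLpNorm_le_eLpNorm_of_exponent_le (by norm_num) hm
    _ = _ := by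
        rw [sq_eLpNorm_two]
        refine lintegral_congr fun s => ?_
        rw [← enorm_pow, Real.enorm_of_nonneg (sq_nonneg _)]

theorem lintegral_comp_smul_add (f : Space d → ℝ≥0∞) (hf : Measurable f) {c : ℝ} (hc : c ≠ 0)
    (v : Space d) :
    ∫⁻ x, f (c • x + v) = ENNReal.ofReal |(c ^ d)⁻¹| * ∫⁻ x, f x := by
  have h1 : ∫⁻ x, f (c • x + v) = ∫⁻ y, f (y + v) ∂(Measure.map (c • ·) volume) := by
    rw [lintegral_map (by fun_prop) (by fun_prop)]
  rw [h1, Measure.map_addHaar_smul volume hc, lintegral_smul_measure, finrank_euclideanSpace_fin,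
    lintegral_add_right_eq_self f v]
  rfl

/-- The combination of mollification with a dilation is bounded on `L²`. -/
theorem eLpNorm_mollify_comp_le (b : ContDiffBump (0 : Space d)) {f : Space d → ℝ}
    (hf : StronglyMeasurable f) {c : ℝ} (hc : 1 / 2 ≤ c) (v : Space d) :
    eLpNorm (fun x => mollify b f (c • x + v)) 2 volume ≤ 2 ^ d * eLpNorm f 2 volume := by
  have hc0 : 0 < c := by linarith
  have hsq : (eLpNorm (fun x => mollify b f (c • x + v)) 2 volume) ^ 2
      ≤ (2 ^ d * eLpNorm f 2 volume) ^ 2 := by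
    have e : ∀ (g : Space d → ℝ), (eLpNorm g 2 volume) ^ 2 = ∫⁻ x, ‖g x‖ₑ ^ 2 := fun g => by
      rw [sq_eLpNorm_two]
      refine lintegral_congr fun s => ?_
      rw [← enorm_pow, Real.enorm_of_nonneg (sq_nonneg _)]
    have hm : Measurable fun x => ‖f x‖ₑ ^ 2 := hf.measurable.enorm.pow_const 2
    rw [mul_pow, e, e]
    calc ∫⁻ x, ‖mollify b f (c • x + v)‖ₑ ^ 2
        ≤ ∫⁻ x, (∫⁻ s, ‖f (c • x + v - s)‖ₑ ^ 2 ∂(bumpMeasure b)) :=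
          lintegral_mono fun x => sq_enorm_mollify_le b hf _
      _ = ∫⁻ s, (∫⁻ x, ‖f (c • x + v - s)‖ₑ ^ 2) ∂(bumpMeasure b) := by
          refine lintegral_lintegral_swap (Measurable.aemeasurable ?_)
          exact hm.comp (by fun_prop : Measurable fun p : Space d × Space d => c • p.1 + v - p.2)
      _ = ∫⁻ _s, (ENNReal.ofReal |(c ^ d)⁻¹| * ∫⁻ x, ‖f x‖ₑ ^ 2) ∂(bumpMeasure b) := by
          refine lintegral_congr fun s => ?_
          rw [← lintegral_comp_smul_add _ hm hc0.ne' (v - s)]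
          simp only [add_sub_assoc]
      _ = ENNReal.ofReal |(c ^ d)⁻¹| * ∫⁻ x, ‖f x‖ₑ ^ 2 := by simp
      _ ≤ (2 ^ d) ^ 2 * ∫⁻ x, ‖f x‖ₑ ^ 2 := by
          gcongr
          have h1 : |(c ^ d)⁻¹| ≤ 2 ^ d := by
            rw [abs_of_nonneg (by positivity), ← inv_pow]
            gcongr
            rw [inv_le_comm₀ hc0 (by norm_num)]
            linarith
          have h2 : (2 : ℝ) ^ d ≤ (2 ^ d) ^ 2 := by
            have : (1 : ℝ) ≤ 2 ^ d := one_le_pow₀ (by norm_num)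
            nlinarith
          calc ENNReal.ofReal |(c ^ d)⁻¹| ≤ ENNReal.ofReal ((2 ^ d) ^ 2) :=
                ENNReal.ofReal_le_ofReal (h1.trans h2)
            _ = (2 ^ d) ^ 2 := by
                rw [ENNReal.ofReal_pow (by positivity), ENNReal.ofReal_pow (by norm_num)]; simp
  exact (ENNReal.pow_le_pow_left_iff two_ne_zero).1 hsq

/-- Mollification combined with a small dilation converges in `L²(K)`. -/
theorem exists_eLpNorm_sub_mollify_le {f : Space d → ℝ} (hf : StronglyMeasurable f)
    (hf2 : MemLp f 2 volume) (x₀ : Space d) {r : ℝ} (hr : 0 < r) {ε : ℝ≥0∞} (hε : 0 < ε) :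
    ∃ t₀ > 0, ∀ t, 0 < t → t < t₀ → ∀ b : ContDiffBump (0 : Space d), b.rOut ≤ t * r →
      eLpNorm (f - fun x => mollify b f ((1 - t) • x + t • x₀)) 2 (volume.restrict (hull K))
        ≤ ε := by
  -- `f` is replaced by a continuous function with compact support; with this tolerance the
  -- difference and its smoothed version, bounded with factor `2 ^ d`, together cost `ε / 2`.
  have hε4 : ε / (2 * (1 + 2 ^ d)) ≠ 0 := by
    simp only [ne_eq, ENNReal.div_eq_zero_iff, not_or]
    exact ⟨hε.ne', ENNReal.mul_ne_top (by simp) (by simp)⟩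
  obtain ⟨h, hhc, hh1, hcont, hhL⟩ := hf2.exists_hasCompactSupport_eLpNorm_sub_le (by simp) hε4
  have hcK : IsCompact (hull K) := isCompact_hull K
  have hfinK : IsFiniteMeasure (volume.restrict (hull K)) :=
    isFiniteMeasure_restrict.2 hcK.measure_lt_top.ne
  obtain ⟨M, hM⟩ := hcK.isBounded.subset_closedBall x₀
  obtain ⟨η, hη, hηε⟩ : ∃ η : ℝ, 0 < η ∧
      (volume.restrict (hull K)) Set.univ ^ (2⁻¹ : ℝ) * ENNReal.ofReal η ≤ ε / 2 := by
    have hm : (volume.restrict (hull K)) Set.univ ^ (2⁻¹ : ℝ) ≠ ⊤ :=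
      ENNReal.rpow_ne_top_of_nonneg (by norm_num) (measure_ne_top _ _)
    have hlim : Tendsto (fun η : ℝ => (volume.restrict (hull K)) Set.univ ^ (2⁻¹ : ℝ) *
        ENNReal.ofReal η) (𝓝[>] 0) (𝓝 0) := by
      have h1 : Tendsto (fun η : ℝ => ENNReal.ofReal η) (𝓝[>] 0) (𝓝 0) := by
        have := (ENNReal.continuous_ofReal.tendsto 0).mono_left
          (nhdsWithin_le_nhds (s := Set.Ioi (0 : ℝ)))
        simpa using this
      have := ENNReal.Tendsto.const_mul h1 (Or.inr hm)
      simpa using this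
    have h2 : 0 < ε / 2 := ENNReal.div_pos hε.ne' (by simp)
    obtain ⟨η, h3, h4⟩ := ((hlim.eventually (gt_mem_nhds h2)).and self_mem_nhdsWithin).exists
    exact ⟨η, h4, h3.le⟩
  have huc := hhc.uniformContinuous_of_continuous hcont
  obtain ⟨ρ, hρ, hρη⟩ := Metric.uniformContinuous_iff.1 huc (η / 2) (by positivity)
  -- The bound `1 / 2` keeps the dilation factor `1 - t` away from zero; the other bound keeps both
  -- the displacement `t (x - x₀)` and the mollification radius `t r` within the modulus of
  -- continuity `ρ`.
  refine ⟨min (1 / 2) (ρ / (|M| + r + 1)), by positivity, fun t ht ht0 b hb => ?_⟩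
  have ht1 : t < 1 / 2 := ht0.trans_le (min_le_left _ _)
  have ht2 : t * (|M| + r + 1) < ρ := by
    have := ht0.trans_le (min_le_right _ _)
    rwa [lt_div_iff₀ (by positivity)] at this
  have hMt : t * M ≤ t * |M| := by gcongr; exact le_abs_self M
  have hMt0 : 0 ≤ t * |M| := by positivity
  have hclose : eLpNorm (h - fun x => mollify b h ((1 - t) • x + t • x₀)) 2
      (volume.restrict (hull K)) ≤ ε / 2 := by
    refine le_trans (eLpNorm_le_of_ae_bound (C := η) ?_) ?_
    · refine ae_restrict_of_forall_mem hcK.measurableSet fun x hx => ?_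
      have d1 : dist x x₀ ≤ M := hM hx
      have d2 : dist x ((1 - t) • x + t • x₀) < ρ := by
        rw [dist_eq_norm, show x - ((1 - t) • x + t • x₀) = t • (x - x₀) by module, norm_smul,
          Real.norm_of_nonneg ht.le, ← dist_eq_norm]
        nlinarith
      have d3 : dist (mollify b h ((1 - t) • x + t • x₀)) (h ((1 - t) • x + t • x₀)) ≤ η / 2 := by
        refine b.dist_normed_convolution_le hcont.aestronglyMeasurable fun y hy => ?_
        refine (hρη ?_).le
        have : dist y ((1 - t) • x + t • x₀) < b.rOut := hy
        nlinarith
      have d4 := hρη d2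
      simp only [Pi.sub_apply]
      rw [← dist_eq_norm]
      rw [dist_comm] at d3
      linarith [dist_triangle (h x) (h ((1 - t) • x + t • x₀))
        (mollify b h ((1 - t) • x + t • x₀))]
    · simpa using hηε
  have hLI : LocallyIntegrable h volume := hcont.locallyIntegrable
  have hLIf : LocallyIntegrable f volume := hf2.locallyIntegrable (by norm_num)
  have hsub : ∀ x, mollify b (f - h) x = mollify b f x - mollify b h x := by
    intro x
    have hint : ∀ {p : Space d → ℝ}, LocallyIntegrable p volume →
        Integrable (fun y => p y * b.normed volume (x - y)) := by
      intro p hp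
      have := (b.hasCompactSupport_normed (μ := volume)).convolutionExists_left
        (ContinuousLinearMap.lsmul ℝ ℝ) b.continuous_normed hp x
      have h2 := this.integrable_swap
      simpa [mul_comm] using h2
    simp only [mollify_eq, Pi.sub_apply, sub_mul]
    exact integral_sub (hint hLIf) (hint hLI)
  have hAc : ∀ {p : Space d → ℝ}, LocallyIntegrable p volume →
      Continuous (fun x => mollify b p ((1 - t) • x + t • x₀)) := fun hp =>
    (contDiff_mollify b hp).continuous.comp (by fun_prop)
  have hsplit : (f - fun x => mollify b f ((1 - t) • x + t • x₀)) =
      ((f - h) - fun x => mollify b (f - h) ((1 - t) • x + t • x₀)) +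
      (h - fun x => mollify b h ((1 - t) • x + t • x₀)) := by
    funext x
    simp only [Pi.sub_apply, Pi.add_apply, hsub]
    ring
  have hfh : StronglyMeasurable (f - h) := hf.sub hcont.stronglyMeasurable
  have hfar : eLpNorm ((f - h) - fun x => mollify b (f - h) ((1 - t) • x + t • x₀)) 2 volume
      ≤ ε / 2 := by
    refine (eLpNorm_sub_le hfh.aestronglyMeasurable
      (hAc (hLIf.sub hLI)).aestronglyMeasurable (by norm_num)).trans ?_
    calc _ ≤ eLpNorm (f - h) 2 volume + 2 ^ d * eLpNorm (f - h) 2 volume := by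
          gcongr
          exact eLpNorm_mollify_comp_le b hfh (by linarith) _
      _ = (1 + 2 ^ d) * eLpNorm (f - h) 2 volume := by ring
      _ ≤ (1 + 2 ^ d) * (ε / (2 * (1 + 2 ^ d))) := by gcongr
      _ = ε / 2 := by
          rw [ENNReal.div_eq_inv_mul, ENNReal.mul_inv (by simp) (by simp), ENNReal.div_eq_inv_mul]
          have h1 : (1 + 2 ^ d : ℝ≥0∞) * (1 + 2 ^ d)⁻¹ = 1 :=
            ENNReal.mul_inv_cancel (by simp) (by simp)
          calc _ = ((1 + 2 ^ d : ℝ≥0∞) * (1 + 2 ^ d)⁻¹) * (2⁻¹ * ε) := by ring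
            _ = _ := by rw [h1, one_mul]
  rw [hsplit]
  refine (eLpNorm_add_le (hfh.aestronglyMeasurable.sub
    (hAc (hLIf.sub hLI)).aestronglyMeasurable)
    (hcont.aestronglyMeasurable.sub (hAc hLI).aestronglyMeasurable) (by norm_num)).trans ?_
  calc _ ≤ ε / 2 + ε / 2 :=
        add_le_add ((eLpNorm_mono_measure _ Measure.restrict_le_self).trans hfar) hclose
    _ = ε := ENNReal.add_halves ε


/-- Contracting towards an interior point `x₀` before mollifying keeps the mollification balls
inside the open simplex. There the translated kernel is a test function, so the gradient of the
approximation is the smoothed weak gradient times `1 - t`. -/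
theorem IsCell.exists_smooth_approx (hK : IsCell K) {Ω : Set (Space d)}
    (hKΩ : interior (hull K) ⊆ Ω) {q : L2 Ω × (Fin d → L2 Ω)} (hq : q ∈ weakGradGraph Ω)
    (ε : ℝ≥0∞) (hε : 0 < ε) :
    ∃ φ : Space d → ℝ, ContDiff ℝ ∞ φ ∧
      eLpNorm ((q.1 : Space d → ℝ) - φ) 2 (volume.restrict (hull K)) ≤ ε ∧
      ∀ i, eLpNorm ((q.2 i : Space d → ℝ) - pd i φ) 2 (volume.restrict (hull K)) ≤ ε := by
  set U := interior (hull K) with hU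
  have hUo : IsOpen U := isOpen_interior
  have hconv : Convex ℝ (hull K) := convex_convexHull ℝ _
  have hmeas : ∀ u : L2 Ω, StronglyMeasurable (U.indicator u) := fun u =>
    (Lp.stronglyMeasurable u).indicator hUo.measurableSet
  have hmem : ∀ u : L2 Ω, MemLp (U.indicator u) 2 volume := fun u =>
    (memLp_indicator_iff_restrict hUo.measurableSet).2
      ((Lp.memLp u).mono_measure (Measure.restrict_mono hKΩ le_rfl))
  have hloc : ∀ u : L2 Ω, LocallyIntegrable (U.indicator u) volume := fun u =>
    (hmem u).locallyIntegrable (by norm_num)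
  have hae : ∀ u : L2 Ω, (u : Space d → ℝ) =ᵐ[volume.restrict (hull K)] U.indicator u := by
    intro u
    rw [← Measure.restrict_congr_set (interior_hull_ae_eq K)]
    exact (indicator_ae_eq_restrict hUo.measurableSet).symm
  obtain ⟨x₀, hx₀⟩ := hK.interior_nonempty
  obtain ⟨r, hr, hball⟩ := Metric.nhds_basis_closedBall.mem_iff.1 (hUo.mem_nhds hx₀)
  have hε2 : ε / 2 ≠ 0 := by simp [hε.ne']
  have hev : ∀ u : L2 Ω, ∀ᶠ t in 𝓝[>] (0 : ℝ), ∀ b : ContDiffBump (0 : Space d),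
      b.rOut ≤ t * r → eLpNorm (U.indicator u - fun x => mollify b (U.indicator u)
        ((1 - t) • x + t • x₀)) 2 (volume.restrict (hull K)) ≤ ε / 2 := by
    intro u
    obtain ⟨t₀, ht₀, h⟩ := exists_eLpNorm_sub_mollify_le (K := K) (hmeas u) (hmem u) x₀ hr
      (pos_iff_ne_zero.2 hε2)
    filter_upwards [Ioo_mem_nhdsGT ht₀] with t ht using h t ht.1 ht.2
  have hev2 : ∀ u : L2 Ω, ∀ᶠ t in 𝓝[>] (0 : ℝ),
      ENNReal.ofReal t * (2 ^ d * eLpNorm (U.indicator u) 2 volume) < ε / 2 := by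
    intro u
    have h1 : Tendsto (fun η : ℝ => ENNReal.ofReal η) (𝓝[>] 0) (𝓝 0) := by
      have := (ENNReal.continuous_ofReal.tendsto 0).mono_left
        (nhdsWithin_le_nhds (s := Set.Ioi (0 : ℝ)))
      simpa using this
    have h2 := ENNReal.Tendsto.mul_const (b := 2 ^ d * eLpNorm (U.indicator u) 2 volume) h1
      (Or.inr (ENNReal.mul_ne_top (by simp) (hmem u).2.ne))
    rw [zero_mul] at h2
    exact h2.eventually (gt_mem_nhds (pos_iff_ne_zero.2 hε2))
  obtain ⟨t, h0, h1, h2, ht⟩ := ((hev q.1).and ((eventually_all.2 fun i => hev (q.2 i)).and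
    ((eventually_all.2 fun i => hev2 (q.2 i)).and
      (Ioo_mem_nhdsGT (by norm_num : (0 : ℝ) < 1 / 2))))).exists
  have htpos : 0 < t := ht.1
  have ht2 : t < 1 / 2 := ht.2
  let b : ContDiffBump (0 : Space d) := ⟨t * r / 2, t * r, by positivity, by
    have : 0 < t * r := by positivity
    linarith⟩
  have hb : b.rOut = t * r := rfl
  have hcd : ContDiff ℝ ∞ (b.normed volume : Space d → ℝ) := b.contDiff_normed
  have hφ := contDiff_mollify b (hloc q.1)
  have hA : ContDiff ℝ ∞ fun x : Space d => (1 - t) • x + t • x₀ := by fun_prop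
  have hpd : ∀ i, ∀ x ∈ hull K, pd i (fun x => mollify b (U.indicator q.1) ((1 - t) • x + t • x₀)) x
      = (1 - t) * mollify b (U.indicator (q.2 i)) ((1 - t) • x + t • x₀) := by
    intro i x hx
    -- This ball equals `(1 - t) x + t B`, where `B` is the closed ball of radius `r` about `x₀`
    -- inside the interior, so convexity applies.
    have hin : Metric.closedBall ((1 - t) • x + t • x₀) (t * r) ⊆ U := by
      intro y hy
      have hy' : x₀ + t⁻¹ • (y - ((1 - t) • x + t • x₀)) ∈ U := by
        refine hball ?_
        rw [mem_closedBall_iff_norm, add_sub_cancel_left, norm_smul, norm_inv,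
          Real.norm_of_nonneg htpos.le, inv_mul_le_iff₀ htpos]
        exact mem_closedBall_iff_norm.1 hy
      have := hconv.combo_self_interior_mem_interior hx hy' (a := 1 - t) (b := t)
        (by linarith) htpos (by ring)
      rw [smul_add, smul_inv_smul₀ htpos.ne'] at this
      convert this using 1
      abel
    have hchain : pd i (fun x => mollify b (U.indicator q.1) ((1 - t) • x + t • x₀)) x
        = (1 - t) * pd i (mollify b (U.indicator q.1)) ((1 - t) • x + t • x₀) := by
      have e1 : HasFDerivAt (fun x : Space d => (1 - t) • x + t • x₀)
          ((1 - t) • ContinuousLinearMap.id ℝ (Space d)) x :=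
        ((hasFDerivAt_id x).const_smul (1 - t)).add_const _
      have e2 := ((hφ.differentiable (by simp)) ((1 - t) • x + t • x₀)).hasFDerivAt.comp x e1
      unfold pd
      rw [show fderiv ℝ (fun x => mollify b (U.indicator q.1) ((1 - t) • x + t • x₀)) x = _
        from e2.fderiv]
      simp
    rw [hchain, pd_mollify b (hloc q.1), mollify_eq]
    congr 1
    set c := (1 - t) • x + t • x₀ with hc
    have hψ : IsTest Ω fun y => b.normed volume (c - y) := by
      have hts : tsupport (fun y => b.normed volume (c - y)) ⊆ Metric.closedBall c (t * r) := by
        refine closure_minimal (fun y hy => ?_) Metric.isClosed_closedBall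
        have : c - y ∈ Function.support (b.normed volume : Space d → ℝ) := hy
        rw [b.support_normed_eq, mem_ball_zero_iff] at this
        rw [mem_closedBall_iff_norm']
        exact this.le
      refine ⟨hcd.comp (contDiff_const.sub contDiff_id), ?_, (hts.trans hin).trans hKΩ⟩
      exact HasCompactSupport.of_support_subset_isCompact (isCompact_closedBall c (t * r))
        ((subset_tsupport _).trans hts)
    have hzero : ∀ y, y ∉ U → b.normed volume (c - y) = 0 := by
      intro y hy
      by_contra hne
      have : c - y ∈ Function.support (b.normed volume : Space d → ℝ) := hne
      rw [b.support_normed_eq, mem_ball_zero_iff] at this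
      exact hy (hin (mem_closedBall_iff_norm'.2 this.le))
    have hpdψ : ∀ y, pd i (fun y => b.normed volume (c - y)) y
        = - pd i (b.normed volume) (c - y) := by
      intro y
      have e1 : HasFDerivAt (fun y : Space d => c - y)
          (-ContinuousLinearMap.id ℝ (Space d)) y := (hasFDerivAt_id y).const_sub c
      have e2 := ((hcd.differentiable (by simp)) (c - y)).hasFDerivAt.comp y e1
      unfold pd
      rw [show fderiv ℝ (fun y => b.normed volume (c - y)) y = _ from e2.fderiv]
      simp
    have hzero' : ∀ y, y ∉ U → pd i (b.normed volume) (c - y) = 0 := by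
      intro y hy
      by_contra hne
      have h3 : c - y ∈ tsupport (b.normed volume : Space d → ℝ) :=
        support_fderiv_subset ℝ (fun h => hne (by simp [pd, h]))
      rw [b.tsupport_normed_eq, mem_closedBall_zero_iff] at h3
      exact hy (hin (mem_closedBall_iff_norm'.2 h3))
    have hred : ∀ (u : L2 Ω) (p : Space d → ℝ), (∀ y, y ∉ U → p y = 0) →
        ∫ y, U.indicator u y * p y = ∫ y in Ω, u y * p y := by
      intro u p hp
      rw [setIntegral_eq_integral_of_forall_compl_eq_zero fun y hy => by
        rw [hp y fun h => hy (hKΩ h), mul_zero]]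
      refine integral_congr_ae (Eventually.of_forall fun y => ?_)
      by_cases hy : y ∈ U
      · simp [hy]
      · simp [hy, hp y hy]
    have := hq _ hψ i
    simp only [hpdψ, mul_neg, integral_neg, neg_inj] at this
    rw [hred _ _ hzero', hred _ _ hzero, this]
  refine ⟨fun x => mollify b (U.indicator q.1) ((1 - t) • x + t • x₀), hφ.comp hA, ?_,
    fun i => ?_⟩
  · rw [eLpNorm_congr_ae ((hae q.1).sub (ae_eq_refl _))]
    exact (h0 b hb.le).trans (ENNReal.half_le_self)
  · have hm : Continuous fun x => mollify b (U.indicator (q.2 i)) ((1 - t) • x + t • x₀) :=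
      (contDiff_mollify b (hloc _)).continuous.comp (by fun_prop)
    -- The chain rule factor `1 - t` is split off: the remainder is `t` times a function with
    -- bounded norm, which is small by `hev2`.
    have e : (q.2 i : Space d → ℝ) -
        pd i (fun x => mollify b (U.indicator q.1) ((1 - t) • x + t • x₀))
        =ᵐ[volume.restrict (hull K)] (U.indicator (q.2 i) - fun x =>
          mollify b (U.indicator (q.2 i)) ((1 - t) • x + t • x₀)) +
          t • fun x => mollify b (U.indicator (q.2 i)) ((1 - t) • x + t • x₀) := by
      filter_upwards [hae (q.2 i), ae_restrict_mem (isCompact_hull K).measurableSet] with x hx hxK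
      simp only [Pi.sub_apply, Pi.add_apply, Pi.smul_apply, hpd i x hxK, smul_eq_mul]
      rw [hx]
      ring
    rw [eLpNorm_congr_ae e]
    refine (eLpNorm_add_le ((hmeas _).aestronglyMeasurable.sub hm.aestronglyMeasurable)
      (hm.aestronglyMeasurable.const_smul t) (by norm_num)).trans ?_
    rw [eLpNorm_const_smul, Real.enorm_of_nonneg htpos.le]
    have h3 := (eLpNorm_mono_measure (μ := volume) (p := 2) (fun x =>
      mollify b (U.indicator (q.2 i)) ((1 - t) • x + t • x₀))
      (Measure.restrict_le_self (s := hull K))).trans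
      (eLpNorm_mollify_comp_le b (hmeas (q.2 i)) (c := 1 - t) (by linarith) (t • x₀))
    calc _ ≤ ε / 2 + ENNReal.ofReal t * (2 ^ d * eLpNorm (U.indicator (q.2 i)) 2 volume) :=
          add_le_add (h1 i b hb.le) (mul_le_mul_right h3 _)
      _ ≤ ε / 2 + ε / 2 := by gcongr; exact (h2 i).le
      _ = ε := ENNReal.add_halves ε

end

section

/-! ### Lipschitz functions in `H¹₀(Ω)` -/

open Filter Topology

variable {d : ℕ} {K : Finset (Space d)} {Ω : Set (Space d)}

/-- A bounded sequence in the second component can be replaced by a convergent one: if `M` contains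
pairs whose first components converge to `b` and whose second components remain bounded, then the
closure of `M` contains a pair with first component `b`. -/
theorem exists_mem_closure_of_bounded {B H : Type*} [NormedAddCommGroup B] [NormedSpace ℝ B]
    [NormedAddCommGroup H] [InnerProductSpace ℝ H] [CompleteSpace H] (M : Submodule ℝ (B × H))
    (b : B) (R : ℝ) (h : ∀ δ > 0, ∃ q ∈ M, ‖q.1 - b‖ ≤ δ ∧ ‖q.2‖ ≤ R) :
    ∃ p, (b, p) ∈ M.topologicalClosure := by
  -- A hands-on version of weak compactness: these nested convex sets collect the second components
  -- whose partners are close to `b`, and their elements of minimal norm will converge.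
  let D : ℕ → Set H := fun n => {p | ∃ x, (x, p) ∈ M ∧ ‖x - b‖ ≤ 1 / ((n : ℝ) + 1)}
  have hDanti : ∀ {m n : ℕ}, m ≤ n → D n ⊆ D m := by
    rintro m n hmn p ⟨x, hx, hxb⟩
    exact ⟨x, hx, hxb.trans (by gcongr)⟩
  have hDconv : ∀ n, Convex ℝ (D n) := by
    rintro n p ⟨x, hx, hxb⟩ q ⟨y, hy, hyb⟩ s t hs ht hst
    refine ⟨s • x + t • y, M.add_mem (M.smul_mem s hx) (M.smul_mem t hy), ?_⟩
    have e : s • x + t • y - b = s • (x - b) + t • (y - b) := by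
      have : b = s • b + t • b := by rw [← add_smul, hst, one_smul]
      conv_lhs => rw [this]
      simp only [smul_sub]; abel
    rw [e]
    refine (norm_add_le _ _).trans ?_
    rw [norm_smul, norm_smul, Real.norm_of_nonneg hs, Real.norm_of_nonneg ht]
    calc s * ‖x - b‖ + t * ‖y - b‖ ≤ s * (1 / ((n : ℝ) + 1)) + t * (1 / ((n : ℝ) + 1)) := by gcongr
      _ = _ := by rw [← add_mul, hst, one_mul]
  have hDne : ∀ n, ∃ p ∈ D n, ‖p‖ ≤ R := by
    intro n
    obtain ⟨q, hq, h1, h2⟩ := h (1 / ((n : ℝ) + 1)) (by positivity)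
    exact ⟨q.2, ⟨q.1, hq, h1⟩, h2⟩
  have hmin : ∀ n, ∃ p ∈ closure (D n), ∀ q ∈ closure (D n), ‖p‖ ≤ ‖q‖ := by
    intro n
    obtain ⟨p, hp, hpR⟩ := hDne n
    obtain ⟨v, hv, hv'⟩ := exists_norm_eq_iInf_of_complete_convex (K := closure (D n))
      ⟨p, subset_closure hp⟩ isClosed_closure.isComplete (hDconv n).closure 0
    refine ⟨v, hv, fun q hq => ?_⟩
    rw [zero_sub, norm_neg] at hv'
    rw [hv']
    have : BddBelow (Set.range fun w : closure (D n) => ‖(0 : H) - w‖) :=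
      ⟨0, by rintro _ ⟨w, rfl⟩; exact norm_nonneg _⟩
    simpa using ciInf_le this ⟨q, hq⟩
  choose p hp hpmin using hmin
  have hmono : Monotone fun n => ‖p n‖ := fun m n hmn =>
    hpmin m _ (closure_mono (hDanti hmn) (hp n))
  have hbdd : ∀ n, ‖p n‖ ≤ R := fun n => by
    obtain ⟨q, hq, hqR⟩ := hDne n
    exact (hpmin n q (subset_closure hq)).trans hqR
  -- The midpoint lies in the larger closed convex set, so its norm is at least `‖p m‖`; the
  -- parallelogram law bounds the distance by the growth of the monotone bounded norms.
  have hpar : ∀ {m n : ℕ}, m ≤ n → ‖p n - p m‖ ^ 2 ≤ 2 * (‖p n‖ ^ 2 - ‖p m‖ ^ 2) := by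
    intro m n hmn
    have hmid : (2⁻¹ : ℝ) • p n + (2⁻¹ : ℝ) • p m ∈ closure (D m) :=
      (hDconv m).closure (closure_mono (hDanti hmn) (hp n)) (hp m) (by norm_num) (by norm_num)
        (by norm_num)
    have h1 := hpmin m _ hmid
    rw [← smul_add, norm_smul] at h1
    norm_num at h1
    have h2 := parallelogram_law_with_norm ℝ (p n) (p m)
    nlinarith [norm_nonneg (p m)]
  have hconvn : ∃ l, Tendsto (fun n => ‖p n‖ ^ 2) atTop (𝓝 l) := by
    refine ⟨_, tendsto_atTop_ciSup (fun m n hmn => by gcongr; exact hmono hmn) ⟨R ^ 2, ?_⟩⟩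
    rintro _ ⟨n, rfl⟩
    exact pow_le_pow_left₀ (norm_nonneg _) (hbdd n) 2
  have hcau : CauchySeq p := by
    obtain ⟨l, hl⟩ := hconvn
    rw [Metric.cauchySeq_iff']
    intro ε hε
    obtain ⟨N, hN⟩ := Metric.cauchySeq_iff'.1 hl.cauchySeq (ε ^ 2 / 2) (by positivity)
    refine ⟨N, fun n hn => ?_⟩
    have h1 := hpar hn
    have h2 := (abs_lt.1 (hN n hn)).2
    rw [dist_eq_norm]
    refine lt_of_pow_lt_pow_left₀ 2 hε.le ?_
    linarith
  obtain ⟨P, hP⟩ := cauchySeq_tendsto_of_complete hcau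
  refine ⟨P, ?_⟩
  have hPD : ∀ n, P ∈ closure (D n) := fun n =>
    isClosed_closure.mem_of_tendsto hP (eventually_atTop.2
      ⟨n, fun m hm => closure_mono (hDanti hm) (hp m)⟩)
  rw [← SetLike.mem_coe, Submodule.topologicalClosure_coe, Metric.mem_closure_iff]
  intro ε hε
  obtain ⟨n, hn⟩ := exists_nat_one_div_lt hε
  obtain ⟨q, ⟨x, hx, hxb⟩, hq⟩ := Metric.mem_closure_iff.1 (hPD n) ε hε
  refine ⟨(x, q), hx, ?_⟩
  rw [Prod.dist_eq, max_lt_iff]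
  refine ⟨?_, hq⟩
  rw [dist_comm, dist_eq_norm]
  exact hxb.trans_lt hn

/-- A variant of `exists_mem_closure_of_bounded` for pairs of a function and its gradient. -/
theorem mem_H10_of_bounded (u : L2 Ω) (R : ℝ)
    (h : ∀ δ > 0, ∃ q ∈ testGraph Ω, ‖q.1 - u‖ ≤ δ ∧ ∀ i, ‖q.2 i‖ ≤ R) : u ∈ H10 Ω := by
  -- The plain product carries the supremum norm; the equivalent `ℓ²` norm provides the inner
  -- product needed for minimal elements.
  let e : (L2 Ω × (Fin d → L2 Ω)) ≃L[ℝ] (L2 Ω × PiLp 2 (fun _ : Fin d => L2 Ω)) :=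
    (ContinuousLinearEquiv.refl ℝ (L2 Ω)).prodCongr
      (PiLp.continuousLinearEquiv 2 ℝ (fun _ : Fin d => L2 Ω)).symm
  obtain ⟨p, hp⟩ := exists_mem_closure_of_bounded ((testGraph Ω).map e.toLinearMap) u
    (Real.sqrt (∑ _i : Fin d, R ^ 2)) (by
      intro δ hδ
      obtain ⟨q, hq, h1, h2⟩ := h δ hδ
      refine ⟨e q, Submodule.mem_map_of_mem hq, h1, ?_⟩
      rw [PiLp.norm_eq_of_L2]
      refine Real.sqrt_le_sqrt (Finset.sum_le_sum fun i _ => ?_)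
      exact pow_le_pow_left₀ (norm_nonneg _) (h2 i) 2)
  refine ⟨e.symm (u, p), ?_, rfl⟩
  refine map_mem_closure e.symm.continuous hp ?_
  rintro _ ⟨q, hq, rfl⟩
  rw [show e.symm (e.toLinearMap q) = q from e.symm_apply_apply q]
  exact hq

theorem IsTest.memLp {φ : Space d → ℝ} (h : IsTest Ω φ) : MemLp φ 2 (volume.restrict Ω) :=
  h.smooth.continuous.memLp_of_hasCompactSupport h.compact

theorem IsTest.memLp_pd {φ : Space d → ℝ} (h : IsTest Ω φ) (i : Fin d) :
    MemLp (pd i φ) 2 (volume.restrict Ω) :=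
  (continuous_pd i h.smooth).memLp_of_hasCompactSupport (h.compact_pd i)

theorem IsTest.mem_testGraph {φ : Space d → ℝ} (h : IsTest Ω φ) :
    (h.memLp.toLp φ, fun i => (h.memLp_pd i).toLp (pd i φ)) ∈ testGraph Ω :=
  ⟨φ, h, h.memLp.coeFn_toLp, fun i => (h.memLp_pd i).coeFn_toLp⟩

/-- An average of translates over a probability measure does not increase the Lipschitz constant. -/
theorem lipschitzWith_mollify (b : ContDiffBump (0 : Space d)) {f : Space d → ℝ} {L : NNReal}
    (hf : LipschitzWith L f) (hfc : HasCompactSupport f) : LipschitzWith L (mollify b f) := by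
  refine LipschitzWith.of_dist_le_mul fun x y => ?_
  have hint : ∀ x, Integrable (fun s => f (x - s)) (bumpMeasure b) := by
    intro x
    obtain ⟨C, hC⟩ := hfc.exists_bound_of_continuous hf.continuous
    exact Integrable.of_bound (C := C)
      (hf.continuous.comp (by fun_prop)).aestronglyMeasurable (Eventually.of_forall fun s => hC _)
  rw [mollify_eq_integral_bumpMeasure, mollify_eq_integral_bumpMeasure, dist_eq_norm,
    ← integral_sub (hint x) (hint y)]
  refine (norm_integral_le_of_norm_le_const (μ := bumpMeasure b) (C := L * dist x y)
    (Eventually.of_forall fun s => ?_)).trans ?_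
  · have := hf.dist_le_mul (x - s) (y - s)
    rwa [dist_sub_right, dist_eq_norm] at this
  · simp

/-- A Lipschitz function that vanishes outside of `Ω` is uniformly close to test functions with the
same Lipschitz constant. -/
theorem exists_isTest_of_lipschitz (hΩ : IsOpen Ω) (hb : Bornology.IsBounded Ω)
    {v : Space d → ℝ} {L : NNReal} (hv : LipschitzWith L v) (hv0 : ∀ x, x ∉ Ω → v x = 0)
    {ε : ℝ} (hε : 0 < ε) :
    ∃ φ, IsTest Ω φ ∧ LipschitzWith L φ ∧ ∀ x, |φ x - v x| ≤ 2 * ε := by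
  -- Soft thresholding: it is `1`-Lipschitz, moves values by at most `ε`, and removes values below
  -- `ε`, so that `c ∘ v` has compact support in `Ω`.
  let c : ℝ → ℝ := fun s => s - max (-ε) (min s ε)
  have hcl : LipschitzWith 1 c := by
    refine LipschitzWith.of_dist_le_mul fun s t => ?_
    simp only [c, Real.dist_eq, NNReal.coe_one, one_mul]
    rcases le_total s t with h | h <;> rcases le_total s ε with h1 | h1 <;>
      rcases le_total t ε with h2 | h2 <;> rcases le_total s (-ε) with h3 | h3 <;>
      rcases le_total t (-ε) with h4 | h4 <;>
      simp only [min_eq_left, min_eq_right, max_eq_left, max_eq_right, h1, h2, h3, h4,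
        (by linarith : -ε ≤ ε)] <;>
      rw [abs_sub_le_iff] <;> constructor <;>
      linarith [le_abs_self (s - t), neg_abs_le (s - t)]
  have hc0 : ∀ s, |s| ≤ ε → c s = 0 := by
    intro s hs
    obtain ⟨h1, h2⟩ := abs_le.1 hs
    simp [c, min_eq_left h2, max_eq_right h1]
  have hcs : ∀ s, |c s - s| ≤ ε := by
    intro s
    have h1 : -ε ≤ max (-ε) (min s ε) := le_max_left _ _
    have h2 : max (-ε) (min s ε) ≤ ε := max_le (by linarith) (min_le_right _ _)
    rw [abs_le]
    constructor <;> simp only [c] <;> linarith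
  have hw : LipschitzWith L (c ∘ v) := by simpa using hcl.comp hv
  have hcb : IsCompact (closure Ω) := hb.isCompact_closure
  have hts : tsupport (c ∘ v) ⊆ {x | ε ≤ |v x|} := by
    refine closure_minimal (fun x hx => ?_) (isClosed_le continuous_const hv.continuous.abs)
    by_contra hne
    exact hx (hc0 _ (not_le.1 hne).le)
  have htsΩ : tsupport (c ∘ v) ⊆ Ω := fun x hx => by
    by_contra hne
    have := hts hx
    simp only [Set.mem_ofPred_eq, hv0 x hne, abs_zero] at this
    linarith
  have hcomp : HasCompactSupport (c ∘ v) :=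
    HasCompactSupport.of_support_subset_isCompact hcb
      ((subset_tsupport _).trans (htsΩ.trans subset_closure))
  obtain ⟨δ, hδ, hδΩ⟩ := hcomp.exists_cthickening_subset_open hΩ htsΩ
  -- The radius keeps the mollified support inside `Ω` and, by the Lipschitz bound, limits the
  -- change of values to `ε`.
  obtain ⟨η, hη, hηδ, hηL⟩ : ∃ η : ℝ, 0 < η ∧ η ≤ δ ∧ L * η ≤ ε := by
    refine ⟨min δ (ε / (L + 1)), by positivity, min_le_left _ _, ?_⟩
    calc (L : ℝ) * min δ (ε / (L + 1)) ≤ (L + 1) * (ε / (L + 1)) := by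
          gcongr
          · linarith
          · exact min_le_right _ _
      _ = ε := by field_simp
  let b : ContDiffBump (0 : Space d) := ⟨η / 2, η, by positivity, by linarith⟩
  have hmsupp : tsupport (mollify b (c ∘ v)) ⊆ Metric.cthickening η (tsupport (c ∘ v)) := by
    refine closure_minimal (fun x hx => ?_) Metric.isClosed_cthickening
    by_contra hne
    refine hx ?_
    rw [mollify_eq]
    refine integral_eq_zero_of_ae (Eventually.of_forall fun y => ?_)
    by_cases hy : y ∈ tsupport (c ∘ v)
    · have hd : η < dist x y := by
        by_contra hle
        exact hne (Metric.mem_cthickening_of_dist_le x y η _ hy (not_lt.1 hle))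
      have : b.normed volume (x - y) = 0 := by
        by_contra h0
        have h1 : x - y ∈ Function.support (b.normed volume : Space d → ℝ) := h0
        rw [b.support_normed_eq, mem_ball_zero_iff, ← dist_eq_norm] at h1
        exact absurd (h1 : dist x y < η) hd.le.not_gt
      simp [this]
    · have : c (v y) = 0 := image_eq_zero_of_notMem_tsupport (f := c ∘ v) hy
      simp [this]
  refine ⟨mollify b (c ∘ v), ⟨contDiff_mollify b hw.continuous.locallyIntegrable, ?_, ?_⟩,
    lipschitzWith_mollify b hw hcomp, fun x => ?_⟩
  · exact HasCompactSupport.of_support_subset_isCompact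
      (hcomp.isCompact.cthickening) ((subset_tsupport _).trans hmsupp)
  · exact hmsupp.trans ((Metric.cthickening_mono hηδ _).trans hδΩ)
  · have h1 : dist (mollify b (c ∘ v) x) ((c ∘ v) x) ≤ ε := by
      refine b.dist_normed_convolution_le hw.continuous.aestronglyMeasurable fun y hy => ?_
      refine (hw.dist_le_mul _ _).trans (le_trans ?_ hηL)
      gcongr
      exact (Metric.mem_ball.1 hy).le
    have h2 := hcs (v x)
    rw [Real.dist_eq] at h1
    calc _ = |(mollify b (c ∘ v) x - (c ∘ v) x) + (c (v x) - v x)| := by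
          congr 1; simp
      _ ≤ _ := (abs_add_le _ _).trans (by linarith)

/-- A Lipschitz function that vanishes outside of the bounded open set `Ω` is in `H¹₀(Ω)`. -/
theorem mem_H10_of_lipschitz (hΩ : IsOpen Ω) (hb : Bornology.IsBounded Ω) {u : L2 Ω}
    {v : Space d → ℝ} {L : NNReal} (hv : LipschitzWith L v) (hv0 : ∀ x, x ∉ Ω → v x = 0)
    (huv : u =ᵐ[volume.restrict Ω] v) : u ∈ H10 Ω := by
  have hfin : IsFiniteMeasure (volume.restrict Ω) :=
    isFiniteMeasure_restrict.2 hb.measure_lt_top.ne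
  set m : ℝ := (measureUnivNNReal (volume.restrict Ω) : ℝ) ^ ((2 : ℝ≥0∞).toReal)⁻¹ with hm
  have hm0 : 0 ≤ m := by positivity
  refine mem_H10_of_bounded u (m * L) fun δ hδ => ?_
  -- The test functions approximate `v` uniformly, while their gradients are merely bounded by `L`;
  -- this is all that `mem_H10_of_bounded` requires.
  obtain ⟨φ, hφ, hφL, hφv⟩ := exists_isTest_of_lipschitz hΩ hb hv hv0
    (ε := δ / (2 * (m + 1))) (by positivity)
  refine ⟨_, hφ.mem_testGraph, ?_, fun i => ?_⟩
  · refine (Lp.norm_le_of_ae_bound (C := 2 * (δ / (2 * (m + 1)))) (by positivity) ?_).trans ?_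
    · filter_upwards [Lp.coeFn_sub (hφ.memLp.toLp φ) u, hφ.memLp.coeFn_toLp, huv] with x h1 h2 h3
      rw [h1, Pi.sub_apply, h2, h3]
      exact hφv x
    · rw [← hm]
      calc m * (2 * (δ / (2 * (m + 1)))) = δ * (m / (m + 1)) := by field_simp
        _ ≤ δ * 1 := by gcongr; exact (div_le_one (by positivity)).2 (by linarith)
        _ = δ := mul_one δ
  · refine (Lp.norm_le_of_ae_bound (C := L) (by positivity) ?_).trans le_rfl
    · filter_upwards [(hφ.memLp_pd i).coeFn_toLp] with x h1
      rw [h1]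
      refine (ContinuousLinearMap.le_opNorm _ _).trans ?_
      simpa using norm_fderiv_le_of_lipschitz ℝ hφL (x₀ := x)

/-- The estimate is propagated along the segment between two points: the parameters up to which it
holds form a closed set that can always be prolonged inside one piece of the cover. -/
theorem lipschitzWith_of_closed_cover {E : Type*} [NormedAddCommGroup E] [NormedSpace ℝ E]
    {ι : Type*} [Finite ι] {C : ι → Set E} (hC : ∀ i, IsClosed (C i)) (hcov : ⋃ i, C i = Set.univ)
    {f : E → ℝ} {L : NNReal} (hf : ∀ i, LipschitzOnWith L f (C i)) : LipschitzWith L f := by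
  have hcont : Continuous f := (locallyFinite_of_finite C).continuous hcov hC
    fun i => (hf i).continuousOn
  refine LipschitzWith.of_dist_le_mul fun x y => ?_
  let γ : ℝ → E := fun s => x + s • (y - x)
  have hγ : Continuous γ := by fun_prop
  have hγd : ∀ s t, dist (γ s) (γ t) = |s - t| * dist x y := by
    intro s t
    rw [dist_eq_norm, dist_eq_norm' x y, show γ s - γ t = (s - t) • (y - x) by
      simp only [γ]; module, norm_smul, Real.norm_eq_abs]
  let S : Set ℝ := {t | dist (f (γ t)) (f (γ 0)) ≤ L * dist x y * t}
  have hS : IsClosed S := isClosed_le (by fun_prop) (by fun_prop)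
  have h01 : Set.Icc (0 : ℝ) 1 ⊆ S := by
    refine (hS.inter isClosed_Icc).Icc_subset_of_forall_exists_gt (by simp [S]) ?_
    rintro t ⟨htS, ht⟩ y' hy'
    -- With finitely many pieces, one of them is met at parameters arbitrarily close above `t`;
    -- being closed, it also contains `γ t`.
    have hex : ∃ i, ∃ᶠ s in 𝓝[>] t, γ s ∈ C i := by
      by_contra hne
      push Not at hne
      obtain ⟨s, hs⟩ := (eventually_all.2 hne).exists
      have : γ s ∈ ⋃ i, C i := hcov ▸ Set.mem_univ _
      obtain ⟨i, hi⟩ := Set.mem_iUnion.1 this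
      exact hs i hi
    obtain ⟨i, hi⟩ := hex
    have hti : γ t ∈ C i := (hC i).mem_of_frequently_of_tendsto hi
      ((hγ.tendsto t).mono_left nhdsWithin_le_nhds)
    obtain ⟨s, hs, hsI⟩ := (hi.and_eventually (Ioc_mem_nhdsGT hy')).exists
    refine ⟨s, ?_, hsI⟩
    have h1 := (hf i).dist_le_mul _ hs _ hti
    rw [hγd, abs_of_pos (sub_pos.2 hsI.1)] at h1
    have h2 : dist (f (γ t)) (f (γ 0)) ≤ L * dist x y * t := htS
    show dist (f (γ s)) (f (γ 0)) ≤ L * dist x y * s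
    linarith [dist_triangle (f (γ s)) (f (γ t)) (f (γ 0))]
  have h1 : dist (f (γ 1)) (f (γ 0)) ≤ L * dist x y * 1 := h01 (by simp)
  rw [dist_comm]
  simpa [γ] using h1

end

section

/-! ### Piecewise polynomial functions -/

open Filter Topology

namespace Mesh

variable {d : ℕ} {Ω : Set (Space d)} (T : Mesh Ω) {K K' F τ σ : Finset (Space d)}

/-- `u` coincides with `p K` on each simplex `K`. -/
def IsRepr (u : L2 Ω) (p : Finset (Space d) → Space d → ℝ) : Prop :=
  ∀ K ∈ T.cells, (u : Space d → ℝ) =ᵐ[volume.restrict (hull K)] p K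

theorem restrict_hull_le (hreg : interior (closure Ω) = Ω) (hK : K ∈ T.cells) :
    (volume : Measure (Space d)).restrict (hull K) ≤ volume.restrict Ω := by
  rw [← Measure.restrict_congr_set (interior_hull_ae_eq K)]
  exact Measure.restrict_mono (T.interior_hull_subset hreg hK) le_rfl

theorem ae_hull (hreg : interior (closure Ω) = Ω) (hK : K ∈ T.cells) {P : Space d → Prop}
    (h : ∀ᵐ x ∂(volume.restrict Ω), P x) : ∀ᵐ x ∂(volume.restrict (hull K)), P x :=
  ae_mono (T.restrict_hull_le hreg hK) h

theorem ae_of_cells {P : Space d → Prop}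
    (h : ∀ K ∈ T.cells, ∀ᵐ x ∂(volume.restrict (hull K)), P x) :
    ∀ᵐ x ∂(volume.restrict Ω), P x := by
  have hsub : Ω ⊆ ⋃ K ∈ T.cells, hull K := fun x hx => by
    obtain ⟨K, hK, hxK⟩ := T.mem_closure_iff.1 (subset_closure hx)
    exact Set.mem_biUnion hK hxK
  refine ae_mono (Measure.restrict_mono hsub le_rfl) ?_
  exact (ae_restrict_biUnion_finset_iff _ _ _).2 h

theorem IsRepr.ext {T : Mesh Ω} {u v : L2 Ω} {p q : Finset (Space d) → Space d → ℝ}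
    (hu : T.IsRepr u p) (hv : T.IsRepr v q)
    (h : ∀ K ∈ T.cells, ∀ x ∈ hull K, p K x = q K x) : u = v := by
  refine Lp.ext (T.ae_of_cells fun K hK => ?_)
  filter_upwards [hu K hK, hv K hK, ae_restrict_mem (isCompact_hull K).measurableSet]
    with x h1 h2 h3
  rw [h1, h2, h K hK x h3]

theorem IsRepr.add {T : Mesh Ω} (hreg : interior (closure Ω) = Ω) {u v : L2 Ω}
    {p q : Finset (Space d) → Space d → ℝ} (hu : T.IsRepr u p) (hv : T.IsRepr v q) :
    T.IsRepr (u + v) fun K => p K + q K := fun K hK =>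
  EventuallyEq.trans (T.ae_hull hreg hK (Lp.coeFn_add u v)) ((hu K hK).add (hv K hK))

theorem IsRepr.smul {T : Mesh Ω} (hreg : interior (closure Ω) = Ω) {u : L2 Ω} (c : ℝ)
    {p : Finset (Space d) → Space d → ℝ} (hu : T.IsRepr u p) :
    T.IsRepr (c • u) fun K => c • p K := fun K hK =>
  EventuallyEq.trans (T.ae_hull hreg hK (Lp.coeFn_smul c u)) ((hu K hK).const_smul c)

theorem isRepr_zero (hreg : interior (closure Ω) = Ω) : T.IsRepr 0 fun _ => 0 := fun _ hK =>
  T.ae_hull hreg hK (Lp.coeFn_zero ℝ 2 (volume.restrict Ω))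

theorem isRepr_sum (hreg : interior (closure Ω) = Ω) {ι : Type*} (s : Finset ι) (c : ι → ℝ)
    {u : ι → L2 Ω} {p : ι → Finset (Space d) → Space d → ℝ}
    (h : ∀ i ∈ s, T.IsRepr (u i) (p i)) :
    T.IsRepr (∑ i ∈ s, c i • u i) fun K x => ∑ i ∈ s, c i * p i K x := by
  induction s using Finset.induction_on with
  | empty =>
    simp only [Finset.sum_empty]
    exact T.isRepr_zero hreg
  | insert i s hi ih =>
    simp only [Finset.sum_insert hi]
    exact ((h i (Finset.mem_insert_self i s)).smul hreg (c i)).add hreg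
      (ih fun j hj => h j (Finset.mem_insert_of_mem hj))

theorem isRepr_glue (hreg : interior (closure Ω) = Ω) {p : Finset (Space d) → Space d → ℝ}
    (hp : ∀ K, Continuous (p K)) : T.IsRepr (T.glue p hp) p := by
  intro K hK
  refine EventuallyEq.trans (T.ae_hull hreg hK (T.memLp_glueFun hp).coeFn_toLp) ?_
  rw [← Measure.restrict_congr_set (interior_hull_ae_eq K)]
  refine ae_restrict_of_forall_mem isOpen_interior.measurableSet fun x hx => ?_
  unfold glueFun
  rw [Finset.sum_eq_single_of_mem K hK, Set.indicator_of_mem hx]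
  intro K' hK' hne
  exact Set.indicator_of_notMem (fun h => hne (T.eq_of_mem_interior hK' hK h
    (interior_subset hx))) _

theorem exists_continuousOn_glue {p : Finset (Space d) → Space d → ℝ} (hp : ∀ K, Continuous (p K))
    (h : ∀ K ∈ T.cells, ∀ K' ∈ T.cells, ∀ x ∈ hull K, x ∈ hull K' → p K x = p K' x) :
    ∃ v : Space d → ℝ, ContinuousOn v (closure Ω) ∧ (∀ K ∈ T.cells, Set.EqOn v (p K) (hull K)) ∧
      ∀ x, x ∉ closure Ω → v x = 0 := by
  let v : Space d → ℝ := fun x => if hx : ∃ K ∈ T.cells, x ∈ hull K then p hx.choose x else 0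
  have hv : ∀ K ∈ T.cells, Set.EqOn v (p K) (hull K) := by
    intro K hK x hx
    have hex : ∃ K ∈ T.cells, x ∈ hull K := ⟨K, hK, hx⟩
    simp only [v, dif_pos hex]
    exact h _ hex.choose_spec.1 K hK x hex.choose_spec.2 hx
  refine ⟨v, ?_, hv, fun x hx => dif_neg fun hex => hx (T.mem_closure_iff.2 hex)⟩
  have hcl : closure Ω = ⋃ K : T.cells, hull (K : Finset (Space d)) := by
    ext x
    simp [T.mem_closure_iff]
  rw [hcl]
  exact (locallyFinite_of_finite _).continuousOn_iUnion (fun K => (isCompact_hull _).isClosed)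
    fun K => (hp K).continuousOn.congr (hv K K.2)

theorem IsRepr.mem_conformingSpace {T : Mesh Ω} {u : L2 Ω} {p : Finset (Space d) → Space d → ℝ}
    (hu : T.IsRepr u p) {k : ℕ} (hp : ∀ K, Continuous (p K))
    (hpoly : ∀ K ∈ T.cells, p K ∈ polySpace d k)
    (h : ∀ K ∈ T.cells, ∀ K' ∈ T.cells, ∀ x ∈ hull K, x ∈ hull K' → p K x = p K' x) :
    u ∈ T.conformingSpace k := by
  obtain ⟨v, hv, hvp, -⟩ := T.exists_continuousOn_glue hp h
  refine ⟨v, hv, fun K hK => ?_, T.ae_of_cells fun K hK => ?_⟩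
  · obtain ⟨q, hq, hpq⟩ := mem_polySpace.1 (hpoly K hK)
    exact ⟨q, hq, fun x hx => by rw [hvp K hK hx, hpq]⟩
  · filter_upwards [hu K hK, ae_restrict_mem (isCompact_hull K).measurableSet] with x h1 h2
    rw [h1, hvp K hK h2]

theorem isBounded (T : Mesh Ω) : Bornology.IsBounded Ω := by
  have hc : Bornology.IsBounded (⋃ K ∈ T.cells, hull K) :=
    (T.cells.isCompact_biUnion fun K _ => isCompact_hull K).isBounded
  refine hc.subset fun x hx => ?_
  obtain ⟨K, hK, hxK⟩ := T.mem_closure_iff.1 (subset_closure hx)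
  exact Set.mem_biUnion hK hxK

/-- The continuous function glued from the pieces, extended by zero, is Lipschitz on each simplex
and on the complement of `Ω`, hence Lipschitz everywhere. -/
theorem IsRepr.mem_H10 {T : Mesh Ω} (hΩ : IsOpen Ω) {u : L2 Ω}
    {p : Finset (Space d) → Space d → ℝ} (hu : T.IsRepr u p) {k : ℕ}
    (hpoly : ∀ K, p K ∈ polySpace d k)
    (h : ∀ K ∈ T.cells, ∀ K' ∈ T.cells, ∀ x ∈ hull K, x ∈ hull K' → p K x = p K' x)
    (h0 : ∀ K ∈ T.cells, ∀ x ∈ hull K, x ∈ frontier Ω → p K x = 0) : u ∈ H10 Ω := by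
  have hp : ∀ K, ContDiff ℝ ∞ (p K) := fun K => contDiff_of_mem_polySpace (hpoly K)
  obtain ⟨v, hv, hvp, hv0⟩ := T.exists_continuousOn_glue (fun K => (hp K).continuous) h
  have hvΩ : ∀ x, x ∉ Ω → v x = 0 := by
    intro x hx
    by_cases hxc : x ∈ closure Ω
    · obtain ⟨K, hK, hxK⟩ := T.mem_closure_iff.1 hxc
      rw [hvp K hK hxK, h0 K hK x hxK (T.mem_frontier hΩ hK hxK hx)]
    · exact hv0 x hxc
  have hLK : ∀ K : Finset (Space d), ∃ L : NNReal, LipschitzOnWith L (p K) (hull K) := by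
    intro K
    obtain ⟨C, hC⟩ := (isCompact_hull K).exists_bound_of_continuousOn
      ((hp K).continuous_fderiv (by simp)).continuousOn
    refine ⟨C.toNNReal, (convex_convexHull ℝ _).lipschitzOnWith_of_nnnorm_fderiv_le
      (fun x _ => ((hp K).differentiable (by simp)) x) fun x hx => ?_⟩
    rw [← NNReal.coe_le_coe, coe_nnnorm]
    exact (hC x hx).trans (Real.le_coe_toNNReal C)
  choose L hL using hLK
  have hlip : LipschitzWith (T.cells.sup L) v := by
    refine lipschitzWith_of_closed_cover (ι := Option T.cells)
      (C := fun o => o.elim Ωᶜ fun K => hull (K : Finset (Space d))) ?_ ?_ ?_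
    · rintro (_ | K)
      · exact hΩ.isClosed_compl
      · exact (isCompact_hull _).isClosed
    · refine Set.eq_univ_of_forall fun x => Set.mem_iUnion.2 ?_
      by_cases hx : x ∈ Ω
      · obtain ⟨K, hK, hxK⟩ := T.mem_closure_iff.1 (subset_closure hx)
        exact ⟨some ⟨K, hK⟩, hxK⟩
      · exact ⟨none, hx⟩
    · rintro (_ | K) x hx y hy
      · rw [hvΩ x hx, hvΩ y hy, edist_self]; exact zero_le
      · rw [hvp K K.2 hx, hvp K K.2 hy]
        refine (hL K hx hy).trans ?_
        gcongr
        exact Finset.le_sup (f := L) K.2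
  refine mem_H10_of_lipschitz hΩ T.isBounded hlip hvΩ (T.ae_of_cells fun K hK => ?_)
  filter_upwards [hu K hK, ae_restrict_mem (isCompact_hull K).measurableSet] with x h1 h2
  rw [h1, hvp K hK h2]

/-! ### The basis functions -/

/-- If only one of two simplices contains the face, some vertex of the face is not shared. Its
coordinate vanishes at common points, so the bubble matches the zero on the other side. -/
theorem facePiece_eq_of_mem (A : Numbering d) (I : Idx d) (hK : K ∈ T.cells) (hK' : K' ∈ T.cells)
    {x : Space d} (hx : x ∈ hull K) (hx' : x ∈ hull K') :
    facePiece A I K x = facePiece A I K' x := by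
  have key : ∀ {K K'}, K ∈ T.cells → K' ∈ T.cells → x ∈ hull K → x ∈ hull K' → I.1 ⊆ K →
      ¬ I.1 ⊆ K' → facePiece A I K x = facePiece A I K' x := by
    intro K K' hK hK' hx hx' h h'
    obtain ⟨z, hz, hz'⟩ := Finset.not_subset.1 h'
    rw [facePiece_eq_zero A hz (by
      by_contra hne
      exact hz' (T.mem_of_bary_ne_zero hK hK' hx hx' (h hz) hne)), facePiece, if_neg h']
  by_cases h : I.1 ⊆ K <;> by_cases h' : I.1 ⊆ K'
  · simp only [facePiece, if_pos h, if_pos h', T.bary_eq hK hK' hx hx']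
  · exact key hK hK' hx hx' h h'
  · exact (key hK' hK hx' hx h' h).symm
  · simp only [facePiece, if_neg h, if_neg h']

theorem mem_idx_iff {k : ℕ} {I : Idx d} : I ∈ T.idx k ↔
    I.1 ∈ T.faces ∧ (2 ≤ I.1.card ∧ I.1.card ≤ k) ∧ I.2 ∈ multiIdx (I.1.card - 1) (k - I.1.card) := by
  simp only [idx, Finset.mem_sigma, Finset.mem_filter]
  tauto

theorem mem_localIdx_of_mem_idx {k : ℕ} {I : Idx d} (hI : I ∈ T.idx k) (h : I.1 ⊆ σ) :
    I ∈ localIdx k σ :=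
  mem_localIdx.2 ⟨h, (T.mem_idx_iff.1 hI).2⟩

theorem mem_idx_of_mem_localIdx {k : ℕ} {I : Idx d} (hσ : σ ∈ T.faces) (hI : I ∈ localIdx k σ) :
    I ∈ T.idx k := by
  obtain ⟨h1, h2, h3⟩ := mem_localIdx.1 hI
  exact T.mem_idx_iff.2 ⟨T.mem_faces_of_subset hσ h1 (Finset.card_pos.1 (by omega)), h2, h3⟩

theorem facePiece_mem (A : Numbering d) {k : ℕ} {I : Idx d} (hI : I ∈ T.idx k)
    (K : Finset (Space d)) : facePiece A I K ∈ polySpace d k :=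
  facePiece_mem_polySpace A (T.mem_localIdx_of_mem_idx hI subset_rfl) K

theorem facetPiece_mem (k : ℕ) (hF : F ∈ T.facets) (hK : K ∈ T.cells) :
    facetPiece k F K ∈ polySpace d k := by
  by_cases h : F ⊆ K
  · obtain ⟨z, hz, rfl⟩ := T.facet_eq_erase hK hF h
    exact facetPiece_erase_mem_polySpace hz k
  · have : facetPiece k F K = 0 := by funext x; simp [facetPiece, h]
    rw [this]; exact Submodule.zero_mem _

theorem isRepr_faceFun (hreg : interior (closure Ω) = Ω) (A : Numbering d) (I : Idx d) :
    T.IsRepr (T.faceFun A I) (facePiece A I) := T.isRepr_glue hreg _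

theorem isRepr_facetFun (hreg : interior (closure Ω) = Ω) (k : ℕ) (F : Finset (Space d)) :
    T.IsRepr (T.facetFun k F) (facetPiece k F) := T.isRepr_glue hreg _

theorem faceFun_mem_conformingSpace (hreg : interior (closure Ω) = Ω) (A : Numbering d) {k : ℕ}
    {I : Idx d} (hI : I ∈ T.idx k) : T.faceFun A I ∈ T.conformingSpace k :=
  (T.isRepr_faceFun hreg A I).mem_conformingSpace (continuous_facePiece A I)
    (fun K _ => T.facePiece_mem A hI K)
    fun _ hK _ hK' _ hx hx' => T.facePiece_eq_of_mem A I hK hK' hx hx'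

theorem faceFun_mem_H10 (hΩ : IsOpen Ω) (hreg : interior (closure Ω) = Ω) (A : Numbering d) {k : ℕ}
    {I : Idx d} (hI : I ∈ T.innerIdx k) : T.faceFun A I ∈ H10 Ω := by
  obtain ⟨hI, hin⟩ := Finset.mem_filter.1 hI
  exact (T.isRepr_faceFun hreg A I).mem_H10 hΩ (T.facePiece_mem A hI)
    (fun _ hK _ hK' _ hx hx' => T.facePiece_eq_of_mem A I hK hK' hx hx')
    fun _ hK _ hx hxΩ => T.facePiece_eq_zero_of_mem_frontier hΩ hreg A hin hK hx hxΩ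

/-! ### Expansion of finite element functions in the basis -/

/-- The coefficients of a sum of shape functions on `K` with respect to the facet functions. -/
theorem _root_.CrouzeixRaviart.IsCell.facet_coeff (hd : 2 ≤ d) (hK : IsCell K) (A : Numbering d)
    {k : ℕ} (hk : Odd k) {f : Space d → ℝ} {c : Idx d → ℝ} {e : Space d → ℝ}
    (h : ∀ x, f x = ∑ I ∈ localIdx k K, c I * facePiece A I K x +
      ∑ z ∈ K, e z * facetPiece k (K.erase z) K x) {z : Space d} (hz : z ∈ K) :
    e z = (vertexScale d k)⁻¹ * ∑ y ∈ K.erase z, f y := by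
  have hd0 : (d : ℝ) ≠ 0 := by positivity
  have hs := vertexScale_pos d k
  -- The vertex matrix is inverted explicitly. The result involves only the values on the facet
  -- opposite to `z`, so neighbouring simplices assign the same coefficient to a common facet.
  have hv : ∀ y ∈ K, f y = vertexScale d k / d * (∑ z ∈ K, e z - d * e y) := by
    intro y hy
    rw [h y, Finset.sum_eq_zero (s := localIdx k K) fun I hI => by
      rw [hK.facePiece_vertex A (mem_localIdx.1 hI).2.1.1 hy, mul_zero], zero_add,
      Finset.sum_congr rfl fun z hz => by rw [hK.facetPiece_vertex hd hk hz hy]]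
    rw [mul_sub, Finset.mul_sum]
    have : ∀ z ∈ K, e z * (vertexScale d k / d * (1 - if y = z then (d : ℝ) else 0)) =
        vertexScale d k / d * e z - if y = z then vertexScale d k / d * (d * e z) else 0 := by
      intro z _
      split_ifs <;> ring
    rw [Finset.sum_congr rfl this, Finset.sum_sub_distrib, Finset.sum_ite_eq, if_pos hy]
  have hsum : ∑ y ∈ K, f y = vertexScale d k / d * ∑ z ∈ K, e z := by
    rw [Finset.sum_congr rfl hv, ← Finset.mul_sum, Finset.sum_sub_distrib, Finset.sum_const,
      hK.card_eq, ← Finset.mul_sum, nsmul_eq_mul]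
    push_cast
    ring
  rw [← Finset.add_sum_erase K f hz, hv z hz] at hsum
  rw [show ∑ y ∈ K.erase z, f y = vertexScale d k * e z by
    have : vertexScale d k / d * (d * e z) = vertexScale d k * e z := by field_simp
    linarith]
  field_simp

/-- The `d` copies of `B_k^{CR,K}` cancel all Jacobi terms but that of `y`. The sum is a function of
`λ_{K,y}` alone, and therefore continuous across simplices. -/
theorem _root_.CrouzeixRaviart.IsCell.sum_erase_facetPiece (hd : 2 ≤ d) (hK : IsCell K)
    {y : Space d} (hy : y ∈ K) (k : ℕ) (x : Space d) :
    ∑ z ∈ K.erase y, facetPiece k (K.erase z) K x = 1 - jacobi 0 (d - 2) k (1 - 2 * bary K y x) := by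
  have hd0 : (d : ℝ) ≠ 0 := by positivity
  rw [Finset.sum_congr rfl fun z hz => facetPiece_erase (Finset.mem_of_mem_erase hz) k x,
    Finset.sum_sub_distrib, Finset.sum_const, Finset.card_erase_of_mem hy, hK.card_eq]
  unfold simplexShape
  rw [← Finset.add_sum_erase K _ hy]
  simp only [Nat.add_sub_cancel, nsmul_eq_mul]
  field_simp
  ring

/-- Facet coefficients that come from vertex values lead to a sum over the vertices. -/
theorem _root_.CrouzeixRaviart.IsCell.sum_facetPiece_eq (hd : 2 ≤ d) (hK : IsCell K) (hτ : τ ⊆ K)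
    (s : ℝ) (f : Space d → ℝ) (k : ℕ) {x : Space d} (hx : x ∈ hull τ) :
    ∑ z ∈ K, (s * ∑ y ∈ K.erase z, f y) * facetPiece k (K.erase z) K x =
      s * ∑ y ∈ τ, f y * (1 - jacobi 0 (d - 2) k (1 - 2 * bary K y x)) := by
  have h1 : ∑ z ∈ K, (s * ∑ y ∈ K.erase z, f y) * facetPiece k (K.erase z) K x =
      s * ∑ y ∈ K, f y * ∑ z ∈ K.erase y, facetPiece k (K.erase z) K x := by
    simp only [mul_assoc, Finset.sum_mul, Finset.mul_sum]
    exact Finset.sum_comm' fun a b => by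
      simp only [Finset.mem_erase, ne_eq]
      constructor
      · rintro ⟨h1, h2, h3⟩; exact ⟨⟨fun e => h2 e.symm, h1⟩, h3⟩
      · rintro ⟨⟨h1, h2⟩, h3⟩; exact ⟨h2, fun e => h1 e.symm, h3⟩
  rw [h1]
  congr 1
  rw [Finset.sum_congr rfl fun y hy => by rw [hK.sum_erase_facetPiece hd hy k x]]
  refine (Finset.sum_subset hτ fun y hy hyτ => ?_).symm
  rw [((hK.mem_hull_face_iff hτ).1 hx).2 y hy hyτ]
  simp [jacobi_one]

/-- Restriction of a sum of conforming shape functions to a face. -/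
theorem _root_.CrouzeixRaviart.IsCell.sum_facePiece_eq (hK : IsCell K) (hτ : τ ⊆ K) (A : Numbering d)
    (k : ℕ) (c : Idx d → ℝ) {x : Space d} (hx : x ∈ hull τ) :
    ∑ I ∈ localIdx k K, c I * facePiece A I K x = ∑ I ∈ localIdx k τ, c I * facePiece A I K x := by
  symm
  refine Finset.sum_subset (fun I hI => ?_) fun I hI hIτ => ?_
  · obtain ⟨h1, h2⟩ := mem_localIdx.1 hI
    exact mem_localIdx.2 ⟨h1.trans hτ, h2⟩
  · obtain ⟨h1, h2⟩ := mem_localIdx.1 hI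
    have h : ¬ I.1 ⊆ τ := fun h => hIτ (mem_localIdx.2 ⟨h, h2⟩)
    obtain ⟨z, hz, hzτ⟩ := Finset.not_subset.1 h
    rw [facePiece_eq_zero A hz (((hK.mem_hull_face_iff hτ).1 hx).2 z (h1 hz) hzτ), mul_zero]

/-- The basis functions of `CR_k(𝒯)` span the conforming space. -/
theorem exists_conforming_sum (hd : 2 ≤ d) (hreg : interior (closure Ω) = Ω) {A : Numbering d}
    (hA : T.IsNumbering A) {k : ℕ} (hk : Odd k) {u : L2 Ω} (hu : u ∈ T.conformingSpace k) :
    ∃ (c : Idx d → ℝ) (e : Finset (Space d) → ℝ),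
      u = ∑ I ∈ T.idx k, c I • T.faceFun A I + ∑ F ∈ T.facets, e F • T.facetFun k F := by
  obtain ⟨v, -, hvp, huv⟩ := hu
  -- The facet coefficients are written through vertex values of `v`, which are common to all
  -- simplices; only the face coefficients still depend on `K`.
  have hloc : ∀ K, ∃ c : Idx d → ℝ, K ∈ T.cells → ∀ x ∈ hull K,
      v x = ∑ I ∈ localIdx k K, c I * facePiece A I K x +
        ∑ z ∈ K, ((vertexScale d k)⁻¹ * ∑ y ∈ K.erase z, v y) * facetPiece k (K.erase z) K x := by
    intro K
    by_cases hK : K ∈ T.cells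
    · have hC := T.isCell hK
      obtain ⟨q, hq, hvq⟩ := hvp K hK
      obtain ⟨c, e, hce⟩ := hC.exists_shape_sum hd (hA.bijOn hK) hk (mem_polySpace.2
        ⟨q, hq, fun x => rfl⟩)
      refine ⟨c, fun _ x hx => ?_⟩
      rw [hvq x hx, hce x]
      congr 1
      refine Finset.sum_congr rfl fun z hz => ?_
      rw [hC.facet_coeff hd A hk hce hz]
      congr 2
      exact Finset.sum_congr rfl fun y hy =>
        (hvq y (subset_convexHull ℝ _ (Finset.mem_of_mem_erase hy))).symm
    · exact ⟨0, fun h => absurd h hK⟩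
  choose c hc using hloc
  -- On the common face the facet parts coincide and `v` is single-valued, so the face parts
  -- coincide; independence on that face identifies the coefficients.
  have hcons : ∀ K ∈ T.cells, ∀ K' ∈ T.cells, ∀ I ∈ localIdx k (K ∩ K'), c K I = c K' I := by
    intro K hK K' hK' I hI
    have h := (T.isCell hK).facePiece_linearIndependent (Finset.inter_subset_left (s₂ := K'))
      (hA.bijOn hK) k (fun I => c K I - c K' I) (fun x hx => by
        have hxK := hull_mono Finset.inter_subset_left hx
        have hxK' := hull_mono Finset.inter_subset_right hx
        have h1 := hc K hK x hxK
        have h2 := hc K' hK' x hxK'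
        rw [(T.isCell hK).sum_facetPiece_eq hd Finset.inter_subset_left _ _ k hx,
          (T.isCell hK).sum_facePiece_eq Finset.inter_subset_left A k _ hx] at h1
        rw [(T.isCell hK').sum_facetPiece_eq hd Finset.inter_subset_right _ _ k hx,
          (T.isCell hK').sum_facePiece_eq Finset.inter_subset_right A k _ hx] at h2
        simp only [← T.bary_eq hK hK' hxK hxK', ← T.facePiece_eq_of_mem A _ hK hK' hxK hxK'] at h2
        simp only [sub_mul, Finset.sum_sub_distrib]
        linarith) I hI
    linarith
  let C : Idx d → ℝ := fun I => if h : ∃ K ∈ T.cells, I.1 ⊆ K then c h.choose I else 0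
  refine ⟨C, fun F => (vertexScale d k)⁻¹ * ∑ y ∈ F, v y, ?_⟩
  have hR := (T.isRepr_sum hreg (T.idx k) C fun I _ => T.isRepr_faceFun hreg A I).add hreg
    (T.isRepr_sum hreg T.facets (fun F => (vertexScale d k)⁻¹ * ∑ y ∈ F, v y)
      fun F _ => T.isRepr_facetFun hreg k F)
  have hu : T.IsRepr u fun _ => v := fun K hK => T.ae_hull hreg hK huv
  refine hu.ext hR fun K hK x hx => ?_
  rw [hc K hK x hx]
  simp only [Pi.add_apply]
  congr 1
  · have hsub : localIdx k K ⊆ T.idx k := fun I hI =>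
      T.mem_idx_of_mem_localIdx (T.cell_mem_faces hK) hI
    refine Finset.sum_subset_zero_on_sdiff hsub (fun I hI => ?_) fun I hI => ?_
    · obtain ⟨h1, h2⟩ := Finset.mem_sdiff.1 hI
      rw [facePiece, if_neg fun h => h2 (T.mem_localIdx_of_mem_idx h1 h), mul_zero]
    · have hex : ∃ K ∈ T.cells, I.1 ⊆ K := ⟨K, hK, (mem_localIdx.1 hI).1⟩
      simp only [C, dif_pos hex]
      rw [hcons K hK _ hex.choose_spec.1 I (mem_localIdx.2
        ⟨Finset.subset_inter (mem_localIdx.1 hI).1 hex.choose_spec.2, (mem_localIdx.1 hI).2⟩)]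
  · have himg : K.image K.erase ⊆ T.facets := fun F hF => by
      obtain ⟨z, hz, rfl⟩ := Finset.mem_image.1 hF
      exact T.erase_mem_facets hd hK hz
    rw [← Finset.sum_subset himg fun F hF hF' => ?_, Finset.sum_image fun z hz y _ h => erase_injOn hz h]
    rw [facetPiece, if_neg, mul_zero]
    intro h
    obtain ⟨z, hz, rfl⟩ := T.facet_eq_erase hK hF h
    exact hF' (Finset.mem_image_of_mem _ hz)

theorem CR_eq {k : ℕ} (hk : Odd k) :
    T.CR k = T.conformingSpace k ⊔ Submodule.span ℝ (T.facetFun k '' T.facets) :=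
  if_neg (Nat.not_even_iff_odd.2 hk)

theorem CR0_eq {k : ℕ} (hk : Odd k) :
    T.CR0 k = T.conformingSpace0 k ⊔ Submodule.span ℝ (T.facetFun k '' T.innerFacets) :=
  if_neg (Nat.not_even_iff_odd.2 hk)

theorem faceFun_mem_CR (hreg : interior (closure Ω) = Ω) (A : Numbering d) {k : ℕ} (hk : Odd k)
    {I : Idx d} (hI : I ∈ T.idx k) : T.faceFun A I ∈ T.CR k := by
  rw [T.CR_eq hk]
  exact Submodule.mem_sup_left (T.faceFun_mem_conformingSpace hreg A hI)

theorem facetFun_mem_CR {k : ℕ} (hk : Odd k) (hF : F ∈ T.facets) : T.facetFun k F ∈ T.CR k := by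
  rw [T.CR_eq hk]
  exact Submodule.mem_sup_right (Submodule.subset_span (Set.mem_image_of_mem _ hF))

/-- The basis functions span `CR_k(𝒯)`. -/
theorem CR_le_span (hd : 2 ≤ d) (hreg : interior (closure Ω) = Ω) {A : Numbering d}
    (hA : T.IsNumbering A) {k : ℕ} (hk : Odd k) :
    T.CR k ≤ Submodule.span ℝ (T.faceFun A '' T.idx k ∪ T.facetFun k '' T.facets) := by
  rw [T.CR_eq hk]
  refine sup_le (fun u hu => ?_) (Submodule.span_mono Set.subset_union_right)
  obtain ⟨c, e, rfl⟩ := T.exists_conforming_sum hd hreg hA hk hu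
  refine Submodule.add_mem _ (Submodule.sum_mem _ fun I hI => Submodule.smul_mem _ _
    (Submodule.subset_span (Or.inl (Set.mem_image_of_mem _ hI))))
    (Submodule.sum_mem _ fun F hF => Submodule.smul_mem _ _
    (Submodule.subset_span (Or.inr (Set.mem_image_of_mem _ hF))))

end Mesh

end

section

/-! ### Degrees of freedom -/

open Filter Topology

namespace Mesh

variable {d : ℕ} {Ω : Set (Space d)} {T : Mesh Ω} {K K' F τ σ : Finset (Space d)} {k : ℕ}

theorem mem_facets_of_bdry (hF : F ∈ T.bdryFacets) : F ∈ T.facets := (T.mem_bdryFacets.1 hF).1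

theorem mem_faces_of_facet (hF : F ∈ T.facets) : F ∈ T.faces := (T.mem_facets.1 hF).1

theorem isFiniteMeasure_facetMeasure (hd : 2 ≤ d) (hF : F ∈ T.facets) :
    IsFiniteMeasure (facetMeasure F) := by
  obtain ⟨K, hK, hFK⟩ := T.exists_cell (mem_faces_of_facet hF)
  obtain ⟨z, hz, rfl⟩ := T.facet_eq_erase hK hF hFK
  exact (T.isCell hK).isFiniteMeasure_facetMeasure hd hz

theorem aestronglyMeasurable_coe (u : L2 Ω) (μ : Measure (Space d)) :
    AEStronglyMeasurable u μ := (Lp.stronglyMeasurable u).aestronglyMeasurable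

theorem isTrace_unique (hd : 2 ≤ d) (hΩ : IsOpen Ω) (hreg : interior (closure Ω) = Ω)
    (hF : F ∈ T.bdryFacets) {u : L2 Ω} {w w' : Space d → ℝ} (h : T.IsTrace F u w)
    (h' : T.IsTrace F u w') : w =ᵐ[facetMeasure F] w' := by
  obtain ⟨K, hK, hFK, hw⟩ := h
  obtain ⟨K', hK', hFK', hw'⟩ := h'
  obtain rfl := T.cell_unique hd hΩ hreg hF hK hK' hFK hFK'
  obtain ⟨z, hz, rfl⟩ := T.facet_eq_erase hK (mem_facets_of_bdry hF) hFK
  exact (T.isCell hK).trace_unique hd hz (aestronglyMeasurable_coe u _) hw hw'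

theorem IsTrace.add (hd : 2 ≤ d) (hΩ : IsOpen Ω) (hreg : interior (closure Ω) = Ω)
    (hF : F ∈ T.bdryFacets) {u v : L2 Ω} {w w' : Space d → ℝ} (h : T.IsTrace F u w)
    (h' : T.IsTrace F v w') : T.IsTrace F (u + v) (w + w') := by
  obtain ⟨K, hK, hFK, hw⟩ := h
  obtain ⟨K', hK', hFK', hw'⟩ := h'
  obtain rfl := T.cell_unique hd hΩ hreg hF hK hK' hFK hFK'
  exact ⟨K, hK, hFK, (hw.add (aestronglyMeasurable_coe u _) (aestronglyMeasurable_coe v _)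
    hw').congr (EventuallyEq.symm (T.ae_hull hreg hK (Lp.coeFn_add u v)))⟩

theorem IsTrace.smul (hreg : interior (closure Ω) = Ω) {u : L2 Ω} {w : Space d → ℝ} (c : ℝ)
    (h : T.IsTrace F u w) : T.IsTrace F (c • u) (c • w) := by
  obtain ⟨K, hK, hFK, hw⟩ := h
  exact ⟨K, hK, hFK, (hw.const_smul c).congr
    (EventuallyEq.symm (T.ae_hull hreg hK (Lp.coeFn_smul c u)))⟩

theorem IsTrace.memLp {u : L2 Ω} {w : Space d → ℝ} (h : T.IsTrace F u w) :
    MemLp w 2 (facetMeasure F) := by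
  obtain ⟨K, -, -, hw⟩ := h
  exact hw.1

theorem IsRepr.isTrace (hd : 2 ≤ d) (hF : F ∈ T.facets) (hK : K ∈ T.cells) (hFK : F ⊆ K)
    {u : L2 Ω} {p : Finset (Space d) → Space d → ℝ} (hu : T.IsRepr u p)
    (hp : p K ∈ polySpace d k) : T.IsTrace F u (p K) :=
  ⟨K, hK, hFK, (isTraceFrom_of_contDiff (contDiff_of_mem_polySpace hp)
    (isFiniteMeasure_facetMeasure hd hF)).congr (hu K hK).symm⟩

theorem exists_isTrace_of_mem_H1 (hd : 2 ≤ d) (hreg : interior (closure Ω) = Ω)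
    (hF : F ∈ T.facets) {u : L2 Ω} (hu : u ∈ H1 Ω) : ∃ w, T.IsTrace F u w := by
  obtain ⟨q, hq, rfl⟩ := hu
  obtain ⟨K, hK, hFK⟩ := T.exists_cell (mem_faces_of_facet hF)
  obtain ⟨z, hz, rfl⟩ := T.facet_eq_erase hK hF hFK
  obtain ⟨w, hw⟩ := (T.isCell hK).exists_trace hd hz (aestronglyMeasurable_coe q.1 _)
    (g := fun i => q.2 i)
    (fun i => (Lp.memLp (q.2 i)).mono_measure (T.restrict_hull_le hreg hK)) (fun ε hε => by
      obtain ⟨δ, hδ, hδε⟩ := exists_between hε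
      obtain ⟨φ, h1, h2, h3⟩ := (T.isCell hK).exists_smooth_approx
        (T.interior_hull_subset hreg hK) hq δ hδ
      exact ⟨φ, h1, h2.trans_lt hδε, fun i => (h3 i).trans_lt hδε⟩)
  exact ⟨w, K, hK, hFK, hw⟩

theorem exists_isTrace_of_mem_CR (hd : 2 ≤ d) (hΩ : IsOpen Ω) (hreg : interior (closure Ω) = Ω)
    {A : Numbering d} (hA : T.IsNumbering A) (hk : Odd k) (hF : F ∈ T.bdryFacets) {u : L2 Ω}
    (hu : u ∈ T.CR k) : ∃ w, T.IsTrace F u w := by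
  have hF' := mem_facets_of_bdry hF
  obtain ⟨K, hK, hFK⟩ := T.exists_cell (mem_faces_of_facet hF')
  refine Submodule.span_induction (p := fun u _ => ∃ w, T.IsTrace F u w) ?_ ?_ ?_ ?_
    (T.CR_le_span hd hreg hA hk hu)
  · rintro _ (⟨I, hI, rfl⟩ | ⟨G, hG, rfl⟩)
    · exact ⟨_, (T.isRepr_faceFun hreg A I).isTrace hd hF' hK hFK (T.facePiece_mem A hI K)⟩
    · exact ⟨_, (T.isRepr_facetFun hreg k G).isTrace hd hF' hK hFK (T.facetPiece_mem k hG hK)⟩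
  · exact ⟨_, (T.isRepr_zero hreg).isTrace (k := 0) hd hF' hK hFK (Submodule.zero_mem _)⟩
  · rintro u v _ _ ⟨w, hw⟩ ⟨w', hw'⟩
    exact ⟨_, hw.add hd hΩ hreg hF hw'⟩
  · rintro c u _ ⟨w, hw⟩
    exact ⟨_, hw.smul hreg c⟩

theorem exists_isTrace (hd : 2 ≤ d) (hΩ : IsOpen Ω) (hreg : interior (closure Ω) = Ω)
    {A : Numbering d} (hA : T.IsNumbering A) (hk : Odd k) (hF : F ∈ T.bdryFacets) {u : L2 Ω}
    (hu : u ∈ H1 Ω ⊔ T.CR k) : ∃ w, T.IsTrace F u w := by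
  obtain ⟨a, ha, b, hb, rfl⟩ := Submodule.mem_sup.1 hu
  obtain ⟨w, hw⟩ := exists_isTrace_of_mem_H1 hd hreg (mem_facets_of_bdry hF) ha
  obtain ⟨w', hw'⟩ := exists_isTrace_of_mem_CR hd hΩ hreg hA hk hF hb
  exact ⟨_, hw.add hd hΩ hreg hF hw'⟩

/-- The test functions that approximate `u` are smooth up to the boundary of `K` and vanish on `F`,
which does not meet `Ω`. -/
theorem isTrace_zero_of_mem_H10 (hΩ : IsOpen Ω) (hreg : interior (closure Ω) = Ω)
    (hF : F ∈ T.bdryFacets) {u : L2 Ω} (hu : u ∈ H10 Ω) : T.IsTrace F u 0 := by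
  obtain ⟨q, hq, rfl⟩ := hu
  obtain ⟨K, hK, hFK⟩ := T.exists_cell (mem_faces_of_facet (mem_facets_of_bdry hF))
  refine ⟨K, hK, hFK, MemLp.zero, fun i => q.2 i,
    fun i => (Lp.memLp (q.2 i)).mono_measure (T.restrict_hull_le hreg hK), fun ε hε => ?_⟩
  have hq' : q ∈ closure (testGraph Ω : Set (L2 Ω × (Fin d → L2 Ω))) := hq
  obtain ⟨p, ⟨φ, hφ, h1, h2⟩, hp⟩ := EMetric.mem_closure_iff.1 hq' ε hε
  have key : ∀ (a b : L2 Ω) (f : Space d → ℝ), b =ᵐ[volume.restrict Ω] f → edist a b < ε →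
      eLpNorm ((a : Space d → ℝ) - f) 2 (volume.restrict (hull K)) < ε := by
    intro a b f hbf hab
    refine (eLpNorm_mono_measure _ (T.restrict_hull_le hreg hK)).trans_lt ?_
    rw [← eLpNorm_congr_ae ((ae_eq_refl (a : Space d → ℝ)).sub hbf), ← Lp.edist_def]
    exact hab
  rw [Prod.edist_eq, max_lt_iff] at hp
  refine ⟨φ, hφ.smooth, key _ _ _ h1 hp.1, fun i => key _ _ _ (h2 i)
    ((edist_le_pi_edist _ _ i).trans_lt hp.2), ?_⟩
  have h0 : (0 - φ) =ᵐ[facetMeasure F] 0 := by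
    unfold facetMeasure
    refine ae_restrict_of_forall_mem (isCompact_hull F).measurableSet fun x hx => ?_
    have hxΩ : x ∉ Ω := fun h => notMem_frontier hΩ h ((T.mem_bdryFacets.1 hF).2 hx)
    simp [image_eq_zero_of_notMem_tsupport fun h => hxΩ (hφ.supp h)]
  rw [eLpNorm_congr_ae h0, eLpNorm_zero]
  exact hε

/-- The functional is defined through a chosen trace; uniqueness allows any convenient trace in its
place. -/
theorem facetDof_eq (hd : 2 ≤ d) (hΩ : IsOpen Ω) (hreg : interior (closure Ω) = Ω)
    (hF : F ∈ T.bdryFacets) (g : Space d → ℝ) {u : L2 Ω} {w : Space d → ℝ}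
    (h : T.IsTrace F u w) : T.facetDof g F u = ∫ x, g x * w x ∂(facetMeasure F) := by
  have hex : ∃ w, T.IsTrace F u w := ⟨w, h⟩
  have htr : T.IsTrace F u (T.trace F u) := by
    unfold trace
    rw [dif_pos hex]
    exact hex.choose_spec
  unfold facetDof
  refine integral_congr_ae ?_
  filter_upwards [isTrace_unique hd hΩ hreg hF htr h] with x hx
  rw [hx]

theorem facetDof_add (hd : 2 ≤ d) (hΩ : IsOpen Ω) (hreg : interior (closure Ω) = Ω)
    (hF : F ∈ T.bdryFacets) {g : Space d → ℝ} (hg : MemLp g 2 (facetMeasure F)) {u v : L2 Ω}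
    (hu : ∃ w, T.IsTrace F u w) (hv : ∃ w, T.IsTrace F v w) :
    T.facetDof g F (u + v) = T.facetDof g F u + T.facetDof g F v := by
  obtain ⟨w, hw⟩ := hu
  obtain ⟨w', hw'⟩ := hv
  rw [facetDof_eq hd hΩ hreg hF g hw, facetDof_eq hd hΩ hreg hF g hw',
    facetDof_eq hd hΩ hreg hF g (hw.add hd hΩ hreg hF hw'),
    ← integral_add (f := fun x => g x * w x) (g := fun x => g x * w' x)
    (hg.integrable_mul hw.memLp) (hg.integrable_mul hw'.memLp)]
  simp only [Pi.add_apply, mul_add]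

theorem facetDof_smul (hd : 2 ≤ d) (hΩ : IsOpen Ω) (hreg : interior (closure Ω) = Ω)
    (hF : F ∈ T.bdryFacets) (g : Space d → ℝ) (c : ℝ) {u : L2 Ω} (hu : ∃ w, T.IsTrace F u w) :
    T.facetDof g F (c • u) = c * T.facetDof g F u := by
  obtain ⟨w, hw⟩ := hu
  rw [facetDof_eq hd hΩ hreg hF g hw, facetDof_eq hd hΩ hreg hF g (hw.smul hreg c),
    ← integral_const_mul]
  refine integral_congr_ae (Eventually.of_forall fun x => ?_)
  simp only [Pi.smul_apply, smul_eq_mul]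
  ring

theorem cellDof_eq (g : Space d → ℝ) (hK : K ∈ T.cells) {u : L2 Ω}
    {p : Finset (Space d) → Space d → ℝ} (hu : T.IsRepr u p) :
    cellDof g K u = ∫ x in hull K, g x * p K x := by
  unfold cellDof
  refine integral_congr_ae ?_
  filter_upwards [hu K hK] with x hx
  rw [hx]

theorem cellDof_add (hreg : interior (closure Ω) = Ω) (hK : K ∈ T.cells) {g : Space d → ℝ}
    (hg : MemLp g 2 (volume.restrict (hull K))) (u v : L2 Ω) :
    cellDof g K (u + v) = cellDof g K u + cellDof g K v := by
  have hL : ∀ u : L2 Ω, MemLp u 2 (volume.restrict (hull K)) := fun u =>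
    (Lp.memLp u).mono_measure (T.restrict_hull_le hreg hK)
  unfold cellDof
  rw [← integral_add (f := fun x => g x * u x) (g := fun x => g x * v x)
    (hg.integrable_mul (hL u)) (hg.integrable_mul (hL v))]
  refine integral_congr_ae ?_
  filter_upwards [T.ae_hull hreg hK (Lp.coeFn_add u v)] with x hx
  rw [hx, Pi.add_apply, mul_add]

theorem cellDof_smul (hreg : interior (closure Ω) = Ω) (hK : K ∈ T.cells) (g : Space d → ℝ)
    (c : ℝ) (u : L2 Ω) : cellDof g K (c • u) = c * cellDof g K u := by
  unfold cellDof
  rw [← integral_const_mul]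
  refine integral_congr_ae ?_
  filter_upwards [T.ae_hull hreg hK (Lp.coeFn_smul c u)] with x hx
  rw [hx, Pi.smul_apply, smul_eq_mul]
  ring

/-! ### The quasi-interpolation operator -/

theorem mem_innerFaces_of_facet (hF : F ∈ T.innerFacets) : F ∈ T.innerFaces := by
  obtain ⟨h1, h2⟩ := Finset.mem_sdiff.1 hF
  exact Finset.mem_sdiff.2 ⟨mem_faces_of_facet h1, fun h =>
    h2 (T.mem_bdryFacets.2 ⟨h1, (T.mem_bdryFaces.1 h).2⟩)⟩

variable {A : Numbering d} {W : Weights d} {mark : Finset (Space d) → Finset (Space d)}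
  {I J : Idx d}

theorem mark_inner (hmark : T.IsMark mark) (hI : I ∈ T.innerIdx k) :
    mark I.1 ∈ T.cells ∧ I ∈ T.idxIn k (mark I.1) := by
  obtain ⟨h1, h2⟩ := Finset.mem_filter.1 hI
  obtain ⟨h3, h4⟩ := hmark.1 _ h2
  exact ⟨h3, Finset.mem_filter.2 ⟨h1, h4⟩⟩

theorem mem_idx_of_bdryIdx (hI : I ∈ T.bdryIdx k) : I ∈ T.idx k := (Finset.mem_sdiff.1 hI).1

theorem mark_bdry (hmark : T.IsMark mark) (hI : I ∈ T.bdryIdx k) :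
    mark I.1 ∈ T.bdryFacets ∧ I ∈ T.idxIn k (mark I.1) := by
  obtain ⟨h1, h2⟩ := Finset.mem_sdiff.1 hI
  have hf : I.1 ∈ T.faces := (T.mem_idx_iff.1 h1).1
  have hb : I.1 ∈ T.bdryFaces := by
    by_contra h
    exact h2 (Finset.mem_filter.2 ⟨h1, Finset.mem_sdiff.2 ⟨hf, h⟩⟩)
  obtain ⟨h3, h4⟩ := hmark.2 _ hb
  exact ⟨h3, Finset.mem_filter.2 ⟨h1, h4⟩⟩

theorem mark_facet (hmark : T.IsMark mark) (hF : F ∈ T.innerFacets) :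
    mark F ∈ T.cells ∧ F ∈ T.facets ∧ F ⊆ mark F :=
  ⟨(hmark.1 F (mem_innerFaces_of_facet hF)).1, (Finset.mem_sdiff.1 hF).1,
    (hmark.1 F (mem_innerFaces_of_facet hF)).2⟩

/-- The weights that occur in the quasi-interpolation operator are square integrable on the
boundary facets. -/
theorem memLp_facetFace (hW : T.IsBidual k A W) (hmark : T.IsMark mark) (hI : I ∈ T.bdryIdx k) :
    MemLp (W.facetFace (mark I.1) I) 2 (facetMeasure (mark I.1)) := by
  obtain ⟨h1, h2⟩ := mark_bdry hmark hI
  obtain ⟨K, hK, hFK⟩ := T.exists_cell (mem_faces_of_facet (mem_facets_of_bdry h1))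
  exact (hW.2 _ h1 K hK hFK).memLp_face I h2

theorem memLp_facetFacet (hW : T.IsBidual k A W) (hF : F ∈ T.bdryFacets) :
    MemLp (W.facetFacet F F) 2 (facetMeasure F) := by
  obtain ⟨K, hK, hFK⟩ := T.exists_cell (mem_faces_of_facet (mem_facets_of_bdry hF))
  exact (hW.2 _ hF K hK hFK).memLp_facet F hF hFK

theorem interp_add (hd : 2 ≤ d) (hΩ : IsOpen Ω) (hreg : interior (closure Ω) = Ω)
    (hW : T.IsBidual k A W) (hmark : T.IsMark mark) {u v : L2 Ω}
    (hu : ∀ F ∈ T.bdryFacets, ∃ w, T.IsTrace F u w)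
    (hv : ∀ F ∈ T.bdryFacets, ∃ w, T.IsTrace F v w) :
    T.interp k A W mark (u + v) = T.interp k A W mark u + T.interp k A W mark v := by
  unfold interp innerInterp
  rw [Finset.sum_congr rfl fun I hI => by
      rw [cellDof_add hreg (mark_inner hmark hI).1
        ((hW.1 _ (mark_inner hmark hI).1).memLp_face I (mark_inner hmark hI).2) u v, add_smul],
    Finset.sum_congr (s₁ := T.innerFacets) rfl fun F hF => by
      rw [cellDof_add hreg (mark_facet hmark hF).1
        ((hW.1 _ (mark_facet hmark hF).1).memLp_facet F (mark_facet hmark hF).2.1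
          (mark_facet hmark hF).2.2) u v, add_smul],
    Finset.sum_congr (s₁ := T.bdryIdx k) rfl fun I hI => by
      rw [facetDof_add hd hΩ hreg (mark_bdry hmark hI).1 (memLp_facetFace hW hmark hI)
        (hu _ (mark_bdry hmark hI).1) (hv _ (mark_bdry hmark hI).1), add_smul],
    Finset.sum_congr (s₁ := T.bdryFacets) rfl fun F hF => by
      rw [facetDof_add hd hΩ hreg hF (memLp_facetFacet hW hF) (hu F hF) (hv F hF), add_smul]]
  simp only [Finset.sum_add_distrib]
  abel

theorem interp_smul (hd : 2 ≤ d) (hΩ : IsOpen Ω) (hreg : interior (closure Ω) = Ω)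
    (hmark : T.IsMark mark) (c : ℝ) {u : L2 Ω}
    (hu : ∀ F ∈ T.bdryFacets, ∃ w, T.IsTrace F u w) :
    T.interp k A W mark (c • u) = c • T.interp k A W mark u := by
  unfold interp innerInterp
  rw [Finset.sum_congr rfl fun I hI => by
      rw [cellDof_smul hreg (mark_inner hmark hI).1 _ c u, mul_smul],
    Finset.sum_congr (s₁ := T.innerFacets) rfl fun F hF => by
      rw [cellDof_smul hreg (mark_facet hmark hF).1 _ c u, mul_smul],
    Finset.sum_congr (s₁ := T.bdryIdx k) rfl fun I hI => by
      rw [facetDof_smul hd hΩ hreg (mark_bdry hmark hI).1 _ c (hu _ (mark_bdry hmark hI).1),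
        mul_smul],
    Finset.sum_congr (s₁ := T.bdryFacets) rfl fun F hF => by
      rw [facetDof_smul hd hΩ hreg hF _ c (hu F hF), mul_smul]]
  simp only [smul_add, Finset.smul_sum]

theorem interp_mem_CR (hreg : interior (closure Ω) = Ω) (hk : Odd k) (u : L2 Ω) :
    T.interp k A W mark u ∈ T.CR k := by
  unfold interp innerInterp
  refine Submodule.add_mem _ (Submodule.add_mem _ (Submodule.add_mem _ ?_ ?_) ?_) ?_ <;>
  refine Submodule.sum_mem _ fun I hI => Submodule.smul_mem _ _ ?_
  · exact T.faceFun_mem_CR hreg A hk (Finset.mem_filter.1 hI).1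
  · exact T.facetFun_mem_CR hk (Finset.mem_sdiff.1 hI).1
  · exact T.faceFun_mem_CR hreg A hk (mem_idx_of_bdryIdx hI)
  · exact T.facetFun_mem_CR hk (mem_facets_of_bdry hI)

theorem innerInterp_mem_CR0 (hΩ : IsOpen Ω) (hreg : interior (closure Ω) = Ω) (hk : Odd k)
    (u : L2 Ω) : T.innerInterp k A W mark u ∈ T.CR0 k := by
  rw [T.CR0_eq hk]
  unfold innerInterp
  refine Submodule.add_mem _ (Submodule.sum_mem _ fun I hI => Submodule.smul_mem _ _ ?_)
    (Submodule.sum_mem _ fun F hF => Submodule.smul_mem _ _ ?_)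
  · exact Submodule.mem_sup_left ⟨T.faceFun_mem_conformingSpace hreg A
      (Finset.mem_filter.1 hI).1, T.faceFun_mem_H10 hΩ hreg A hI⟩
  · exact Submodule.mem_sup_right (Submodule.subset_span (Set.mem_image_of_mem _ hF))

/-- A functional on a boundary facet that annihilates the facet functions of the inner facets
annihilates `H¹₀(Ω) + CR_{k,0}(𝒯)`. -/
theorem facetDof_eq_zero (hd : 2 ≤ d) (hΩ : IsOpen Ω) (hreg : interior (closure Ω) = Ω)
    (hk : Odd k) (hF : F ∈ T.bdryFacets) (hK : K ∈ T.cells) (hFK : F ⊆ K) {g : Space d → ℝ}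
    (hg : MemLp g 2 (facetMeasure F))
    (h : ∀ F' ∈ T.innerFacets, F' ⊆ K → ∫ x, g x * facetPiece k F' K x ∂(facetMeasure F) = 0)
    {u : L2 Ω} (hu : u ∈ H10 Ω ⊔ T.CR0 k) : T.facetDof g F u = 0 := by
  have hF' := mem_facets_of_bdry hF
  have hspan : ∀ v ∈ Submodule.span ℝ (T.facetFun k '' T.innerFacets),
      (∃ w, T.IsTrace F v w) ∧ T.facetDof g F v = 0 := by
    intro v hv
    refine Submodule.span_induction
      (p := fun v _ => (∃ w, T.IsTrace F v w) ∧ T.facetDof g F v = 0) ?_ ?_ ?_ ?_ hv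
    · rintro _ ⟨G, hG, rfl⟩
      have htr := (T.isRepr_facetFun hreg k G).isTrace hd hF' hK hFK
        (T.facetPiece_mem k (Finset.mem_sdiff.1 hG).1 hK)
      refine ⟨⟨_, htr⟩, ?_⟩
      rw [facetDof_eq hd hΩ hreg hF g htr]
      by_cases hGK : G ⊆ K
      · exact h G hG hGK
      · simp [facetPiece, hGK]
    · have htr := (T.isRepr_zero hreg).isTrace (k := 0) hd hF' hK hFK (Submodule.zero_mem _)
      refine ⟨⟨_, htr⟩, ?_⟩
      rw [facetDof_eq hd hΩ hreg hF g htr]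
      simp
    · rintro a b _ _ ⟨⟨wa, ha⟩, ha0⟩ ⟨⟨wb, hb⟩, hb0⟩
      refine ⟨⟨_, ha.add hd hΩ hreg hF hb⟩, ?_⟩
      rw [facetDof_add hd hΩ hreg hF hg ⟨wa, ha⟩ ⟨wb, hb⟩, ha0, hb0, add_zero]
    · rintro c a _ ⟨⟨wa, ha⟩, ha0⟩
      refine ⟨⟨_, ha.smul hreg c⟩, ?_⟩
      rw [facetDof_smul hd hΩ hreg hF g c ⟨wa, ha⟩, ha0, mul_zero]
  -- Since `S_{k,0}` is contained in `H¹₀`, only functions with zero trace and inner facet functions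
  -- have to be tested.
  have hsup : H10 Ω ⊔ T.CR0 k ≤ H10 Ω ⊔ Submodule.span ℝ (T.facetFun k '' T.innerFacets) := by
    rw [T.CR0_eq hk]
    exact sup_le le_sup_left (sup_le (inf_le_right.trans le_sup_left) le_sup_right)
  obtain ⟨a, ha, b, hb, rfl⟩ := Submodule.mem_sup.1 (hsup hu)
  have ha' := isTrace_zero_of_mem_H10 hΩ hreg hF ha
  rw [facetDof_add hd hΩ hreg hF hg ⟨_, ha'⟩ (hspan b hb).1, (hspan b hb).2,
    facetDof_eq hd hΩ hreg hF g ha']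
  simp

theorem interp_eq_innerInterp (hd : 2 ≤ d) (hΩ : IsOpen Ω) (hreg : interior (closure Ω) = Ω)
    (hk : Odd k) (hW : T.IsBidual k A W) (hmark : T.IsMark mark) {u : L2 Ω}
    (hu : u ∈ H10 Ω ⊔ T.CR0 k) : T.interp k A W mark u = T.innerInterp k A W mark u := by
  unfold interp
  rw [Finset.sum_eq_zero (s := T.bdryIdx k) fun I hI => ?_,
    Finset.sum_eq_zero (s := T.bdryFacets) fun F hF => ?_, add_zero, add_zero]
  · obtain ⟨K, hK, hFK⟩ := T.exists_cell (mem_faces_of_facet (mem_facets_of_bdry hF))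
    rw [facetDof_eq_zero hd hΩ hreg hk hF hK hFK (memLp_facetFacet hW hF)
      (hW.2 F hF K hK hFK).facet_inner hu, zero_smul]
  · obtain ⟨h1, h2⟩ := mark_bdry hmark hI
    obtain ⟨K, hK, hFK⟩ := T.exists_cell (mem_faces_of_facet (mem_facets_of_bdry h1))
    rw [facetDof_eq_zero hd hΩ hreg hk h1 hK hFK (memLp_facetFace hW hmark hI)
      ((hW.2 _ h1 K hK hFK).face_inner I h2) hu, zero_smul]

/-! ### The quasi-interpolation operator on the basis functions -/

theorem integral_facePiece_cell (hW : T.IsBidualOnCell k A W K) (hI : I ∈ T.idxIn k K)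
    (hJ : J ∈ T.idx k) :
    ∫ x in hull K, W.cellFace K I x * facePiece A J K x = if I = J then 1 else 0 := by
  by_cases h : J.1 ⊆ K
  · exact hW.face_face I hI J (Finset.mem_filter.2 ⟨hJ, h⟩)
  · have hne : I ≠ J := by
      rintro rfl
      exact h (Finset.mem_filter.1 hI).2
    simp [facePiece, h, hne]

/-- The trace of a face function on a facet that does not contain the face vanishes. -/
theorem integral_mul_facePiece_eq_zero (hK : K ∈ T.cells) (hFK : F ⊆ K) (h : ¬ J.1 ⊆ F)
    (g : Space d → ℝ) : ∫ x, g x * facePiece A J K x ∂(facetMeasure F) = 0 := by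
  by_cases hJK : J.1 ⊆ K
  · obtain ⟨z, hz, hzF⟩ := Finset.not_subset.1 h
    unfold facetMeasure
    refine integral_eq_zero_of_ae (ae_restrict_of_forall_mem (isCompact_hull F).measurableSet
      fun x hx => ?_)
    simp [facePiece_eq_zero A hz
      ((((T.isCell hK).mem_hull_face_iff hFK).1 hx).2 z (hJK hz) hzF)]
  · simp [facePiece, hJK]

/-- Each functional meets either a function that vanishes on its simplex or facet, or one covered by
biduality. The index of the function occurs in exactly one of the inner and boundary sums. -/
theorem interp_faceFun (hd : 2 ≤ d) (hΩ : IsOpen Ω) (hreg : interior (closure Ω) = Ω)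
    (hW : T.IsBidual k A W) (hmark : T.IsMark mark) (hJ : J ∈ T.idx k) :
    T.interp k A W mark (T.faceFun A J) = T.faceFun A J := by
  have hR := T.isRepr_faceFun hreg A J
  have e1 : ∀ I ∈ T.innerIdx k,
      cellDof (W.cellFace (mark I.1) I) (mark I.1) (T.faceFun A J) • T.faceFun A I =
        if I = J then T.faceFun A J else 0 := by
    intro I hI
    obtain ⟨h1, h2⟩ := mark_inner hmark hI
    rw [cellDof_eq _ h1 hR, integral_facePiece_cell (hW.1 _ h1) h2 hJ]
    split_ifs with h
    · rw [one_smul, h]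
    · rw [zero_smul]
  have e2 : ∀ F ∈ T.innerFacets,
      cellDof (W.cellFacet (mark F) F) (mark F) (T.faceFun A J) • T.facetFun k F = 0 := by
    intro F hF
    obtain ⟨h1, h2, h3⟩ := mark_facet hmark hF
    rw [cellDof_eq _ h1 hR]
    by_cases h : J.1 ⊆ mark F
    · rw [(hW.1 _ h1).facet_face F h2 h3 J (Finset.mem_filter.2 ⟨hJ, h⟩), zero_smul]
    · simp [facePiece, h]
  have e3 : ∀ I ∈ T.bdryIdx k,
      T.facetDof (W.facetFace (mark I.1) I) (mark I.1) (T.faceFun A J) • T.faceFun A I =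
        if I = J then T.faceFun A J else 0 := by
    intro I hI
    obtain ⟨h1, h2⟩ := mark_bdry hmark hI
    obtain ⟨K, hK, hFK⟩ := T.exists_cell (mem_faces_of_facet (mem_facets_of_bdry h1))
    rw [facetDof_eq hd hΩ hreg h1 _ (hR.isTrace hd (mem_facets_of_bdry h1) hK hFK
      (T.facePiece_mem A hJ K))]
    by_cases h : J.1 ⊆ mark I.1
    · rw [(hW.2 _ h1 K hK hFK).face_face I h2 J (Finset.mem_filter.2 ⟨hJ, h⟩)]
      split_ifs with h
      · rw [one_smul, h]
      · rw [zero_smul]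
    · have hne : I ≠ J := by
        rintro rfl
        exact h (Finset.mem_filter.1 h2).2
      rw [integral_mul_facePiece_eq_zero hK hFK h, zero_smul, if_neg hne]
  have e4 : ∀ F ∈ T.bdryFacets,
      T.facetDof (W.facetFacet F F) F (T.faceFun A J) • T.facetFun k F = 0 := by
    intro F hF
    obtain ⟨K, hK, hFK⟩ := T.exists_cell (mem_faces_of_facet (mem_facets_of_bdry hF))
    rw [facetDof_eq hd hΩ hreg hF _ (hR.isTrace hd (mem_facets_of_bdry hF) hK hFK
      (T.facePiece_mem A hJ K))]
    by_cases h : J.1 ⊆ F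
    · rw [(hW.2 _ hF K hK hFK).facet_face F hF hFK J (Finset.mem_filter.2 ⟨hJ, h⟩), zero_smul]
    · rw [integral_mul_facePiece_eq_zero hK hFK h, zero_smul]
  unfold interp innerInterp
  rw [Finset.sum_congr rfl e1, Finset.sum_eq_zero e2, Finset.sum_congr rfl e3,
    Finset.sum_eq_zero e4, Finset.sum_ite_eq', Finset.sum_ite_eq', add_zero, add_zero]
  by_cases h : J ∈ T.innerIdx k
  · rw [if_pos h, if_neg fun h' : J ∈ T.bdryIdx k => (Finset.mem_sdiff.1 h').2 h, add_zero]
  · rw [if_neg h, if_pos (show J ∈ T.bdryIdx k from Finset.mem_sdiff.2 ⟨hJ, h⟩), zero_add]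

/-- Facet functions are discontinuous and need not vanish on other facets of the same simplex; the
boundary functionals must therefore be controlled on every facet function of the adjacent simplex.
-/
theorem interp_facetFun (hd : 2 ≤ d) (hΩ : IsOpen Ω) (hreg : interior (closure Ω) = Ω)
    (hW : T.IsBidual k A W) (hmark : T.IsMark mark) {G : Finset (Space d)} (hG : G ∈ T.facets) :
    T.interp k A W mark (T.facetFun k G) = T.facetFun k G := by
  have hR := T.isRepr_facetFun hreg k G
  have hin : G ∉ T.bdryFacets → G ∈ T.innerFacets := fun h => Finset.mem_sdiff.2 ⟨hG, h⟩
  have e1 : ∀ I ∈ T.innerIdx k,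
      cellDof (W.cellFace (mark I.1) I) (mark I.1) (T.facetFun k G) • T.faceFun A I = 0 := by
    intro I hI
    obtain ⟨h1, h2⟩ := mark_inner hmark hI
    rw [cellDof_eq _ h1 hR]
    by_cases h : G ⊆ mark I.1
    · rw [(hW.1 _ h1).face_facet I h2 G hG h, zero_smul]
    · simp [facetPiece, h]
  have e2 : ∀ F ∈ T.innerFacets,
      cellDof (W.cellFacet (mark F) F) (mark F) (T.facetFun k G) • T.facetFun k F =
        if F = G then T.facetFun k G else 0 := by
    intro F hF
    obtain ⟨h1, h2, h3⟩ := mark_facet hmark hF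
    rw [cellDof_eq _ h1 hR]
    by_cases h : G ⊆ mark F
    · rw [(hW.1 _ h1).facet_facet F h2 h3 G hG h]
      split_ifs with h
      · rw [one_smul, h]
      · rw [zero_smul]
    · have hne : F ≠ G := by
        rintro rfl
        exact h h3
      simp [facetPiece, h, hne]
  have e3 : ∀ I ∈ T.bdryIdx k,
      T.facetDof (W.facetFace (mark I.1) I) (mark I.1) (T.facetFun k G) • T.faceFun A I = 0 := by
    intro I hI
    obtain ⟨h1, h2⟩ := mark_bdry hmark hI
    obtain ⟨K, hK, hFK⟩ := T.exists_cell (mem_faces_of_facet (mem_facets_of_bdry h1))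
    rw [facetDof_eq hd hΩ hreg h1 _ (hR.isTrace hd (mem_facets_of_bdry h1) hK hFK
      (T.facetPiece_mem k hG hK))]
    have hB := hW.2 _ h1 K hK hFK
    by_cases h : G ⊆ K
    -- Biduality covers the boundary facets of `K`; for an inner facet the additional annihilation
    -- condition takes over.
    · by_cases hb : G ∈ T.bdryFacets
      · rw [hB.face_facet I h2 G hb h, zero_smul]
      · rw [hB.face_inner I h2 G (hin hb) h, zero_smul]
    · simp [facetPiece, h]
  have e4 : ∀ F ∈ T.bdryFacets,
      T.facetDof (W.facetFacet F F) F (T.facetFun k G) • T.facetFun k F =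
        if F = G then T.facetFun k G else 0 := by
    intro F hF
    obtain ⟨K, hK, hFK⟩ := T.exists_cell (mem_faces_of_facet (mem_facets_of_bdry hF))
    rw [facetDof_eq hd hΩ hreg hF _ (hR.isTrace hd (mem_facets_of_bdry hF) hK hFK
      (T.facetPiece_mem k hG hK))]
    have hB := hW.2 _ hF K hK hFK
    by_cases h : G ⊆ K
    · by_cases hb : G ∈ T.bdryFacets
      · rw [hB.facet_facet F hF hFK G hb h]
        split_ifs with h
        · rw [one_smul, h]
        · rw [zero_smul]
      · have hne : F ≠ G := by
          rintro rfl
          exact hb hF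
        rw [hB.facet_inner G (hin hb) h, zero_smul, if_neg hne]
    · have hne : F ≠ G := by
        rintro rfl
        exact h hFK
      simp [facetPiece, h, hne]
  unfold interp innerInterp
  rw [Finset.sum_eq_zero e1, Finset.sum_congr rfl e2, Finset.sum_eq_zero e3,
    Finset.sum_congr rfl e4, Finset.sum_ite_eq', Finset.sum_ite_eq', add_zero, zero_add]
  by_cases h : G ∈ T.bdryFacets
  · rw [if_pos h, if_neg fun h' : G ∈ T.innerFacets => (Finset.mem_sdiff.1 h').2 h, zero_add]
  · rw [if_neg h, if_pos (hin h), add_zero]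

/-- Both sides are linear on the span of the basis functions; the existence of traces there is what
makes the boundary functionals additive. -/
theorem interp_eq_self (hd : 2 ≤ d) (hΩ : IsOpen Ω) (hreg : interior (closure Ω) = Ω)
    (hA : T.IsNumbering A) (hk : Odd k) (hW : T.IsBidual k A W) (hmark : T.IsMark mark) {u : L2 Ω}
    (hu : u ∈ T.CR k) : T.interp k A W mark u = u := by
  have htr : ∀ v ∈ Submodule.span ℝ (T.faceFun A '' T.idx k ∪ T.facetFun k '' T.facets),
      ∀ F ∈ T.bdryFacets, ∃ w, T.IsTrace F v w := by
    intro v hv F hF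
    refine exists_isTrace_of_mem_CR hd hΩ hreg hA hk hF (Submodule.span_le.2 ?_ hv)
    rintro _ (⟨I, hI, rfl⟩ | ⟨G, hG, rfl⟩)
    · exact T.faceFun_mem_CR hreg A hk hI
    · exact T.facetFun_mem_CR hk hG
  refine Submodule.span_induction (p := fun u _ => T.interp k A W mark u = u) ?_ ?_ ?_ ?_
    (T.CR_le_span hd hreg hA hk hu)
  · rintro _ (⟨I, hI, rfl⟩ | ⟨G, hG, rfl⟩)
    · exact interp_faceFun hd hΩ hreg hW hmark hI
    · exact interp_facetFun hd hΩ hreg hW hmark hG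
  · have := interp_smul (A := A) (W := W) (k := k) hd hΩ hreg hmark 0 (htr 0 (Submodule.zero_mem _))
    simpa using this
  · intro a b ha hb h1 h2
    rw [interp_add hd hΩ hreg hW hmark (htr a ha) (htr b hb), h1, h2]
  · intro c a ha h1
    rw [interp_smul hd hΩ hreg hmark c (htr a ha), h1]

end Mesh

end

end CrouzeixRaviart

end

/-! ### The main theorem -/

theorem mainTheorem8 (d : ℕ) (hd : 2 ≤ d) (k : ℕ) (hk : Odd k)
    (Ω : Set (CrouzeixRaviart.Space d)) (hΩ_open : IsOpen Ω) (hΩ_conn : IsConnected Ω)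
    (hΩ_reg : interior (closure Ω) = Ω)
    (T : CrouzeixRaviart.Mesh Ω) (hT : 1 < T.cells.card)
    (A : CrouzeixRaviart.Numbering d) (hA : T.IsNumbering A) :
    (∃ W : CrouzeixRaviart.Weights d, T.IsBidual k A W) ∧
    (∀ F ∈ T.bdryFacets, ∀ u ∈ CrouzeixRaviart.H1 Ω ⊔ T.CR k,
      (∃ w, T.IsTrace F u w) ∧
      ∀ w w', T.IsTrace F u w → T.IsTrace F u w' →
        w =ᵐ[CrouzeixRaviart.facetMeasure F] w') ∧
    ∀ W : CrouzeixRaviart.Weights d, T.IsBidual k A W →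
    ∀ mark : Finset (CrouzeixRaviart.Space d) → Finset (CrouzeixRaviart.Space d), T.IsMark mark →
      (∃ P : ↥(CrouzeixRaviart.H1 Ω ⊔ T.CR k) →ₗ[ℝ] ↥(CrouzeixRaviart.H1 Ω ⊔ T.CR k),
        (∀ u, (P u : CrouzeixRaviart.L2 Ω) = T.interp k A W mark u) ∧
        LinearMap.IsProj ((T.CR k).submoduleOf (CrouzeixRaviart.H1 Ω ⊔ T.CR k)) P) ∧
      (∀ u ∈ CrouzeixRaviart.H10 Ω ⊔ T.CR0 k, T.interp k A W mark u ∈ T.CR0 k) ∧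
      (∀ u ∈ CrouzeixRaviart.H10 Ω ⊔ T.CR0 k,
        T.interp k A W mark u = T.innerInterp k A W mark u) := by
  have htr : ∀ u ∈ CrouzeixRaviart.H1 Ω ⊔ T.CR k, ∀ F ∈ T.bdryFacets, ∃ w, T.IsTrace F u w :=
    fun u hu F hF => CrouzeixRaviart.Mesh.exists_isTrace hd hΩ_open hΩ_reg hA hk hF hu
  refine ⟨T.exists_isBidual hd hk hΩ_open hΩ_conn hΩ_reg hT hA, fun F hF u hu =>
    ⟨htr u hu F hF, fun w w' h h' =>
      CrouzeixRaviart.Mesh.isTrace_unique hd hΩ_open hΩ_reg hF h h'⟩,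
    fun W hW mark hmark => ⟨⟨
      { toFun := fun u => ⟨T.interp k A W mark u, Submodule.mem_sup_right
          (CrouzeixRaviart.Mesh.interp_mem_CR hΩ_reg hk _)⟩
        map_add' := fun u v => Subtype.ext (CrouzeixRaviart.Mesh.interp_add hd hΩ_open hΩ_reg hW
          hmark (htr u u.2) (htr v v.2))
        map_smul' := fun c u => Subtype.ext (CrouzeixRaviart.Mesh.interp_smul hd hΩ_open hΩ_reg
          hmark c (htr u u.2)) },
      fun _ => rfl, fun _ => CrouzeixRaviart.Mesh.interp_mem_CR hΩ_reg hk _,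
      fun u hu => Subtype.ext (CrouzeixRaviart.Mesh.interp_eq_self hd hΩ_open hΩ_reg hA hk hW
        hmark hu)⟩, fun u hu => ?_, fun u hu =>
      CrouzeixRaviart.Mesh.interp_eq_innerInterp hd hΩ_open hΩ_reg hk hW hmark hu⟩⟩
  rw [CrouzeixRaviart.Mesh.interp_eq_innerInterp hd hΩ_open hΩ_reg hk hW hmark hu]
  exact CrouzeixRaviart.Mesh.innerInterp_mem_CR0 hΩ_open hΩ_reg hk u
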